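/- For $b\in\mathbb R$ consider the system $$U_t-U_{xx}=\sin x-(b+1)U+U^2V,\qquad V_t-\tfrac1{64}V_{xx}=bU-U^2V$$ on $0<x<\pi$ with Dirichlet boundary conditions $U(0,t)=U(\pi,t)=V(0,t)=V(\pi,t)=0$ for all $t$. A stationary solution is a (classical) solution that does not depend on $t$. Let $\rho=65/64$ and let $\mathcal C$ be the Banach space of functions $f(x)=\sum_{k\ge1}f_k\sin(kx)$, $f_k\in\mathbb C$, with norm $\|f\|=\sum_{k\ge1}|f_k|\rho^k<\infty$. There is a map $b\mapsto(U_b,V_b)\in\mathcal C^2$, real analytic at every point of $[0,11]$, such that for every $b\in[0,11]$: (1) $U_b$ and $V_b$ are real valued and real analytic on $\mathbb R$, and $(U_b,V_b)$ is a stationary solution of the system with parameter $b$; (2) $U_b(\pi-x)=U_b(x)$ and $V_b(\pi-x)=V_b(x)$ for all $x\in[0,\pi]$; (3) $(U_b,V_b)$ is isolated for this fixed $b$: there is $\varepsilon>0$ such that every stationary solution $(u,v)$ of the system with the same $b$, real or complex valued, with $|u-U_b|<\varepsilon$ and $|v-V_b|<\varepsilon$ on $[0,\pi]$ equals $(U_b,V_b)$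 on $[0,\pi]$; (4) there is no symmetry-breaking bifurcation at $b$: there is $\varepsilon>0$ such that every stationary solution $(u,v)$ of the system with a parameter $b'\in(b-\varepsilon,b+\varepsilon)$, real or complex valued, with $|u-U_b|<\varepsilon$ and $|v-V_b|<\varepsilon$ on $[0,\pi]$ is symmetric under $x\mapsto\pi-x$. -/

import Mathlib

open Set

namespace Brusselator

/-! ### The evolution system -/

/-- Regularity and homogeneous Dirichlet conditions for one component `W x t` of a classical
solution on `[0, π] × ℝ`: continuous up to the boundary, differentiable in `t` and twice
continuously differentiable in `x` on the open interval, and zero at `x = 0` and `x = π`. -/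
structure IsDirichletRegular (W : ℝ → ℝ → ℂ) : Prop where
  continuousOn : ContinuousOn (fun p : ℝ × ℝ => W p.1 p.2) (Icc 0 Real.pi ×ˢ univ)
  differentiable_time : ∀ x ∈ Ioo 0 Real.pi, Differentiable ℝ (fun s => W x s)
  contDiffOn_space : ∀ t, ContDiffOn ℝ 2 (fun y => W y t) (Ioo 0 Real.pi)
  boundary_left : ∀ t, W 0 t = 0
  boundary_right : ∀ t, W Real.pi t = 0

/-- `(U, V)`, as functions of `x` and `t`, is a classical (complex valued) solution of
`U_t - U_xx = sin x - (b + 1) U + U² V`, `V_t - (1/64) V_xx = b U - U² V` on `(0, π) × ℝ`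
with homogeneous Dirichlet boundary conditions. -/
structure IsSolution (b : ℝ) (U V : ℝ → ℝ → ℂ) : Prop where
  regular_fst : IsDirichletRegular U
  regular_snd : IsDirichletRegular V
  eq_fst : ∀ x ∈ Ioo 0 Real.pi, ∀ t,
    deriv (fun s => U x s) t - deriv (deriv fun y => U y t) x
      = (Real.sin x : ℂ) - ((b : ℂ) + 1) * U x t + U x t ^ 2 * V x t
  eq_snd : ∀ x ∈ Ioo 0 Real.pi, ∀ t,
    deriv (fun s => V x s) t - (1 / 64 : ℂ) * deriv (deriv fun y => V y t) x
      = (b : ℂ) * U x t - U x t ^ 2 * V x t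

/-- A stationary solution is a solution that does not depend on time. -/
def IsStationarySolution (b : ℝ) (u v : ℝ → ℂ) : Prop :=
  IsSolution b (fun x _ => u x) (fun x _ => v x)

/-- The pairs `(u, v)` and `(u', v')` are uniformly `ε`-close on `[0, π]`. -/
def UniformlyClose (ε : ℝ) (u v u' v' : ℝ → ℂ) : Prop :=
  ∀ x ∈ Icc 0 Real.pi, ‖u' x - u x‖ < ε ∧ ‖v' x - v x‖ < ε

/-- Both components are invariant under the reflection `x ↦ π - x` of `[0, π]`. -/
def IsReflectionSymmetric (u v : ℝ → ℂ) : Prop :=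
  ∀ x ∈ Icc 0 Real.pi, u (Real.pi - x) = u x ∧ v (Real.pi - x) = v x

/-- For the fixed value `b`, no other stationary solution is uniformly close to `(u, v)`. -/
def IsIsolatedStationary (b : ℝ) (u v : ℝ → ℂ) : Prop :=
  ∃ ε > 0, ∀ u' v' : ℝ → ℂ, IsStationarySolution b u' v' → UniformlyClose ε u v u' v' →
    EqOn u' u (Icc 0 Real.pi) ∧ EqOn v' v (Icc 0 Real.pi)

/-- Symmetry-breaking bifurcation at `(b₀, (u, v))`: there are stationary solutions that are not
reflection symmetric, for parameters arbitrarily near `b₀`, arbitrarily close to `(u, v)`. -/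
def IsSymmetryBreakingBifurcation (b₀ : ℝ) (u v : ℝ → ℂ) : Prop :=
  ∀ ε > 0, ∃ b : ℝ, |b - b₀| < ε ∧ ∃ u' v' : ℝ → ℂ, IsStationarySolution b u' v' ∧
    UniformlyClose ε u v u' v' ∧ ¬ IsReflectionSymmetric u' v'

/-! ### The Banach space of sine series -/

/-- The weight `ρ = 65 / 64`. -/
noncomputable def rho : ℝ := 65 / 64

/-- The Banach space of sine series `f = ∑_{k ≥ 1} f_k sin (k x)`, `f_k ∈ ℂ`, with norm
`∑_k |f_k| ρ ^ k`. An element is stored through the sequence `(f_k ρ ^ k)_{k ≥ 1}` in `ℓ¹`;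
since Lean sequences start at `0`, the entry `n` belongs to the frequency `k = n + 1`. -/
abbrev SineSpace : Type := lp (fun _ : ℕ => ℂ) 1

/-- The coefficient `f_{n+1}` of `sin ((n + 1) x)`. -/
noncomputable def SineSpace.coeff (f : SineSpace) (n : ℕ) : ℂ := f n / ((rho ^ (n + 1) : ℝ) : ℂ)

/-- The function `x ↦ ∑_{k ≥ 1} f_k sin (k x)` on the real line. -/
noncomputable def SineSpace.toFun (f : SineSpace) (x : ℝ) : ℂ :=
  ∑' n : ℕ, f.coeff n * (Real.sin ((n + 1 : ℕ) * x) : ℂ)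

theorem rho_pos : 0 < rho := by norm_num [rho]

theorem SineSpace.norm_coeff_mul (f : SineSpace) (n : ℕ) :
    ‖f.coeff n‖ * rho ^ (n + 1) = ‖f n‖ := by
  have h : 0 < rho ^ (n + 1) := pow_pos rho_pos _
  rw [SineSpace.coeff, norm_div, Complex.norm_real, Real.norm_of_nonneg h.le,
    div_mul_cancel₀ _ h.ne']

/-- The norm is the weighted `ℓ¹` norm of the sine coefficients. -/
theorem SineSpace.hasSum_norm (f : SineSpace) :
    HasSum (fun n : ℕ => ‖f.coeff n‖ * rho ^ (n + 1)) ‖f‖ := by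
  simp only [SineSpace.norm_coeff_mul]
  simpa using lp.hasSum_norm (p := 1) (by norm_num) f

/-- Every coefficient sequence with finite weighted norm belongs to the space. -/
theorem SineSpace.exists_coeff_eq (c : ℕ → ℂ)
    (hc : Summable fun n : ℕ => ‖c n‖ * rho ^ (n + 1)) :
    ∃ f : SineSpace, ∀ n, f.coeff n = c n := by
  have hpos : ∀ n : ℕ, 0 < rho ^ (n + 1) := fun n => pow_pos rho_pos _
  refine ⟨⟨fun n => c n * ((rho ^ (n + 1) : ℝ) : ℂ), ?_⟩, fun n => ?_⟩
  · refine memℓp_gen ?_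
    simpa only [norm_mul, Complex.norm_real, Real.norm_of_nonneg (hpos _).le,
      ENNReal.toReal_one, Real.rpow_one] using hc
  · have h : ((rho ^ (n + 1) : ℝ) : ℂ) ≠ 0 := by exact_mod_cast (hpos n).ne'
    exact mul_div_cancel_right₀ _ h

end Brusselator

/-!
The proof follows one branch of stationary solutions with validated numerics, and then excludes other
stationary solutions near it by the implicit function theorem.

With `y = V / 64`, `S = (-d²/dx²)⁻¹` and `R = (1 + S)⁻¹`, the sum of the two stationary equations gives
`U = R (sin x - y)`, and the system becomes the single cubic equation `cubic b y = 0`,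
`y = S (b U - 64 U² y)`. It is studied on sine series with weight `r ^ k`, for every `r` with `1 ≤ r`
and `r ^ 5 ≤ 1081 / 1000`: the weight `r = 65 / 64` is that of the theorem, and `r = 1` is large enough
to contain all stationary solutions.

Approximate zeros with the modes `1, 3, 5` are given at the nodes of `chain` and interpolated in between.
On each cell, `A = precond` is an approximate inverse of the derivative, exact integer arithmetic bounds
the residual and `‖1 - A D‖` at the two nodes (`chainOK_chain`), and convexity together with bounds for
the nonlinear remainder extends this to a ball of radius `1 / 500` around the interpolated path
(`norm_map_cubic_interp_le`, `norm_newton_deriv_le`). Hence each ball contains exactly one zero, and the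
derivative is invertible there (`existsUnique_zero`, `center_zero`). The Newton map preserves real series
with odd frequencies, so the solution is real and symmetric under `x ↦ π - x`. The zeros depend
analytically on `b` because the implicit function theorem applies over `ℂ` and the zero in each ball is
unique (`exists_analytic_branch`); a series with geometric weight converges in a complex strip, so each
solution is real analytic in `x`.

Conversely, two integrations by parts show that the sine coefficients of any stationary solution are
`O(k⁻²)`, and by completeness of the sines the solution is a zero of the cubic map with weight `1`
(`exists_zero_of_isStationarySolution`); solutions that are uniformly close are close in that norm. As
the branch is nondegenerate with weight `1` as well, any two stationary solutions with the same
parameter near a point of the branch coincide (`exists_eqOn_of_uniformlyClose`). Comparing with the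
branch gives isolation, and comparing a solution with its own reflection excludes symmetry breaking.
-/

namespace Brusselator

/-! ### Linear maps on the space of sine series -/

/-- The `n`-th unit vector of the sequence space. -/
noncomputable def unitVec (n : ℕ) : SineSpace := lp.single 1 n (1 : ℂ)

theorem norm_unitVec (n : ℕ) : ‖unitVec n‖ = 1 := by
  simp [unitVec, lp.norm_single]

theorem unitVec_apply (n m : ℕ) : unitVec n m = if m = n then 1 else 0 := by
  by_cases h : m = n
  · subst h; simp [unitVec]
  · simp [unitVec, h]

theorem hasSum_unitVec (f : SineSpace) : HasSum (fun n => f n • unitVec n) f := by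
  convert lp.hasSum_single (p := 1) (by norm_num) f using 2 with n
  rw [unitVec, ← lp.single_smul]
  simp

theorem hasSum_norm_coord (f : SineSpace) : HasSum (fun n => ‖f n‖) ‖f‖ := by
  simpa using lp.hasSum_norm (p := 1) (by norm_num) f

section Lift

variable {F : Type*} [NormedAddCommGroup F] [NormedSpace ℂ F]

theorem clm_ext {f g : SineSpace →L[ℂ] F} (h : ∀ n, f (unitVec n) = g (unitVec n)) : f = g := by
  ext x
  have hf := (hasSum_unitVec x).mapL f
  have hg := (hasSum_unitVec x).mapL g
  simp only [map_smul, h] at hf hg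
  exact hf.unique hg

theorem opNorm_le_of_unitVec (f : SineSpace →L[ℂ] F) {C : ℝ} (hC : 0 ≤ C)
    (h : ∀ n, ‖f (unitVec n)‖ ≤ C) : ‖f‖ ≤ C := by
  refine f.opNorm_le_bound hC fun x => ?_
  have hf := (hasSum_unitVec x).mapL f
  have hx := (hasSum_norm_coord x).mul_left C
  refine hf.norm_le_of_bounded hx fun n => ?_
  rw [map_smul, norm_smul, mul_comm]
  gcongr
  exact h n

variable [CompleteSpace F]

theorem summable_smul_of_bounded {y : ℕ → F} {C : ℝ} (hy : ∀ n, ‖y n‖ ≤ C) (f : SineSpace) :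
    Summable fun n => f n • y n := by
  refine Summable.of_norm_bounded ((hasSum_norm_coord f).mul_left C).summable fun n => ?_
  rw [norm_smul, mul_comm]
  gcongr
  exact hy n

/-- The universal property of `ℓ¹`: the continuous linear map that sends the unit vectors to a
given bounded sequence. -/
noncomputable def lift (y : ℕ → F) (C : ℝ) (hy : ∀ n, ‖y n‖ ≤ C) : SineSpace →L[ℂ] F :=
  LinearMap.mkContinuous
    { toFun := fun f => ∑' n, f n • y n
      map_add' := fun f g => by
        rw [← (summable_smul_of_bounded hy f).tsum_add (summable_smul_of_bounded hy g)]
        simp [add_smul]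
      map_smul' := fun c f => by
        rw [RingHom.id_apply, ← (summable_smul_of_bounded hy f).tsum_const_smul]
        simp [mul_smul] } C (fun f => by
      refine (summable_smul_of_bounded hy f).hasSum.norm_le_of_bounded
        ((hasSum_norm_coord f).mul_left C) fun n => ?_
      rw [norm_smul, mul_comm]
      gcongr
      exact hy n)

theorem lift_apply (y : ℕ → F) (C : ℝ) (hy : ∀ n, ‖y n‖ ≤ C) (f : SineSpace) :
    lift y C hy f = ∑' n, f n • y n := rfl

theorem hasSum_lift (y : ℕ → F) (C : ℝ) (hy : ∀ n, ‖y n‖ ≤ C) (f : SineSpace) :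
    HasSum (fun n => f n • y n) (lift y C hy f) :=
  (summable_smul_of_bounded hy f).hasSum

@[simp] theorem lift_unitVec (y : ℕ → F) (C : ℝ) (hy : ∀ n, ‖y n‖ ≤ C) (n : ℕ) :
    lift y C hy (unitVec n) = y n := by
  rw [lift_apply, tsum_eq_single n]
  · simp [unitVec_apply]
  · intro m hm
    simp [unitVec_apply, hm]

theorem norm_lift_le (y : ℕ → F) (C : ℝ) (hy : ∀ n, ‖y n‖ ≤ C) : ‖lift y C hy‖ ≤ C :=
  opNorm_le_of_unitVec _ ((norm_nonneg _).trans (hy 0)) fun n => by simpa using hy n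

end Lift

theorem norm_lift_apply_le {F : Type*} [NormedAddCommGroup F] [NormedSpace ℂ F] [CompleteSpace F]
    (y : ℕ → F) (C : ℝ) (hy : ∀ n, ‖y n‖ ≤ C) (f : SineSpace) : ‖lift y C hy f‖ ≤ C * ‖f‖ := by
  refine (hasSum_lift y C hy f).norm_le_of_bounded ((hasSum_norm_coord f).mul_left C) fun n => ?_
  rw [norm_smul, mul_comm]
  gcongr
  exact hy n

/-- The diagonal operator with bounded symbol `d`. -/
noncomputable def diag (d : ℕ → ℂ) (C : ℝ) (hd : ∀ n, ‖d n‖ ≤ C) : SineSpace →L[ℂ] SineSpace :=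
  lift (fun n => d n • unitVec n) C fun n => by simpa [norm_smul, norm_unitVec] using hd n

@[simp] theorem diag_unitVec (d : ℕ → ℂ) (C : ℝ) (hd : ∀ n, ‖d n‖ ≤ C) (n : ℕ) :
    diag d C hd (unitVec n) = d n • unitVec n := by simp [diag]

theorem coord_diag (d : ℕ → ℂ) (C : ℝ) (hd : ∀ n, ‖d n‖ ≤ C) (f : SineSpace) (n : ℕ) :
    diag d C hd f n = d n * f n := by
  have h : (lp.evalCLM ℂ (fun _ : ℕ => ℂ) 1 n).comp (diag d C hd)
      = d n • lp.evalCLM ℂ (fun _ : ℕ => ℂ) 1 n := by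
    refine clm_ext fun m => ?_
    have he : lp.evalCLM ℂ (fun _ : ℕ => ℂ) 1 n (unitVec m) = unitVec m n := rfl
    by_cases hm : n = m
    · subst hm; simp
    · simp [he, unitVec_apply, hm]
  exact DFunLike.congr_fun h f

theorem norm_diag_le (d : ℕ → ℂ) (C : ℝ) (hd : ∀ n, ‖d n‖ ≤ C) : ‖diag d C hd‖ ≤ C :=
  norm_lift_le _ _ _

theorem norm_inv_sq_le (n : ℕ) : ‖(1 / ((n : ℂ) + 1) ^ 2)‖ ≤ 1 := by
  have : ‖(n : ℂ) + 1‖ = (n : ℝ) + 1 := by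
    rw [← Nat.cast_succ, Complex.norm_natCast]; push_cast; ring
  rw [norm_div, norm_one, norm_pow, this, div_le_one (by positivity)]
  nlinarith [(Nat.cast_nonneg n : (0 : ℝ) ≤ n)]

/-- The inverse of `-d²/dx²` with Dirichlet boundary conditions: `sin (k x) ↦ k⁻² sin (k x)`. -/
noncomputable def invLap : SineSpace →L[ℂ] SineSpace :=
  diag (fun n => 1 / ((n : ℂ) + 1) ^ 2) 1 norm_inv_sq_le

theorem sq_add_one_ne_zero (n : ℕ) : ((n : ℂ) + 1) ^ 2 + 1 ≠ 0 := by
  have : (((n : ℝ) + 1) ^ 2 + 1 : ℝ) ≠ 0 := by positivity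
  exact_mod_cast this

theorem norm_sq_div_le (n : ℕ) : ‖(((n : ℂ) + 1) ^ 2 / (((n : ℂ) + 1) ^ 2 + 1))‖ ≤ 1 := by
  have h1 : (((n : ℂ) + 1) ^ 2 / (((n : ℂ) + 1) ^ 2 + 1))
      = ((((n : ℝ) + 1) ^ 2 / (((n : ℝ) + 1) ^ 2 + 1) : ℝ) : ℂ) := by push_cast; ring
  rw [h1, Complex.norm_real, Real.norm_of_nonneg (by positivity), div_le_one (by positivity)]
  linarith

/-- The operator `(1 + (-Δ)⁻¹)⁻¹`: `sin (k x) ↦ k² / (k² + 1) sin (k x)`. -/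
noncomputable def resolv : SineSpace →L[ℂ] SineSpace :=
  diag (fun n => ((n : ℂ) + 1) ^ 2 / (((n : ℂ) + 1) ^ 2 + 1)) 1 norm_sq_div_le

theorem norm_resolv_le : ‖resolv‖ ≤ 1 := norm_diag_le _ _ _

theorem resolv_add_invLap_resolv (f : SineSpace) : resolv f + invLap (resolv f) = f := by
  have h : resolv + invLap.comp resolv = ContinuousLinearMap.id ℂ SineSpace := by
    refine clm_ext fun n => ?_
    have h1 : ((n : ℂ) + 1) ≠ 0 := by exact_mod_cast n.succ_ne_zero
    have h2 := sq_add_one_ne_zero n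
    simp only [resolv, invLap, add_apply, ContinuousLinearMap.comp_apply,
      diag_unitVec, map_smul, ContinuousLinearMap.id_apply]
    match_scalars
    field_simp
  exact DFunLike.congr_fun h f

/-! ### The vectors of the functions `sin (m x)` -/

/-- The vector of the function `x ↦ sin (m x)`, for integer `m`, in the space of sine series with
weights `r ^ k`. -/
noncomputable def sineVec (r : ℝ) (m : ℤ) : SineSpace :=
  ((m.sign : ℂ) * (r : ℂ) ^ m.natAbs) • unitVec (m.natAbs - 1)

section Sine

variable (r : ℝ)

theorem sineVec_succ (n : ℕ) : sineVec r ((n : ℤ) + 1) = ((r : ℂ) ^ (n + 1)) • unitVec n := by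
  have h1 : ((n : ℤ) + 1).sign = 1 := Int.sign_eq_one_of_pos (by positivity)
  have h2 : ((n : ℤ) + 1).natAbs = n + 1 := by omega
  simp [sineVec, h1, h2]

@[simp] theorem sineVec_zero : sineVec r 0 = 0 := by simp [sineVec]

theorem sineVec_neg (m : ℤ) : sineVec r (-m) = - sineVec r m := by
  simp [sineVec, Int.sign_neg]

theorem unitVec_eq [h : Fact (1 ≤ r)] (n : ℕ) :
    unitVec n = ((r : ℂ) ^ (n + 1))⁻¹ • sineVec r ((n : ℤ) + 1) := by
  have hr : (r : ℂ) ^ (n + 1) ≠ 0 := by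
    have : (0 : ℝ) < r ^ (n + 1) := pow_pos (by linarith [h.out]) _
    exact_mod_cast this.ne'
  rw [sineVec_succ, smul_smul, inv_mul_cancel₀ hr, one_smul]

theorem norm_sineVec_le [h : Fact (1 ≤ r)] (m : ℤ) : ‖sineVec r m‖ ≤ r ^ m.natAbs := by
  have hr : (0 : ℝ) ≤ r := by linarith [h.out]
  rw [sineVec, norm_smul, norm_unitVec, mul_one, norm_mul, norm_pow, Complex.norm_real,
    Real.norm_of_nonneg hr]
  have : ‖(m.sign : ℂ)‖ ≤ 1 := by
    rcases m.sign_trichotomy with h | h | h <;> simp [h]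
  calc _ ≤ 1 * r ^ m.natAbs := by gcongr
    _ = _ := one_mul _

theorem norm_sineVec_le' [h : Fact (1 ≤ r)] {m : ℤ} {N : ℕ} (hm : m.natAbs ≤ N) :
    ‖sineVec r m‖ ≤ r ^ N :=
  (norm_sineVec_le r m).trans (pow_le_pow_right₀ h.out hm)

variable {F : Type*} [NormedAddCommGroup F] [NormedSpace ℂ F]

theorem clm_ext_sineVec [Fact (1 ≤ r)] {f g : SineSpace →L[ℂ] F}
    (h : ∀ n : ℕ, f (sineVec r ((n : ℤ) + 1)) = g (sineVec r ((n : ℤ) + 1))) : f = g := by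
  refine clm_ext fun n => ?_
  rw [unitVec_eq r, map_smul, map_smul, h]

theorem opNorm_le_of_sineVec [hr : Fact (1 ≤ r)] (f : SineSpace →L[ℂ] F) {C : ℝ} (hC : 0 ≤ C)
    (h : ∀ n : ℕ, ‖f (sineVec r ((n : ℤ) + 1))‖ ≤ C * r ^ (n + 1)) : ‖f‖ ≤ C := by
  refine opNorm_le_of_unitVec f hC fun n => ?_
  have hp : (0 : ℝ) < r ^ (n + 1) := pow_pos (by linarith [hr.out]) _
  rw [unitVec_eq r, map_smul, norm_smul, norm_inv, norm_pow, Complex.norm_real,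
    Real.norm_of_nonneg (by linarith [hr.out]), inv_mul_le_iff₀ hp, mul_comm]
  exact h n

theorem diag_sineVec (d : ℕ → ℂ) (C : ℝ) (hd : ∀ n, ‖d n‖ ≤ C) (n : ℕ) :
    diag d C hd (sineVec r ((n : ℤ) + 1)) = d n • sineVec r ((n : ℤ) + 1) := by
  rw [sineVec_succ, map_smul, diag_unitVec, smul_comm]

end Sine

/-! ### Products of three sine series -/

section Triple

variable (r : ℝ)

/-- The sine series of `sin (a x) sin (b x) sin (c x)`. -/
noncomputable def sineTriple (a b c : ℤ) : SineSpace :=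
  (1 / 4 : ℂ) • (sineVec r (c + (a - b)) + sineVec r (c - (a - b))
    - sineVec r (c + (a + b)) - sineVec r (c - (a + b)))

theorem sineTriple_comm (a b c : ℤ) : sineTriple r a b c = sineTriple r b a c := by
  simp only [sineTriple]
  rw [show c + (a - b) = c - (b - a) by ring, show c - (a - b) = c + (b - a) by ring,
    add_comm a b]
  module

theorem sineTriple_comm' (a b c : ℤ) : sineTriple r a b c = sineTriple r a c b := by
  simp only [sineTriple]
  rw [show c - (a - b) = -(a - c - b) by ring, show b - (a - c) = -(a - b - c) by ring,
    show c - (a + b) = -(b + (a - c)) by ring, show b - (a + c) = - (c + (a - b)) by ring,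
    show b + (a + c) = c + (a + b) by ring, show a - c - b = a - b - c by ring]
  simp only [sineVec_neg]
  module

theorem norm_sineTriple_le [hr : Fact (1 ≤ r)] (i j k : ℕ) :
    ‖sineTriple r ((i : ℤ) + 1) ((j : ℤ) + 1) ((k : ℤ) + 1)‖ ≤ r ^ (i + j + k + 3) := by
  rw [sineTriple, norm_smul]
  have h : ∀ m : ℤ, m.natAbs ≤ i + j + k + 3 → ‖sineVec r m‖ ≤ r ^ (i + j + k + 3) :=
    fun m hm => norm_sineVec_le' r hm
  set a := sineVec r ((k : ℤ) + 1 + ((i : ℤ) + 1 - ((j : ℤ) + 1))) with ha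
  set b := sineVec r ((k : ℤ) + 1 - ((i : ℤ) + 1 - ((j : ℤ) + 1))) with hb
  set c := sineVec r ((k : ℤ) + 1 + ((i : ℤ) + 1 + ((j : ℤ) + 1))) with hc
  set d := sineVec r ((k : ℤ) + 1 - ((i : ℤ) + 1 + ((j : ℤ) + 1))) with hd
  have h1 : ‖a‖ ≤ _ := h _ (by omega)
  have h2 : ‖b‖ ≤ _ := h _ (by omega)
  have h3 : ‖c‖ ≤ _ := h _ (by omega)
  have h4 : ‖d‖ ≤ _ := h _ (by omega)
  have h5 := norm_sub_le (a + b - c) d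
  have h6 := norm_sub_le (a + b) c
  have h7 := norm_add_le a b
  have h8 : ‖(1 / 4 : ℂ)‖ = 1 / 4 := by norm_num
  rw [h8]
  linarith

theorem norm_smul_sineTriple_le [hr : Fact (1 ≤ r)] (i j k : ℕ) :
    ‖((r : ℂ) ^ (i + j + k + 3))⁻¹ • sineTriple r ((i : ℤ) + 1) ((j : ℤ) + 1) ((k : ℤ) + 1)‖
      ≤ 1 := by
  have hp : (0 : ℝ) < r ^ (i + j + k + 3) := pow_pos (by linarith [hr.out]) _
  rw [norm_smul, norm_inv, norm_pow, Complex.norm_real,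
    Real.norm_of_nonneg (by linarith [hr.out]), inv_mul_le_iff₀ hp, mul_one]
  exact norm_sineTriple_le r i j k

/-- The pointwise product of three sine series, as a trilinear map of norm at most one. -/
noncomputable def mul3 [Fact (1 ≤ r)] :
    SineSpace →L[ℂ] SineSpace →L[ℂ] SineSpace →L[ℂ] SineSpace :=
  lift (fun i => lift (fun j => lift (fun k =>
    ((r : ℂ) ^ (i + j + k + 3))⁻¹ • sineTriple r ((i : ℤ) + 1) ((j : ℤ) + 1) ((k : ℤ) + 1)) 1
    (norm_smul_sineTriple_le r i j)) 1 fun _ => norm_lift_le _ _ _) 1 fun _ => norm_lift_le _ _ _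

variable [hr : Fact (1 ≤ r)]

theorem norm_mul3_le (f g h : SineSpace) : ‖mul3 r f g h‖ ≤ ‖f‖ * ‖g‖ * ‖h‖ := by
  have h1 : ‖mul3 r f‖ ≤ 1 * ‖f‖ := norm_lift_apply_le _ _ _ f
  calc _ ≤ ‖mul3 r f g‖ * ‖h‖ := (mul3 r f g).le_opNorm h
    _ ≤ (‖mul3 r f‖ * ‖g‖) * ‖h‖ := by gcongr; exact (mul3 r f).le_opNorm g
    _ ≤ (1 * ‖f‖ * ‖g‖) * ‖h‖ := by gcongr
    _ = _ := by ring

theorem norm_mul3_le_clm (f g : SineSpace) : ‖mul3 r f g‖ ≤ ‖f‖ * ‖g‖ :=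
  ContinuousLinearMap.opNorm_le_bound _ (by positivity) fun h => norm_mul3_le r f g h

theorem mul3_unitVec (i j k : ℕ) : mul3 r (unitVec i) (unitVec j) (unitVec k)
    = ((r : ℂ) ^ (i + j + k + 3))⁻¹ •
      sineTriple r ((i : ℤ) + 1) ((j : ℤ) + 1) ((k : ℤ) + 1) := by
  simp [mul3]

theorem mul3_sineVec (i j k : ℕ) :
    mul3 r (sineVec r ((i : ℤ) + 1)) (sineVec r ((j : ℤ) + 1)) (sineVec r ((k : ℤ) + 1))
      = sineTriple r ((i : ℤ) + 1) ((j : ℤ) + 1) ((k : ℤ) + 1) := by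
  have hp : ∀ n : ℕ, (r : ℂ) ^ n ≠ 0 := fun n => by
    have : (0 : ℝ) < r ^ n := pow_pos (by linarith [hr.out]) _
    exact_mod_cast this.ne'
  rw [sineVec_succ, sineVec_succ, sineVec_succ]
  simp only [map_smul, smul_apply, mul3_unitVec, smul_smul]
  have : (r : ℂ) ^ (k + 1) * ((r : ℂ) ^ (j + 1) * ((r : ℂ) ^ (i + 1)
      * ((r : ℂ) ^ (i + j + k + 3))⁻¹)) = 1 := by
    have := hp (i + j + k + 3)
    field_simp
    ring
  first
  | rw [this, one_smul]
  | (convert one_smul ℂ (sineTriple r ((i : ℤ) + 1) ((j : ℤ) + 1) ((k : ℤ) + 1)) using 2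
     rw [← this]; ring)

/-- Two trilinear maps agree if they agree on unit vectors. -/
theorem clm_ext3 {F : Type*} [NormedAddCommGroup F] [NormedSpace ℂ F]
    {f g : SineSpace →L[ℂ] SineSpace →L[ℂ] SineSpace →L[ℂ] F}
    (h : ∀ i j k : ℕ, f (unitVec i) (unitVec j) (unitVec k)
      = g (unitVec i) (unitVec j) (unitVec k)) : f = g :=
  clm_ext fun i => clm_ext fun j => clm_ext fun k => h i j k

theorem mul3_comm (f g h : SineSpace) : mul3 r f g h = mul3 r g f h := by
  have : mul3 r = (mul3 r).flip := clm_ext3 fun i j k => by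
    simp only [ContinuousLinearMap.flip_apply, mul3_unitVec]
    rw [sineTriple_comm, show i + j + k = j + i + k by ring]
  exact DFunLike.congr_fun (DFunLike.congr_fun (DFunLike.congr_fun this f) g) h

theorem mul3_comm' (f g h : SineSpace) : mul3 r f g h = mul3 r f h g := by
  have hf : ∀ i, mul3 r (unitVec i) = (mul3 r (unitVec i)).flip := fun i =>
    clm_ext fun j => clm_ext fun k => by
      simp only [ContinuousLinearMap.flip_apply, mul3_unitVec]
      rw [sineTriple_comm', show i + j + k = i + k + j by ring]
  have key : ((mul3 r).flip g).flip h = ((mul3 r).flip h).flip g := clm_ext fun i => by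
    simp only [ContinuousLinearMap.flip_apply]
    conv_lhs => rw [hf i]
    rfl
  exact DFunLike.congr_fun key f

end Triple

/-! ### A cubic equation in a Banach space -/

section Cubic

open Filter Topology
open scoped ContDiff

variable {E : Type*} [NormedAddCommGroup E] [NormedSpace ℂ E]
  (S R : E →L[ℂ] E) (T : E →L[ℂ] E →L[ℂ] E →L[ℂ] E) (s : E)

/-- The map whose zeros are the stationary solutions: for `S = (-Δ)⁻¹`, `R = (1 + S)⁻¹`, the pointwise
product `T` of three functions and `s = sin x`, the equation `cubic b y = 0` says that `u = R (s - y)`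
and `v = 64 y` solve the stationary system. The parameter is complex so that the implicit function
theorem yields analyticity. -/
noncomputable def cubic (b : ℂ) (y : E) : E :=
  y - S (b • R (s - y) - (64 : ℂ) • T (R (s - y)) (R (s - y)) y)

/-- The derivative of `cubic b` at `y` is `1 + S ∘ linPart b u y` with `u = R (s - y)`. -/
noncomputable def linPart (b : ℂ) (u y : E) : E →L[ℂ] E :=
  b • R + (64 : ℂ) • T u u - (128 : ℂ) • (T u y).comp R

variable {T}

theorem hasFDerivAt_cubic (h1 : ∀ f g h, T f g h = T g f h) (h2 : ∀ f g h, T f g h = T f h g)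
    (b : ℂ) (y : E) :
    HasFDerivAt (cubic S R T s b) (1 + S.comp (linPart R T b (R (s - y)) y)) y := by
  have hu : HasFDerivAt (fun y => R (s - y)) (-R) y := by
    refine (R.hasFDerivAt.comp y ((hasFDerivAt_id (𝕜 := ℂ) y).const_sub s)).congr_fderiv ?_
    ext w
    simp
  have hTu : HasFDerivAt (fun y => T (R (s - y))) (T.comp (-R)) y :=
    HasFDerivAt.comp (G := E →L[ℂ] E →L[ℂ] E) (g := T) y T.hasFDerivAt hu
  have hT := ((hTu.clm_apply hu).clm_apply (hasFDerivAt_id (𝕜 := ℂ) y)).const_smul (64 : ℂ)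
  have hS := S.hasFDerivAt.comp y ((hu.const_smul b).sub hT)
  refine ((hasFDerivAt_id (𝕜 := ℂ) y).sub hS).congr_fderiv ?_
  ext w
  have e1 : T (R (s - y)) (R w) y = T (R (s - y)) y (R w) := h2 _ _ _
  have e2 : T (R w) (R (s - y)) y = T (R (s - y)) y (R w) := by rw [h1, h2]
  clear hu hTu hT hS
  generalize R (s - y) = u at *
  simp only [linPart, add_apply, sub_apply,
    ContinuousLinearMap.comp_apply, smul_apply, neg_apply,
    ContinuousLinearMap.flip_apply, ContinuousLinearMap.id_apply, one_apply_eq_self,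
    map_neg, map_add, map_sub, map_smul, id, e1, e2]
  module

variable (T) in
theorem contDiff_cubic : ContDiff ℂ ω (fun p : ℂ × E => cubic S R T s p.1 p.2) := by
  have hu : ContDiff ℂ ω (fun p : ℂ × E => R (s - p.2)) :=
    R.contDiff.comp (contDiff_const.sub contDiff_snd)
  have hT0 : ContDiff ℂ ω (fun z : E => T z) :=
    ContinuousLinearMap.contDiff (𝕜 := ℂ) (E := E) (F := E →L[ℂ] E →L[ℂ] E) T
  have hT : ContDiff ℂ ω (fun p : ℂ × E => T (R (s - p.2)) (R (s - p.2)) p.2) :=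
    ((ContDiff.comp (F := E) (G := E →L[ℂ] E →L[ℂ] E) (g := fun z => T z) hT0 hu).clm_apply
      hu).clm_apply contDiff_snd
  exact contDiff_snd.sub (S.contDiff.comp ((contDiff_fst.smul hu).sub (hT.const_smul _)))

/-- At a nondegenerate zero, the zero set is locally the graph of an analytic function. -/
theorem exists_local_branch [CompleteSpace E]
    (h1 : ∀ f g h, T f g h = T g f h) (h2 : ∀ f g h, T f g h = T f h g)
    {b : ℂ} {y : E} (h0 : cubic S R T s b y = 0)
    (hD : IsUnit (1 + S.comp (linPart R T b (R (s - y)) y))) :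
    ∃ φ : ℂ → E, AnalyticAt ℂ φ b ∧ φ b = y ∧ (∀ᶠ c in 𝓝 b, cubic S R T s c (φ c) = 0) ∧
      ∀ᶠ p in 𝓝 (b, y), cubic S R T s p.1 p.2 = 0 ↔ φ p.1 = p.2 := by
  set f := fun p : ℂ × E => cubic S R T s p.1 p.2 with hf
  have cdf : ContDiffAt ℂ ω f (b, y) := (contDiff_cubic S R T s).contDiffAt
  have hcomp : fderiv ℂ f (b, y) ∘L .inr ℂ ℂ E = 1 + S.comp (linPart R T b (R (s - y)) y) := by
    have hd : HasFDerivAt f (fderiv ℂ f (b, y)) (b, y) :=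
      (cdf.differentiableAt (by simp)).hasFDerivAt
    have hi : HasFDerivAt (fun z : E => (b, z)) (.inr ℂ ℂ E) y := hasFDerivAt_prodMk_right b y
    exact (hd.comp y hi).unique (hasFDerivAt_cubic S R s h1 h2 b y)
  have hinv : (fderiv ℂ f (b, y) ∘L .inr ℂ ℂ E).IsInvertible := by
    rw [hcomp]
    obtain ⟨U, hU⟩ := hD
    exact ⟨ContinuousLinearEquiv.unitsEquiv ℂ E U, by rw [← hU]; rfl⟩
  refine ⟨cdf.implicitFunction (by simp) hinv,
    (cdf.contDiffAt_implicitFunction (by simp) hinv).analyticAt,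
    cdf.implicitFunction_apply_self (by simp) hinv, ?_, ?_⟩
  · filter_upwards [cdf.eventually_apply_implicitFunction (by simp) hinv] with c hc
    exact hc.trans h0
  · filter_upwards [cdf.eventually_apply_eq_iff_implicitFunction (by simp) hinv] with p hp
    rw [← hp]
    exact ⟨fun h => h.trans h0.symm, fun h => h.trans h0⟩

/-- An operator that differs from the identity by finite rank and has a right inverse is injective:
it is surjective, hence injective, on a finite-dimensional space that contains its kernel. -/
theorem injective_of_mul_eq_one {A C : E →L[ℂ] E} (W : Submodule ℂ E) [FiniteDimensional ℂ W]
    (hW : ∀ x, A x - x ∈ W) (h : A * C = 1) : Function.Injective A := by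
  have hAW : ∀ x ∈ W, A x ∈ W := fun x hx => by
    have := W.add_mem (hW x) hx
    simpa using this
  have hsurj : Function.Surjective ((A : E →ₗ[ℂ] E).restrict hAW) := by
    rintro ⟨w, hw⟩
    have h1 : A (C w) = w := DFunLike.congr_fun h w
    have h2 : C w ∈ W := by
      have := W.sub_mem hw (hW (C w))
      rw [h1] at this
      simpa using this
    exact ⟨⟨C w, h2⟩, Subtype.ext h1⟩
  have hinj := LinearMap.injective_iff_surjective.2 hsurj
  refine (injective_iff_map_eq_zero A).2 fun x hx => ?_
  have hxW : x ∈ W := by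
    have := W.neg_mem (hW x)
    rw [hx] at this
    simpa using this
  have := @hinj ⟨x, hxW⟩ 0 (Subtype.ext (by simpa using hx))
  simpa using congrArg Subtype.val this

/-- The Newton–Kantorovich argument for `cubic`: if `A` is an approximate left inverse of the
derivative on a ball, and the centre is an approximate zero, then the ball contains exactly one
zero, it is nondegenerate, and it inherits closed constraints that the Newton map respects. -/
theorem existsUnique_zero [CompleteSpace E]
    (h1 : ∀ f g h, T f g h = T g f h) (h2 : ∀ f g h, T f g h = T f h g)
    {A : E →L[ℂ] E} (W : Submodule ℂ E) [FiniteDimensional ℂ W] (hW : ∀ x, A x - x ∈ W)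
    {b : ℂ} {c : E} {ρ κ δ : ℝ} (hδ : ‖A (cubic S R T s b c)‖ ≤ δ) (hκ0 : 0 ≤ κ)
    (hκ : ∀ y ∈ Metric.closedBall c ρ,
      ‖1 - A * (1 + S.comp (linPart R T b (R (s - y)) y))‖ ≤ κ)
    (hρ0 : 0 < ρ) (hρ : δ + κ * ρ < ρ)
    {P : Set E} (hPc : IsClosed P) (hcP : c ∈ P)
    (hP : ∀ y ∈ P, y - A (cubic S R T s b y) ∈ P) :
    (∃ y ∈ Metric.ball c ρ, y ∈ P ∧ cubic S R T s b y = 0) ∧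
    (∀ y ∈ Metric.closedBall c ρ, ∀ z ∈ Metric.closedBall c ρ, cubic S R T s b y = 0 →
      cubic S R T s b z = 0 → y = z) ∧
    ∀ y ∈ Metric.closedBall c ρ, IsUnit (1 + S.comp (linPart R T b (R (s - y)) y)) := by
  have hδ0 : 0 ≤ δ := (norm_nonneg _).trans hδ
  have hκ1 : κ < 1 := by
    by_contra hneg
    nlinarith
  set N : E → E := fun y => y - A (cubic S R T s b y) with hN
  have hder : ∀ y, HasFDerivAt N (1 - A * (1 + S.comp (linPart R T b (R (s - y)) y))) y := by
    intro y
    exact (hasFDerivAt_id (𝕜 := ℂ) y).sub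
      (A.hasFDerivAt.comp y (hasFDerivAt_cubic S R s h1 h2 b y))
  have hlip : ∀ y ∈ Metric.closedBall c ρ, ∀ z ∈ Metric.closedBall c ρ,
      ‖N z - N y‖ ≤ κ * ‖z - y‖ := by
    intro y hy z hz
    let : NormedSpace ℝ E := NormedSpace.restrictScalars ℝ ℂ E
    exact (convex_closedBall c ρ).norm_image_sub_le_of_norm_hasFDerivWithin_le
      (fun x _ => (hder x).hasFDerivWithinAt) hκ hy hz
  have hcc : c ∈ Metric.closedBall c ρ := Metric.mem_closedBall_self hρ0.le
  have hNc : ‖N c - c‖ ≤ δ := by simpa [hN] using hδ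
  have hmaps : MapsTo N (Metric.closedBall c ρ ∩ P) (Metric.closedBall c ρ ∩ P) := by
    rintro y ⟨hy, hyP⟩
    refine ⟨?_, hP y hyP⟩
    have h3 := hlip c hcc y hy
    have h4 : ‖y - c‖ ≤ ρ := by simpa [dist_eq_norm] using hy
    rw [Metric.mem_closedBall, dist_eq_norm]
    calc ‖N y - c‖ = ‖(N y - N c) + (N c - c)‖ := by congr 1; abel
      _ ≤ ‖N y - N c‖ + ‖N c - c‖ := norm_add_le _ _
      _ ≤ κ * ρ + δ := by
        have := mul_le_mul_of_nonneg_left h4 hκ0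
        linarith
      _ ≤ ρ := by linarith
  have hunit : ∀ y ∈ Metric.closedBall c ρ,
      IsUnit (A * (1 + S.comp (linPart R T b (R (s - y)) y))) := by
    intro y hy
    have := isUnit_one_sub_of_norm_lt_one ((hκ y hy).trans_lt hκ1)
    simpa using this
  -- A zero of `A ∘ cubic` is a zero of `cubic` because `A` is injective.
  have hA : Function.Injective A := by
    obtain ⟨U, hU⟩ := hunit c hcc
    refine injective_of_mul_eq_one W hW
      (C := (1 + S.comp (linPart R T b (R (s - c)) c)) * (↑U⁻¹ : E →L[ℂ] E)) ?_
    rw [← mul_assoc, ← hU, Units.mul_inv]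
  refine ⟨?_, ?_, ?_⟩
  -- The zero is the fixed point of the Newton map `N` in the ball and in `P`.
  · have hcomp : IsComplete (Metric.closedBall c ρ ∩ P) :=
      (Metric.isClosed_closedBall.inter hPc).isComplete
    have hcontr : ContractingWith ⟨κ, hκ0⟩ (hmaps.restrict N _ _) := by
      refine ⟨by exact_mod_cast hκ1, LipschitzWith.of_dist_le_mul fun y z => ?_⟩
      rw [Subtype.dist_eq, Subtype.dist_eq, dist_eq_norm, dist_eq_norm]
      exact hlip z z.2.1 y y.2.1
    obtain ⟨y, hy, hfix, -⟩ := hcontr.exists_fixedPoint' hcomp hmaps ⟨hcc, hcP⟩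
      (edist_ne_top _ _)
    have hyN : N y = y := hfix
    refine ⟨y, ?_, hy.2, hA ?_⟩
    · rw [Metric.mem_ball, dist_eq_norm]
      have h3 := hlip c hcc y hy.1
      have h5 : ‖y - c‖ ≤ κ * ‖y - c‖ + δ := by
        calc ‖y - c‖ = ‖(N y - N c) + (N c - c)‖ := by congr 1; rw [hyN]; abel
          _ ≤ ‖N y - N c‖ + ‖N c - c‖ := norm_add_le _ _
          _ ≤ _ := by linarith
      nlinarith
    · rw [map_zero]
      simpa [hN] using hyN
  · intro y hy z hz hy0 hz0
    have h3 := hlip z hz y hy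
    have h4 : N y - N z = y - z := by simp [hN, hy0, hz0]
    rw [h4] at h3
    have h5 : ‖y - z‖ ≤ 0 := by
      by_contra hneg
      nlinarith [norm_nonneg (y - z)]
    exact sub_eq_zero.1 (norm_le_zero_iff.1 h5)
  · intro y hy
    obtain ⟨U, hU⟩ := hunit y hy
    set D := 1 + S.comp (linPart R T b (R (s - y)) y) with hD
    have hl : ((↑U⁻¹ : E →L[ℂ] E) * A) * D = 1 := by rw [mul_assoc, ← hU, Units.inv_mul]
    have hr : D * ((↑U⁻¹ : E →L[ℂ] E) * A) = 1 := by
      ext x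
      apply hA
      have h6 : A * D * (↑U⁻¹ : E →L[ℂ] E) = 1 := by rw [← hU, Units.mul_inv]
      exact DFunLike.congr_fun h6 (A x)
    exact ⟨⟨D, _, hr, hl⟩, rfl⟩

end Cubic

/-! ### Interpolation between two approximate zeros -/

section Interpolation

variable {E : Type*} [NormedAddCommGroup E] [NormedSpace ℂ E]
  {S R A : E →L[ℂ] E} {T : E →L[ℂ] E →L[ℂ] E →L[ℂ] E} {s : E}

/-- Affine interpolation, with a real parameter cast to `ℂ`. -/
noncomputable def interp {F : Type*} [AddCommGroup F] [Module ℂ F] (x y : F) (θ : ℝ) : F :=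
  (1 - (θ : ℂ)) • x + (θ : ℂ) • y

theorem norm_one_sub_cast {θ : ℝ} (h : θ ∈ Icc (0 : ℝ) 1) : ‖(1 - (θ : ℂ))‖ = 1 - θ := by
  rw [← Complex.ofReal_one, ← Complex.ofReal_sub, Complex.norm_real,
    Real.norm_of_nonneg (by linarith [h.2])]

theorem norm_cast_unit {θ : ℝ} (h : θ ∈ Icc (0 : ℝ) 1) : ‖(θ : ℂ)‖ = θ := by
  rw [Complex.norm_real, Real.norm_of_nonneg h.1]

theorem norm_interp_le {F : Type*} [NormedAddCommGroup F] [NormedSpace ℂ F] {x y : F} {θ C : ℝ}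
    (h : θ ∈ Icc (0 : ℝ) 1) (hx : ‖x‖ ≤ C) (hy : ‖y‖ ≤ C) : ‖interp x y θ‖ ≤ C := by
  refine (norm_add_le _ _).trans ?_
  rw [norm_smul, norm_smul, norm_one_sub_cast h, norm_cast_unit h]
  nlinarith [h.1, h.2]

theorem norm_mul_one_sub_le {θ : ℝ} (h : θ ∈ Icc (0 : ℝ) 1) :
    ‖(θ : ℂ) * (1 - θ)‖ ≤ 1 / 4 := by
  rw [norm_mul, norm_one_sub_cast h, norm_cast_unit h]
  nlinarith [sq_nonneg (θ - 1 / 2)]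

theorem resolv_sub_interp (y₀ y₁ : E) (θ : ℝ) :
    R (s - interp y₀ y₁ θ) = interp (R (s - y₀)) (R (s - y₁)) θ := by
  simp only [interp, map_sub, map_add, map_smul]
  module

variable (hT : ∀ f g, ‖T f g‖ ≤ ‖f‖ * ‖g‖) (hR : ‖R‖ ≤ 1)

include hT in
theorem norm_apply3_le (f g h : E) : ‖T f g h‖ ≤ ‖f‖ * ‖g‖ * ‖h‖ :=
  ((T f g).le_opNorm h).trans (by gcongr; exact hT f g)

include hR in
theorem norm_apply_le_of_norm_le_one (f : E) : ‖R f‖ ≤ ‖f‖ :=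
  (R.le_opNorm f).trans (by nlinarith [norm_nonneg f])

include hT hR

/-- Variation of `linPart` in a ball. -/
theorem norm_linPart_sub_le {b : ℂ} {c y : E} {ρ nu ny : ℝ} (hu : ‖R (s - c)‖ ≤ nu)
    (hy : ‖c‖ ≤ ny) (hd : ‖y - c‖ ≤ ρ) :
    ‖linPart R T b (R (s - y)) y - linPart R T b (R (s - c)) c‖
      ≤ ρ * (256 * nu + 128 * ny + 192 * ρ) := by
  set u := R (s - c) with hudef
  set e := -R (y - c) with he
  set d := y - c with hddef
  have hy' : y = c + d := by rw [hddef]; abel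
  have hu' : R (s - y) = u + e := by
    rw [hudef, he, hddef, ← map_neg, ← map_add]; congr 1; abel
  have hen : ‖e‖ ≤ ρ := by
    rw [he, norm_neg]
    exact (norm_apply_le_of_norm_le_one hR d).trans hd
  have hρ : 0 ≤ ρ := (norm_nonneg _).trans hd
  have hnu : 0 ≤ nu := (norm_nonneg _).trans hu
  have hny : 0 ≤ ny := (norm_nonneg _).trans hy
  have key : linPart R T b (R (s - y)) y - linPart R T b u c
      = (64 : ℂ) • (T e u + T u e + T e e)
        - (128 : ℂ) • (T e c + T e d + T u d).comp R := by
    rw [hu', hy']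
    ext w
    simp only [linPart, add_apply, sub_apply, ContinuousLinearMap.comp_apply, smul_apply, map_add]
    module
  have n64 : ‖(64 : ℂ)‖ = 64 := by norm_num
  have n128 : ‖(128 : ℂ)‖ = 128 := by norm_num
  have b1 : ‖T e u + T u e + T e e‖ ≤ ρ * nu + nu * ρ + ρ * ρ := by
    refine (norm_add_le_of_le (norm_add_le_of_le ((hT e u).trans ?_) ((hT u e).trans ?_))
      ((hT e e).trans ?_)) <;> gcongr
  have b2 : ‖T e c + T e d + T u d‖ ≤ ρ * ny + ρ * ρ + nu * ρ := by
    refine (norm_add_le_of_le (norm_add_le_of_le ((hT e c).trans ?_) ((hT e d).trans ?_))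
      ((hT u d).trans ?_)) <;> gcongr
  have b3 : ‖(T e c + T e d + T u d).comp R‖ ≤ (ρ * ny + ρ * ρ + nu * ρ) * 1 :=
    (ContinuousLinearMap.opNorm_comp_le _ _).trans (by gcongr)
  rw [key]
  refine (norm_sub_le _ _).trans ?_
  rw [norm_smul, norm_smul, n64, n128]
  nlinarith

/-- Deviation of `linPart` from affine interpolation. -/
theorem norm_linPart_interp_sub_le {b₀ b₁ : ℂ} {y₀ y₁ : E} {θ δ : ℝ} (hθ : θ ∈ Icc (0 : ℝ) 1)
    (hδ : ‖y₁ - y₀‖ ≤ δ) :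
    ‖linPart R T (interp b₀ b₁ θ) (R (s - interp y₀ y₁ θ)) (interp y₀ y₁ θ)
      - interp (linPart R T b₀ (R (s - y₀)) y₀) (linPart R T b₁ (R (s - y₁)) y₁) θ‖
      ≤ 48 * δ ^ 2 := by
  rw [resolv_sub_interp]
  set u₀ := R (s - y₀) with hu0
  set u₁ := R (s - y₁) with hu1
  set d := y₁ - y₀ with hd
  have he : u₁ - u₀ = -R d := by
    rw [hu0, hu1, ← map_sub, ← map_neg]; congr 1; rw [hd]; abel
  set e := u₁ - u₀ with hedef
  have hen : ‖e‖ ≤ δ := by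
    rw [he, norm_neg]; exact (norm_apply_le_of_norm_le_one hR d).trans hδ
  have hδ0 : 0 ≤ δ := (norm_nonneg _).trans hδ
  have h1 : y₁ = y₀ + d := by rw [hd]; abel
  have h2 : u₁ = u₀ + e := by rw [hedef]; abel
  have key : linPart R T (interp b₀ b₁ θ) (interp u₀ u₁ θ) (interp y₀ y₁ θ)
      - interp (linPart R T b₀ u₀ y₀) (linPart R T b₁ u₁ y₁) θ
      = ((θ : ℂ) * (1 - θ)) • ((128 : ℂ) • (T e d).comp R - (64 : ℂ) • T e e) := by
    rw [h1, h2]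
    ext w
    simp only [linPart, interp, add_apply, sub_apply, ContinuousLinearMap.comp_apply, smul_apply,
      map_add, map_smul, smul_eq_mul]
    module
  have n64 : ‖(64 : ℂ)‖ = 64 := by norm_num
  have n128 : ‖(128 : ℂ)‖ = 128 := by norm_num
  have b1 : ‖T e e‖ ≤ δ * δ := (hT e e).trans (by gcongr)
  have b2 : ‖(T e d).comp R‖ ≤ (δ * δ) * 1 :=
    (ContinuousLinearMap.opNorm_comp_le _ _).trans (by
      gcongr; exact (hT e d).trans (by gcongr))
  rw [key, norm_smul]
  have b3 : ‖(128 : ℂ) • (T e d).comp R - (64 : ℂ) • T e e‖ ≤ 192 * δ ^ 2 := by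
    refine (norm_sub_le _ _).trans ?_
    rw [norm_smul, norm_smul, n64, n128]
    nlinarith
  calc _ ≤ 1 / 4 * (192 * δ ^ 2) := by gcongr; exact norm_mul_one_sub_le hθ
    _ = _ := by ring

/-- Deviation of the residual from affine interpolation. -/
theorem norm_map_cubic_interp_le (h1 : ∀ f g h, T f g h = T g f h)
    {b₀ b₁ : ℂ} {y₀ y₁ : E} {θ δ α nu ny β Y : ℝ}
    (hθ : θ ∈ Icc (0 : ℝ) 1) (hδ : ‖y₁ - y₀‖ ≤ δ) (hα : ‖A * S‖ ≤ α) (hnu : ‖R (s - y₀)‖ ≤ nu)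
    (hny : ‖y₀‖ ≤ ny) (hβ : ‖b₁ - b₀‖ ≤ β)
    (hY₀ : ‖A (cubic S R T s b₀ y₀)‖ ≤ Y) (hY₁ : ‖A (cubic S R T s b₁ y₁)‖ ≤ Y) :
    ‖A (cubic S R T s (interp b₀ b₁ θ) (interp y₀ y₁ θ))‖
      ≤ Y + α / 4 * (β * δ + 64 * ((2 * nu + ny) * δ ^ 2 + 2 * δ ^ 3)) := by
  have hRi := resolv_sub_interp (R := R) (s := s) y₀ y₁ θ
  set d := y₁ - y₀ with hd
  set e := -R d with hedef
  set u₀ := R (s - y₀) with hu0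
  have hu1 : R (s - y₁) = u₀ + e := by
    rw [hu0, hedef, hd, ← map_neg, ← map_add]; congr 1; abel
  have hen : ‖e‖ ≤ δ := by
    rw [hedef, norm_neg]; exact (norm_apply_le_of_norm_le_one hR d).trans hδ
  have hδ0 : 0 ≤ δ := (norm_nonneg _).trans hδ
  have hnu0 : 0 ≤ nu := (norm_nonneg _).trans hnu
  have hny0 : 0 ≤ ny := (norm_nonneg _).trans hny
  have hα0 : 0 ≤ α := (norm_nonneg _).trans hα
  have hβ0 : 0 ≤ β := (norm_nonneg _).trans hβ
  have hy1 : y₁ = y₀ + d := by rw [hd]; abel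
  set q := (b₁ - b₀) • e - (64 : ℂ) • (T e e y₀ + (2 : ℂ) • T u₀ e d
    + (1 + (θ : ℂ)) • T e e d) with hq
  have key : cubic S R T s (interp b₀ b₁ θ) (interp y₀ y₁ θ)
      = interp (cubic S R T s b₀ y₀) (cubic S R T s b₁ y₁) θ
        + ((θ : ℂ) * (1 - θ)) • S q := by
    have c1 : T e u₀ d = T u₀ e d := h1 _ _ _
    have c2 : T e u₀ y₀ = T u₀ e y₀ := h1 _ _ _
    simp only [cubic, hRi]
    rw [hu1, ← hu0, hy1, hq]
    clear_value q e u₀ d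
    simp only [interp, add_apply, smul_apply, map_add, map_sub, map_smul, smul_eq_mul, c1, c2]
    module
  have n64 : ‖(64 : ℂ)‖ = 64 := by norm_num
  have n2 : ‖(2 : ℂ)‖ = 2 := by norm_num
  have hθ1 : ‖(1 + (θ : ℂ))‖ ≤ 2 := by
    refine (norm_add_le _ _).trans ?_
    rw [norm_one, norm_cast_unit hθ]; linarith [hθ.2]
  have t1 : ‖T e e y₀‖ ≤ δ * δ * ny := (norm_apply3_le hT _ _ _).trans (by gcongr)
  have t2 : ‖T u₀ e d‖ ≤ nu * δ * δ := (norm_apply3_le hT _ _ _).trans (by gcongr)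
  have t3 : ‖T e e d‖ ≤ δ * δ * δ := (norm_apply3_le hT _ _ _).trans (by gcongr)
  have t4 : ‖(1 + (θ : ℂ)) • T e e d‖ ≤ 2 * (δ * δ * δ) := by
    rw [norm_smul]; gcongr
  have t5 : ‖(2 : ℂ) • T u₀ e d‖ ≤ 2 * (nu * δ * δ) := by
    rw [norm_smul, n2]; gcongr
  have t6 : ‖(b₁ - b₀) • e‖ ≤ β * δ := by
    rw [norm_smul]; gcongr
  have hqn : ‖q‖ ≤ β * δ + 64 * ((2 * nu + ny) * δ ^ 2 + 2 * δ ^ 3) := by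
    refine (norm_sub_le _ _).trans ?_
    have := norm_add_le_of_le (norm_add_le_of_le t1 t5) t4
    rw [norm_smul (64 : ℂ), n64]
    nlinarith
  have hAS : ‖A (S q)‖ ≤ α * (β * δ + 64 * ((2 * nu + ny) * δ ^ 2 + 2 * δ ^ 3)) := by
    calc ‖A (S q)‖ = ‖(A * S) q‖ := rfl
      _ ≤ ‖A * S‖ * ‖q‖ := (A * S).le_opNorm q
      _ ≤ _ := by gcongr
  have hAi : A (interp (cubic S R T s b₀ y₀) (cubic S R T s b₁ y₁) θ)
      = interp (A (cubic S R T s b₀ y₀)) (A (cubic S R T s b₁ y₁)) θ := by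
    simp only [interp, map_add, map_smul]
  rw [key, map_add, map_smul, hAi]
  refine (norm_add_le_of_le (norm_interp_le hθ hY₀ hY₁) (?_ : _ ≤
    1 / 4 * (α * (β * δ + 64 * ((2 * nu + ny) * δ ^ 2 + 2 * δ ^ 3))))).trans (le_of_eq (by ring))
  rw [norm_smul]
  gcongr
  exact norm_mul_one_sub_le hθ

/-- The Newton map contracts near the segment between two approximate zeros. -/
theorem norm_newton_deriv_le {b₀ b₁ : ℂ} {y₀ y₁ y : E} {θ δ α nu ny k ρ : ℝ}
    (hθ : θ ∈ Icc (0 : ℝ) 1) (hδ : ‖y₁ - y₀‖ ≤ δ) (hα : ‖A * S‖ ≤ α)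
    (hnu₀ : ‖R (s - y₀)‖ ≤ nu) (hny₀ : ‖y₀‖ ≤ ny)
    (hnu₁ : ‖R (s - y₁)‖ ≤ nu) (hny₁ : ‖y₁‖ ≤ ny)
    (hk₀ : ‖1 - A * (1 + S.comp (linPart R T b₀ (R (s - y₀)) y₀))‖ ≤ k)
    (hk₁ : ‖1 - A * (1 + S.comp (linPart R T b₁ (R (s - y₁)) y₁))‖ ≤ k)
    (hy : ‖y - interp y₀ y₁ θ‖ ≤ ρ) :
    ‖1 - A * (1 + S.comp (linPart R T (interp b₀ b₁ θ) (R (s - y)) y))‖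
      ≤ k + α * (48 * δ ^ 2 + ρ * (256 * nu + 128 * ny + 192 * ρ)) := by
  set L := linPart R T (interp b₀ b₁ θ) (R (s - y)) y with hL
  set Lc := linPart R T (interp b₀ b₁ θ) (R (s - interp y₀ y₁ θ)) (interp y₀ y₁ θ) with hLc
  set L₀ := linPart R T b₀ (R (s - y₀)) y₀ with hL0
  set L₁ := linPart R T b₁ (R (s - y₁)) y₁ with hL1
  have e1 : ‖L - Lc‖ ≤ ρ * (256 * nu + 128 * ny + 192 * ρ) :=
    norm_linPart_sub_le hT hR
      (by rw [resolv_sub_interp]; exact norm_interp_le hθ hnu₀ hnu₁)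
      (norm_interp_le hθ hny₀ hny₁) hy
  have e2 : ‖Lc - interp L₀ L₁ θ‖ ≤ 48 * δ ^ 2 := norm_linPart_interp_sub_le hT hR hθ hδ
  have hα0 : 0 ≤ α := (norm_nonneg _).trans hα
  have e3 : ‖L - interp L₀ L₁ θ‖ ≤ 48 * δ ^ 2 + ρ * (256 * nu + 128 * ny + 192 * ρ) := by
    calc _ = ‖(Lc - interp L₀ L₁ θ) + (L - Lc)‖ := by congr 1; abel
      _ ≤ _ := norm_add_le_of_le e2 e1
  have key : 1 - A * (1 + S.comp L)
      = interp (1 - A * (1 + S.comp L₀)) (1 - A * (1 + S.comp L₁)) θ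
        - (A * S) * (L - interp L₀ L₁ θ) := by
    have hc : ∀ M : E →L[ℂ] E, S.comp M = S * M := fun _ => rfl
    simp only [hc, interp, mul_add, mul_sub, mul_one, mul_smul_comm, mul_assoc]
    module
  rw [key]
  refine (norm_sub_le _ _).trans (add_le_add (norm_interp_le hθ hk₀ hk₁) ?_)
  refine (norm_mul_le _ _).trans ?_
  gcongr

end Interpolation

/-! ### Trigonometric polynomials with three odd modes -/

section Polynomials

open Finset (range sum_congr sum_comm sum_sub_distrib sum_add_distrib sum_ite_eq sum_ite_eq'
  smul_sum sum_smul sum_const_zero)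

variable (r : ℝ)

/-- The odd sine polynomial `u₀ sin x + u₁ sin 3x + u₂ sin 5x`. -/
noncomputable def oddPoly (u : ℕ → ℝ) : SineSpace :=
  (u 0 : ℂ) • sineVec r 1 + (u 1 : ℂ) • sineVec r 3 + (u 2 : ℂ) • sineVec r 5

/-- If `u` and `y` are the coefficients of two polynomials with modes `1, 3, 5`, then the product
of the polynomials is `m₀ + 2 ∑ m_c cos (2 c x)` with `m = prodCoeff u y`. -/
noncomputable def prodCoeff (u y : ℕ → ℝ) : ℕ → ℝ
  | 0 => (u 0 * y 0 + u 1 * y 1 + u 2 * y 2) / 2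
  | 1 => (u 0 * y 1 + u 1 * y 0 + u 1 * y 2 + u 2 * y 1 - u 0 * y 0) / 4
  | 2 => (u 0 * y 2 + u 2 * y 0 - u 0 * y 1 - u 1 * y 0) / 4
  | 3 => -(u 0 * y 2 + u 2 * y 0 + u 1 * y 1) / 4
  | 4 => -(u 1 * y 2 + u 2 * y 1) / 4
  | 5 => -(u 2 * y 2) / 4
  | _ => 0

theorem prodCoeff_eq_zero (u y : ℕ → ℝ) {c : ℕ} (hc : 5 < c) : prodCoeff u y c = 0 := by
  match c, hc with
  | n + 6, _ => rfl

theorem mul3_sineVec_int [Fact (1 ≤ r)] {a b c : ℤ} (ha : 0 < a) (hb : 0 < b) (hc : 0 < c) :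
    mul3 r (sineVec r a) (sineVec r b) (sineVec r c) = sineTriple r a b c := by
  have h := mul3_sineVec r (a - 1).toNat (b - 1).toNat (c - 1).toNat
  rwa [Int.toNat_of_nonneg (by omega), Int.toNat_of_nonneg (by omega),
    Int.toNat_of_nonneg (by omega), sub_add_cancel, sub_add_cancel, sub_add_cancel] at h

theorem mul3_oddPoly_sineVec [Fact (1 ≤ r)] (u y : ℕ → ℝ) {j : ℤ} (hj : 0 < j) :
    mul3 r (oddPoly r u) (oddPoly r y) (sineVec r j) = (prodCoeff u y 0 : ℂ) • sineVec r j
      + ∑ c ∈ Finset.Icc 1 5, (prodCoeff u y c : ℂ) •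
        (sineVec r (j + 2 * (c : ℤ)) + sineVec r (j - 2 * (c : ℤ))) := by
  have hs : Finset.Icc 1 5 = ({1, 2, 3, 4, 5} : Finset ℕ) := by decide
  rw [hs]
  simp only [oddPoly, map_add, map_smul, add_apply, smul_apply]
  rw [mul3_sineVec_int r (by norm_num) (by norm_num) hj,
    mul3_sineVec_int r (by norm_num) (by norm_num) hj,
    mul3_sineVec_int r (by norm_num) (by norm_num) hj,
    mul3_sineVec_int r (by norm_num) (by norm_num) hj,
    mul3_sineVec_int r (by norm_num) (by norm_num) hj,
    mul3_sineVec_int r (by norm_num) (by norm_num) hj,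
    mul3_sineVec_int r (by norm_num) (by norm_num) hj,
    mul3_sineVec_int r (by norm_num) (by norm_num) hj,
    mul3_sineVec_int r (by norm_num) (by norm_num) hj]
  simp [sineTriple, prodCoeff]
  norm_num [← sub_eq_add_neg]
  module

/-- Reflection at zero, for odd or for even frequencies: `sin (j + 2c) x + sin (j - 2c) x`
in terms of sines of positive frequencies. -/
theorem sineVec_add_sineVec_sub (π q K c : ℕ) (hπ : π ≤ 1) (hc : 1 ≤ c) (hK : q + c < K) :
    sineVec r ((2 * q + π + 1 : ℕ) + 2 * (c : ℤ)) + sineVec r ((2 * q + π + 1 : ℕ) - 2 * (c : ℤ))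
      = ∑ a ∈ range K, ((if (a - q) + (q - a) = c then (1 : ℂ) else 0)
          - (if a + q + π + 1 = c then 1 else 0)) • sineVec r (2 * a + π + 1 : ℕ) := by
  have h1 : ∀ a : ℕ, (if (a - q) + (q - a) = c then (1 : ℂ) else 0)
      = (if a = q + c then 1 else 0) + (if a + c = q then 1 else 0) := by
    intro a
    split_ifs <;> first | omega | simp
  simp only [h1, sub_smul, add_smul, ite_smul, one_smul, zero_smul, sum_sub_distrib,
    sum_add_distrib, sum_ite_eq', Finset.mem_range, hK, if_true]
  have e1 : ((2 * (q + c) + π + 1 : ℕ) : ℤ) = (2 * q + π + 1 : ℕ) + 2 * (c : ℤ) := by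
    push_cast; ring
  rw [e1, add_sub_assoc]
  congr 1
  by_cases hcq : c ≤ q
  · have h2 : ∀ a : ℕ, a + c = q ↔ a = q - c := by omega
    have h3 : ∀ a : ℕ, ¬ a + q + π + 1 = c := by omega
    simp only [h2, h3, sum_ite_eq', Finset.mem_range, if_false, sum_const_zero, sub_zero]
    rw [if_pos (by omega)]
    congr 1
    omega
  · have h2 : ∀ a : ℕ, ¬ a + c = q := by omega
    simp only [h2, if_false, sum_const_zero, zero_sub]
    by_cases h0 : q + π + 1 ≤ c
    · have h3 : ∀ a : ℕ, a + q + π + 1 = c ↔ a = c - (q + π + 1) := by omega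
      simp only [h3, sum_ite_eq', Finset.mem_range]
      rw [if_pos (by omega), ← sineVec_neg]
      congr 1
      omega
    · have h3 : ∀ a : ℕ, ¬ a + q + π + 1 = c := by omega
      have h4 : ((2 * q + π + 1 : ℕ) : ℤ) - 2 * (c : ℤ) = 0 := by omega
      rw [h4]
      simp [h3]

/-- Entry of the matrix of multiplication by `m₀ + 2 ∑ m_c cos (2 c x)`, for the row frequency
`2 a + π + 1` and the column frequency `2 q + π + 1`. -/
def foldEntry (m : ℕ → ℝ) (π a q : ℕ) : ℝ := m ((a - q) + (q - a)) - m (a + q + π + 1)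

theorem mul3_oddPoly_eq_sum [Fact (1 ≤ r)] (u y : ℕ → ℝ) {π q K : ℕ} (hπ : π ≤ 1)
    (hK : q + 6 ≤ K) :
    mul3 r (oddPoly r u) (oddPoly r y) (sineVec r (2 * q + π + 1 : ℕ))
      = ∑ a ∈ range K, (foldEntry (prodCoeff u y) π a q : ℂ) • sineVec r (2 * a + π + 1 : ℕ) := by
  rw [mul3_oddPoly_sineVec r u y (by positivity)]
  have h1 : ∀ c ∈ Finset.Icc 1 5, (prodCoeff u y c : ℂ) •
        (sineVec r ((2 * q + π + 1 : ℕ) + 2 * (c : ℤ))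
          + sineVec r ((2 * q + π + 1 : ℕ) - 2 * (c : ℤ)))
      = ∑ a ∈ range K, ((prodCoeff u y c : ℂ) * ((if (a - q) + (q - a) = c then (1 : ℂ) else 0)
          - (if a + q + π + 1 = c then 1 else 0))) • sineVec r (2 * a + π + 1 : ℕ) := by
    intro c hc
    rw [Finset.mem_Icc] at hc
    rw [sineVec_add_sineVec_sub r π q K c hπ hc.1 (by omega), smul_sum]
    simp only [smul_smul]
  have h2 : (prodCoeff u y 0 : ℂ) • sineVec r (2 * q + π + 1 : ℕ)
      = ∑ a ∈ range K, ((if a = q then (prodCoeff u y 0 : ℂ) else 0)) •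
        sineVec r (2 * a + π + 1 : ℕ) := by
    simp only [ite_smul, zero_smul, sum_ite_eq', Finset.mem_range]
    rw [if_pos (by omega)]
  rw [sum_congr rfl h1, sum_comm, h2, ← sum_add_distrib]
  refine sum_congr rfl fun a _ => ?_
  rw [← sum_smul, ← add_smul]
  congr 1
  simp only [mul_sub, mul_ite, mul_one, mul_zero, sum_sub_distrib, sum_ite_eq, Finset.mem_Icc,
    foldEntry, Complex.ofReal_sub]
  have h3 : (if 1 ≤ a + q + π + 1 ∧ a + q + π + 1 ≤ 5 then (prodCoeff u y (a + q + π + 1) : ℂ)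
      else 0) = prodCoeff u y (a + q + π + 1) := by
    split_ifs with h
    · rfl
    · rw [prodCoeff_eq_zero _ _ (by omega)]; simp
  rw [h3]
  by_cases haq : a = q
  · subst haq
    simp
    ring
  · rw [if_neg haq]
    split_ifs with h
    · ring
    · rw [prodCoeff_eq_zero _ _ (c := a - q + (q - a)) (by omega)]; simp

end Polynomials

/-! ### The approximate inverse -/

section Precond

open Finset (range)

variable (r : ℝ)

theorem map_mem_of_unitVec {F : Type*} [NormedAddCommGroup F] [NormedSpace ℂ F]
    (f : SineSpace →L[ℂ] F) {P : AddSubmonoid F} (hP : IsClosed (P : Set F)) {x : SineSpace}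
    (h : ∀ n, x n • f (unitVec n) ∈ P) : f x ∈ P := by
  have hs := (hasSum_unitVec x).mapL f
  simp only [map_smul] at hs
  exact hP.mem_of_tendsto hs (Filter.Eventually.of_forall fun s => P.sum_mem fun n _ => h n)

/-- Columns of the approximate inverse `precond`. -/
noncomputable def precondCol (β : ℕ → ℕ → ℕ → ℝ) (n : ℕ) : SineSpace :=
  if n < 8 then (((r : ℂ) ^ (n + 1))⁻¹ * ((n : ℂ) + 1) ^ 2) •
    ∑ a ∈ range 4, (β (n % 2) a (n / 2) : ℂ) • sineVec r (2 * a + n % 2 + 1 : ℕ)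
  else unitVec n

theorem norm_precondCol_le (β : ℕ → ℕ → ℕ → ℝ) (n : ℕ) :
    ‖precondCol r β n‖ ≤ 1 + ∑ i ∈ range 8, ‖precondCol r β i‖ := by
  by_cases hn : n < 8
  · have := Finset.single_le_sum (f := fun i => ‖precondCol r β i‖) (fun i _ => norm_nonneg _)
      (Finset.mem_range.2 hn)
    linarith
  · have h1 : ‖precondCol r β n‖ = 1 := by rw [precondCol, if_neg hn, norm_unitVec]
    have h2 : 0 ≤ ∑ i ∈ range 8, ‖precondCol r β i‖ := Finset.sum_nonneg fun i _ => norm_nonneg _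
    linarith

/-- The approximate inverse of the derivative of the stationary equation. It preserves the parity
of the frequencies. On the frequencies `1, …, 8` it is `β (-Δ)`, where `β π` is a `4 × 4` matrix
for each parity (frequencies `2 a + π + 1`, `a < 4`), and it is the identity on the others. -/
noncomputable def precond (β : ℕ → ℕ → ℕ → ℝ) : SineSpace →L[ℂ] SineSpace :=
  lift (precondCol r β) (1 + ∑ i ∈ range 8, ‖precondCol r β i‖) (norm_precondCol_le r β)

/-- The span of the first eight unit vectors. -/
noncomputable def lowModes : Submodule ℂ SineSpace :=
  Submodule.span ℂ (Set.range fun i : Fin 8 => unitVec i)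

instance : FiniteDimensional ℂ lowModes := FiniteDimensional.span_of_finite ℂ (Set.finite_range _)

theorem unitVec_mem_lowModes {n : ℕ} (h : n < 8) : unitVec n ∈ lowModes :=
  Submodule.subset_span ⟨⟨n, h⟩, rfl⟩

theorem precond_sub_mem (β : ℕ → ℕ → ℕ → ℝ) (x : SineSpace) : precond r β x - x ∈ lowModes := by
  have hc : IsClosed (lowModes : Set SineSpace) := Submodule.closed_of_finiteDimensional _
  refine map_mem_of_unitVec (precond r β - ContinuousLinearMap.id ℂ SineSpace)
    (P := lowModes.toAddSubmonoid) hc fun n => ?_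
  refine lowModes.smul_mem _ ?_
  simp only [precond, sub_apply, lift_unitVec, ContinuousLinearMap.id_apply, precondCol]
  split_ifs with h
  · refine lowModes.sub_mem (lowModes.smul_mem _ (lowModes.sum_mem fun a ha => ?_))
      (unitVec_mem_lowModes h)
    refine lowModes.smul_mem _ ?_
    rw [Finset.mem_range] at ha
    rw [show ((2 * a + n % 2 + 1 : ℕ) : ℤ) = ((2 * a + n % 2 : ℕ) : ℤ) + 1 by push_cast; ring,
      sineVec_succ]
    exact lowModes.smul_mem _ (unitVec_mem_lowModes (by omega))
  · simp

theorem sineVec_nat (n : ℕ) : sineVec r (n + 1 : ℕ) = ((r : ℂ) ^ (n + 1)) • unitVec n := by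
  rw [Nat.cast_succ, sineVec_succ]

theorem invLap_sineVec (n : ℕ) : invLap (sineVec r (n + 1 : ℕ))
    = (1 / ((n + 1 : ℕ) : ℂ) ^ 2) • sineVec r (n + 1 : ℕ) := by
  rw [invLap, Nat.cast_succ, diag_sineVec]
  push_cast
  rfl

theorem resolv_sineVec (n : ℕ) : resolv (sineVec r (n + 1 : ℕ))
    = (((n + 1 : ℕ) : ℂ) ^ 2 / (((n + 1 : ℕ) : ℂ) ^ 2 + 1)) • sineVec r (n + 1 : ℕ) := by
  rw [resolv, Nat.cast_succ, diag_sineVec]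
  push_cast
  rfl

theorem precond_sineVec_high (β : ℕ → ℕ → ℕ → ℝ) {π m : ℕ} (hm : 4 ≤ m) :
    precond r β (sineVec r (2 * m + π + 1 : ℕ)) = sineVec r (2 * m + π + 1 : ℕ) := by
  rw [sineVec_nat, map_smul, precond, lift_unitVec, precondCol, if_neg (by omega)]

theorem precond_invLap_high (β : ℕ → ℕ → ℕ → ℝ) {π m : ℕ} (hm : 4 ≤ m) :
    precond r β (invLap (sineVec r (2 * m + π + 1 : ℕ)))
      = (1 / ((2 * m + π + 1 : ℕ) : ℂ) ^ 2) • sineVec r (2 * m + π + 1 : ℕ) := by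
  rw [invLap_sineVec, map_smul, precond_sineVec_high r β hm]

theorem oddPoly_eq_sum (u : ℕ → ℝ) {K : ℕ} (hK : 3 ≤ K) :
    oddPoly r u = ∑ a ∈ range K, ((if a < 3 then u a else 0 : ℝ) : ℂ) •
      sineVec r (2 * a + 0 + 1 : ℕ) := by
  rw [← Finset.sum_range_add_sum_Ico _ hK, Finset.sum_eq_zero (s := Finset.Ico 3 K)]
  · simp [Finset.sum_range_succ, oddPoly]
  · intro a ha
    rw [if_neg (by have := (Finset.mem_Ico.1 ha).1; omega)]
    simp

theorem resolv_sub_oddPoly {u y : ℕ → ℝ} (h0 : u 0 = (1 - y 0) / 2) (h1 : u 1 = -(9 / 10) * y 1)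
    (h2 : u 2 = -(25 / 26) * y 2) : resolv (sineVec r 1 - oddPoly r y) = oddPoly r u := by
  have e1 := resolv_sineVec r 0
  have e3 := resolv_sineVec r 2
  have e5 := resolv_sineVec r 4
  norm_num at e1 e3 e5
  simp only [oddPoly, map_sub, map_add, map_smul, e1, e3, e5, h0, h1, h2]
  push_cast
  module

variable [hr : Fact (1 ≤ r)]

theorem precond_sineVec_low (β : ℕ → ℕ → ℕ → ℝ) {π m : ℕ} (hπ : π ≤ 1) (hm : m < 4) :
    precond r β (sineVec r (2 * m + π + 1 : ℕ)) = ((2 * m + π + 1 : ℕ) : ℂ) ^ 2 •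
      ∑ a ∈ range 4, (β π a m : ℂ) • sineVec r (2 * a + π + 1 : ℕ) := by
  have h1 : (2 * m + π) % 2 = π := by omega
  have h2 : (2 * m + π) / 2 = m := by omega
  have hp : (r : ℂ) ^ (2 * m + π + 1) ≠ 0 := by
    have : (0 : ℝ) < r ^ (2 * m + π + 1) := pow_pos (by linarith [hr.out]) _
    exact_mod_cast this.ne'
  rw [sineVec_nat, map_smul, precond, lift_unitVec, precondCol, if_pos (by omega), h1, h2,
    smul_smul, ← mul_assoc, mul_inv_cancel₀ hp, one_mul]
  push_cast
  rfl

theorem precond_invLap_low (β : ℕ → ℕ → ℕ → ℝ) {π m : ℕ} (hπ : π ≤ 1) (hm : m < 4) :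
    precond r β (invLap (sineVec r (2 * m + π + 1 : ℕ)))
      = ∑ a ∈ range 4, (β π a m : ℂ) • sineVec r (2 * a + π + 1 : ℕ) := by
  have : ((2 * m + π + 1 : ℕ) : ℂ) ≠ 0 := Nat.cast_ne_zero.2 (by omega)
  rw [invLap_sineVec, map_smul, precond_sineVec_low r β hπ hm, smul_smul]
  rw [one_div_mul_cancel (pow_ne_zero 2 this), one_smul]

theorem inv_freq_sq_le (π : ℕ) {m : ℕ} (hm : 4 ≤ m) :
    ‖(1 / ((2 * m + π + 1 : ℕ) : ℂ) ^ 2)‖ ≤ 1 / 81 := by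
  rw [norm_div, norm_one, norm_pow, Complex.norm_natCast]
  have : (9 : ℝ) ≤ ((2 * m + π + 1 : ℕ) : ℝ) := by exact_mod_cast (by omega : 9 ≤ 2 * m + π + 1)
  gcongr
  nlinarith

/-- The approximate inverse applied to a trigonometric polynomial, minus a polynomial of low
degree, in norm. -/
theorem norm_low_sub_precond_invLap_le (β : ℕ → ℕ → ℕ → ℝ) {π K N : ℕ} (hπ : π ≤ 1) (hK : 4 ≤ K)
    (hN : 8 ≤ N) (hN' : 2 * K + π ≤ N + 1) (z x : ℕ → ℝ) :
    ‖∑ i ∈ range 4, (z i : ℂ) • sineVec r (2 * i + π + 1 : ℕ)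
      - precond r β (invLap (∑ a ∈ range K, (x a : ℂ) • sineVec r (2 * a + π + 1 : ℕ)))‖
      ≤ r ^ N * (∑ i ∈ range 4, |z i - ∑ a ∈ range 4, β π i a * x a|
        + (∑ a ∈ Finset.Ico 4 K, |x a|) / 81) := by
  have h1r : 1 ≤ r := hr.out
  have key : ∑ i ∈ range 4, (z i : ℂ) • sineVec r (2 * i + π + 1 : ℕ)
      - precond r β (invLap (∑ a ∈ range K, (x a : ℂ) • sineVec r (2 * a + π + 1 : ℕ)))
      = ∑ i ∈ range 4, ((z i - ∑ a ∈ range 4, β π i a * x a : ℝ) : ℂ) •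
          sineVec r (2 * i + π + 1 : ℕ)
        - ∑ a ∈ Finset.Ico 4 K, (x a : ℂ) •
          (1 / ((2 * a + π + 1 : ℕ) : ℂ) ^ 2) • sineVec r (2 * a + π + 1 : ℕ) := by
    rw [← Finset.sum_range_add_sum_Ico _ hK]
    simp only [map_add, map_sum, map_smul]
    have e1 : ∑ a ∈ range 4, (x a : ℂ) • precond r β (invLap (sineVec r (2 * a + π + 1 : ℕ)))
        = ∑ i ∈ range 4, ((∑ a ∈ range 4, β π i a * x a : ℝ) : ℂ) •
          sineVec r (2 * i + π + 1 : ℕ) := by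
      rw [Finset.sum_congr rfl fun a ha => by
        rw [precond_invLap_low r β hπ (Finset.mem_range.1 ha), Finset.smul_sum]]
      rw [Finset.sum_comm]
      refine Finset.sum_congr rfl fun i _ => ?_
      push_cast
      rw [Finset.sum_smul]
      refine Finset.sum_congr rfl fun a _ => ?_
      rw [smul_smul, mul_comm]
    have e2 : ∑ a ∈ Finset.Ico 4 K, (x a : ℂ) •
          precond r β (invLap (sineVec r (2 * a + π + 1 : ℕ)))
        = ∑ a ∈ Finset.Ico 4 K, (x a : ℂ) •
          (1 / ((2 * a + π + 1 : ℕ) : ℂ) ^ 2) • sineVec r (2 * a + π + 1 : ℕ) :=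
      Finset.sum_congr rfl fun a ha => by
        rw [precond_invLap_high r β (Finset.mem_Ico.1 ha).1]
    rw [e1, e2, ← sub_sub, ← Finset.sum_sub_distrib]
    simp only [Complex.ofReal_sub, sub_smul]
  rw [key]
  have hn : ∀ a : ℕ, 2 * a + π + 1 ≤ N → ‖sineVec r (2 * a + π + 1 : ℕ)‖ ≤ r ^ N := fun a ha =>
    norm_sineVec_le' r (by omega)
  have hrN : (0 : ℝ) ≤ r ^ N := by positivity
  refine (norm_sub_le_of_le (norm_sum_le_of_le (f := fun i : ℕ =>
      ((z i - ∑ a ∈ range 4, β π i a * x a : ℝ) : ℂ) • sineVec r (2 * i + π + 1 : ℕ))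
      (n := fun i => |z i - ∑ a ∈ range 4, β π i a * x a| * r ^ N) _ fun i hi => ?_)
    (norm_sum_le_of_le (n := fun a => |x a| * (1 / 81 * r ^ N)) _ fun a ha => ?_)).trans ?_
  · rw [norm_smul, Complex.norm_real, Real.norm_eq_abs]
    rw [Finset.mem_range] at hi
    gcongr
    exact hn i (by omega)
  · rw [Finset.mem_Ico] at ha
    rw [norm_smul, norm_smul, Complex.norm_real, Real.norm_eq_abs]
    gcongr
    · exact inv_freq_sq_le π ha.1
    · exact hn a (by omega)
  · rw [← Finset.sum_mul, ← Finset.sum_mul]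
    exact le_of_eq (by ring)

theorem freq_cases (n : ℕ) : ∃ π q : ℕ, π ≤ 1 ∧ n = 2 * q + π :=
  ⟨n % 2, n / 2, by omega, by omega⟩

theorem norm_precond_mul_invLap_le (β : ℕ → ℕ → ℕ → ℝ) {α : ℝ} (hα : 1 / 81 ≤ α)
    (hr10 : r ^ 10 ≤ 117 / 100)
    (h : ∀ π ≤ 1, ∀ q < 4, 117 / 100 * ∑ a ∈ range 4, |β π a q| ≤ α) :
    ‖precond r β * invLap‖ ≤ α := by
  have h1r : 1 ≤ r := hr.out
  refine opNorm_le_of_sineVec r _ (by linarith) fun n => ?_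
  obtain ⟨π, q, hπ, rfl⟩ := freq_cases n
  rw [← Nat.cast_succ]
  change ‖precond r β (invLap (sineVec r (2 * q + π + 1 : ℕ)))‖ ≤ _
  have hp : (0 : ℝ) ≤ r ^ (2 * q + π + 1) := by positivity
  by_cases hq : q < 4
  · rw [precond_invLap_low r β hπ hq]
    refine (norm_sum_le_of_le (n := fun a => |β π a q| * (117 / 100 * r ^ (2 * q + π + 1))) _
      fun a ha => ?_).trans ?_
    · rw [norm_smul, Complex.norm_real, Real.norm_eq_abs]
      rw [Finset.mem_range] at ha
      gcongr
      calc _ ≤ r ^ (10 + (2 * q + π + 1)) := norm_sineVec_le' r (by omega)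
        _ = r ^ 10 * r ^ (2 * q + π + 1) := pow_add _ _ _
        _ ≤ _ := by gcongr
    · rw [← Finset.sum_mul]
      calc _ = (117 / 100 * ∑ a ∈ range 4, |β π a q|) * r ^ (2 * q + π + 1) := by ring
        _ ≤ _ := by gcongr; exact h π hπ q hq
  · rw [precond_invLap_high r β (not_lt.1 hq), norm_smul]
    gcongr
    · exact (inv_freq_sq_le π (not_lt.1 hq)).trans hα
    · exact norm_sineVec_le' r (by omega)

/-- `precond * invLap` is small on high frequencies. -/
theorem norm_precond_invLap_le_of_high (β : ℕ → ℕ → ℕ → ℝ) {x : SineSpace}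
    (hx : ∀ n < 8, x n = 0) : ‖precond r β (invLap x)‖ ≤ 1 / 81 * ‖x‖ := by
  have hs := (hasSum_unitVec x).mapL (precond r β * invLap)
  simp only [map_smul] at hs
  refine hs.norm_le_of_bounded ((hasSum_norm_coord x).mul_left (1 / 81)) fun n => ?_
  by_cases hn : n < 8
  · simp [hx n hn]
  · rw [norm_smul, mul_comm]
    gcongr
    obtain ⟨π, q, hπ, rfl⟩ := freq_cases n
    change ‖precond r β (invLap (unitVec (2 * q + π)))‖ ≤ 1 / 81
    have e : unitVec (2 * q + π)
        = ((r : ℂ) ^ (2 * q + π + 1))⁻¹ • sineVec r (2 * q + π + 1 : ℕ) := by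
      rw [unitVec_eq r, Nat.cast_succ]
    have h2 : precond r β (invLap (unitVec (2 * q + π)))
        = (1 / ((2 * q + π + 1 : ℕ) : ℂ) ^ 2) • unitVec (2 * q + π) := by
      rw [e, map_smul, map_smul, precond_invLap_high r β (by omega), smul_comm]
    rw [h2, norm_smul, norm_unitVec, mul_one]
    exact inv_freq_sq_le π (by omega)

/-! ### Columns of the preconditioned derivative -/

/-- Matrix entries of `linPart` at a pair of polynomials, in units of the row frequency
`2 a + π + 1` and the column frequency `2 q + π + 1`. -/
noncomputable def linEntry (b : ℝ) (u y : ℕ → ℝ) (π q a : ℕ) : ℝ :=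
  (if a = q then b * ((2 * q + π + 1 : ℕ) ^ 2 / ((2 * q + π + 1 : ℕ) ^ 2 + 1)) else 0)
    + 64 * foldEntry (prodCoeff u u) π a q
    - 128 * ((2 * q + π + 1 : ℕ) ^ 2 / ((2 * q + π + 1 : ℕ) ^ 2 + 1))
      * foldEntry (prodCoeff u y) π a q

theorem linPart_sineVec (b : ℝ) (u y : ℕ → ℝ) {π q K : ℕ} (hπ : π ≤ 1) (hK : q + 6 ≤ K) :
    linPart resolv (mul3 r) b (oddPoly r u) (oddPoly r y) (sineVec r (2 * q + π + 1 : ℕ))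
      = ∑ a ∈ range K, (linEntry b u y π q a : ℂ) • sineVec r (2 * a + π + 1 : ℕ) := by
  have h0 : sineVec r (2 * q + π + 1 : ℕ)
      = ∑ a ∈ range K, (if a = q then (1 : ℂ) else 0) • sineVec r (2 * a + π + 1 : ℕ) := by
    simp only [ite_smul, zero_smul, one_smul, Finset.sum_ite_eq', Finset.mem_range]
    rw [if_pos (by omega)]
  simp only [linPart, sub_apply, add_apply, smul_apply, ContinuousLinearMap.comp_apply]
  rw [resolv_sineVec, map_smul, mul3_oddPoly_eq_sum r u u hπ hK, mul3_oddPoly_eq_sum r u y hπ hK]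
  conv_lhs => rw [h0]
  simp only [Finset.smul_sum, smul_smul]
  rw [← Finset.sum_add_distrib, ← Finset.sum_sub_distrib]
  refine Finset.sum_congr rfl fun a _ => ?_
  rw [← add_smul, ← sub_smul]
  congr 1
  simp only [linEntry]
  split_ifs <;> push_cast <;> ring

/-- The low part of a column of `1 - A (1 + S L)`. -/
noncomputable def colEntry (β : ℕ → ℕ → ℕ → ℝ) (b : ℝ) (u y : ℕ → ℝ) (π q i : ℕ) : ℝ :=
  (if q < 4 then (if i = q then 1 else 0) - ((2 * q + π + 1 : ℕ) : ℝ) ^ 2 * β π i q else 0)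
    - ∑ a ∈ range 4, β π i a * linEntry b u y π q a

theorem linEntry_eq_zero (b : ℝ) (u y : ℕ → ℝ) (π : ℕ) {q a : ℕ} (h : a + 6 ≤ q) :
    linEntry b u y π q a = 0 := by
  rw [linEntry, if_neg (by omega), foldEntry, foldEntry,
    prodCoeff_eq_zero _ _ (by omega), prodCoeff_eq_zero _ _ (by omega),
    prodCoeff_eq_zero _ _ (by omega), prodCoeff_eq_zero _ _ (by omega)]
  ring

/-- The preconditioned derivative is close to the identity if finitely many columns are small
and the high frequencies are dominated by the Laplacian. -/
theorem norm_one_sub_precond_le (β : ℕ → ℕ → ℕ → ℝ) (b : ℝ) (u y : ℕ → ℝ) {k nu ny : ℝ}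
    (hr10 : r ^ 10 ≤ 117 / 100) (hb : |b| + 64 * nu ^ 2 + 128 * nu * ny ≤ 81 * k)
    (hnu : ‖oddPoly r u‖ ≤ nu) (hny : ‖oddPoly r y‖ ≤ ny)
    (hcol : ∀ π ≤ 1, ∀ q < 9, 117 / 100 * (∑ i ∈ range 4, |colEntry β b u y π q i|
      + (∑ a ∈ Finset.Ico 4 (q + 6), |linEntry b u y π q a|) / 81) ≤ k) :
    ‖1 - precond r β * (1 + invLap.comp (linPart resolv (mul3 r) b (oddPoly r u) (oddPoly r y)))‖
      ≤ k := by
  have h1r : 1 ≤ r := hr.out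
  have hnu0 : 0 ≤ nu := (norm_nonneg _).trans hnu
  have hny0 : 0 ≤ ny := (norm_nonneg _).trans hny
  have hk : 0 ≤ k := by
    have := abs_nonneg b
    have : 0 ≤ nu * ny := by positivity
    nlinarith [sq_nonneg nu]
  set L := linPart resolv (mul3 r) b (oddPoly r u) (oddPoly r y) with hL
  refine opNorm_le_of_sineVec r _ hk fun n => ?_
  obtain ⟨π, q, hπ, rfl⟩ := freq_cases n
  rw [← Nat.cast_succ]
  have hp : (0 : ℝ) ≤ r ^ (2 * q + π + 1) := by positivity
  change ‖sineVec r (2 * q + π + 1 : ℕ) - precond r β (sineVec r (2 * q + π + 1 : ℕ)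
    + invLap (L (sineVec r (2 * q + π + 1 : ℕ))))‖ ≤ k * r ^ (2 * q + π + 1)
  rw [map_add, ← sub_sub]
  have hLs := linPart_sineVec r b u y (q := q) hπ le_rfl
  by_cases hq : q < 9
  · have e : sineVec r (2 * q + π + 1 : ℕ) - precond r β (sineVec r (2 * q + π + 1 : ℕ))
        = ∑ i ∈ range 4, ((if q < 4 then (if i = q then (1 : ℝ) else 0)
          - ((2 * q + π + 1 : ℕ) : ℝ) ^ 2 * β π i q else 0 : ℝ) : ℂ) •
            sineVec r (2 * i + π + 1 : ℕ) := by
      by_cases hq4 : q < 4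
      · rw [precond_sineVec_low r β hπ hq4]
        have e1 : ∀ i, ((if i = q then (1 : ℝ) else 0 : ℝ) : ℂ) • sineVec r (2 * i + π + 1 : ℕ)
            = if i = q then sineVec r (2 * i + π + 1 : ℕ) else 0 := fun i => by
          split_ifs <;> simp
        simp only [if_pos hq4, Complex.ofReal_sub, sub_smul, Finset.sum_sub_distrib, e1,
          Finset.sum_ite_eq', Finset.mem_range, Finset.smul_sum, smul_smul, Complex.ofReal_mul,
          Complex.ofReal_pow, Complex.ofReal_natCast]
      · rw [precond_sineVec_high r β (not_lt.1 hq4)]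
        simp [hq4]
    rw [e, hLs]
    refine (norm_low_sub_precond_invLap_le r β (N := 10 + (2 * q + π + 1)) hπ (by omega)
      (by omega) (by omega) _ _).trans ?_
    rw [pow_add]
    calc r ^ 10 * r ^ (2 * q + π + 1) * _
        ≤ (117 / 100) * r ^ (2 * q + π + 1) * _ := by gcongr
      _ = (117 / 100 * (∑ i ∈ range 4, |colEntry β b u y π q i|
          + (∑ a ∈ Finset.Ico 4 (q + 6), |linEntry b u y π q a|) / 81))
          * r ^ (2 * q + π + 1) := by
        simp only [colEntry]; ring
      _ ≤ _ := by gcongr; exact hcol π hπ q hq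
  · have e : sineVec r (2 * q + π + 1 : ℕ) - precond r β (sineVec r (2 * q + π + 1 : ℕ)) = 0 := by
      rw [precond_sineVec_high r β (by omega), sub_self]
    rw [e, zero_sub, norm_neg]
    have hhigh : ∀ n < 8, (L (sineVec r (2 * q + π + 1 : ℕ))) n = 0 := by
      intro n hn
      rw [hLs]
      have hev : ∀ z : SineSpace, z n = lp.evalCLM ℂ (fun _ : ℕ => ℂ) 1 n z := fun _ => rfl
      rw [hev, map_sum]
      refine Finset.sum_eq_zero fun a _ => ?_
      by_cases ha : a + 6 ≤ q
      · rw [linEntry_eq_zero b u y π ha]; simp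
      · rw [map_smul, sineVec_nat, map_smul, ← hev, unitVec_apply, if_neg (by omega)]
        simp
    refine (norm_precond_invLap_le_of_high r β hhigh).trans ?_
    have hLn : ‖L‖ ≤ |b| + 64 * nu ^ 2 + 128 * nu * ny := by
      have n64 : ‖(64 : ℂ)‖ = 64 := by norm_num
      have n128 : ‖(128 : ℂ)‖ = 128 := by norm_num
      have t1 : ‖(b : ℂ) • resolv‖ ≤ |b| := by
        rw [norm_smul, Complex.norm_real, Real.norm_eq_abs]
        have := mul_le_mul_of_nonneg_left norm_resolv_le (abs_nonneg b)
        linarith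
      have t2 : ‖(64 : ℂ) • mul3 r (oddPoly r u) (oddPoly r u)‖ ≤ 64 * nu ^ 2 := by
        rw [norm_smul, n64, sq]
        gcongr
        exact (norm_mul3_le_clm r _ _).trans (by gcongr)
      have t3 : ‖(128 : ℂ) • (mul3 r (oddPoly r u) (oddPoly r y)).comp resolv‖
          ≤ 128 * nu * ny := by
        rw [norm_smul, n128, mul_assoc]
        gcongr
        refine (ContinuousLinearMap.opNorm_comp_le _ _).trans ?_
        calc _ ≤ (nu * ny) * 1 := by
              gcongr
              · exact (norm_mul3_le_clm r _ _).trans (by gcongr)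
              · exact norm_resolv_le
          _ = _ := mul_one _
      exact (norm_sub_le _ _).trans (add_le_add ((norm_add_le _ _).trans (add_le_add t1 t2)) t3)
    have hs : ‖sineVec r (2 * q + π + 1 : ℕ)‖ ≤ r ^ (2 * q + π + 1) :=
      norm_sineVec_le' r (by omega)
    calc 1 / 81 * ‖L (sineVec r (2 * q + π + 1 : ℕ))‖
        ≤ 1 / 81 * (‖L‖ * ‖sineVec r (2 * q + π + 1 : ℕ)‖) := by gcongr; exact L.le_opNorm _
      _ ≤ 1 / 81 * ((81 * k) * r ^ (2 * q + π + 1)) := by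
        gcongr
        exact hLn.trans hb
      _ = _ := by ring

/-! ### The residual -/

theorem norm_oddPoly_le (u : ℕ → ℝ) : ‖oddPoly r u‖ ≤ r ^ 5 * (|u 0| + |u 1| + |u 2|) := by
  have h : ∀ (a : ℝ) (m : ℤ), m.natAbs ≤ 5 → ‖(a : ℂ) • sineVec r m‖ ≤ |a| * r ^ 5 := by
    intro a m hm
    rw [norm_smul, Complex.norm_real, Real.norm_eq_abs]
    gcongr
    exact norm_sineVec_le' r hm
  refine (norm_add_le_of_le (norm_add_le_of_le (h _ _ ?_) (h _ _ ?_)) (h _ _ ?_)).trans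
    (le_of_eq (by ring)) <;> norm_num

/-- Coefficients of `-y'' - b u + 64 u² y` for polynomials `u`, `y` with modes `1, 3, 5`. -/
noncomputable def residual (b : ℝ) (u y : ℕ → ℝ) (a : ℕ) : ℝ :=
  (if a < 3 then ((2 * a + 1 : ℕ) : ℝ) ^ 2 * y a - b * u a else 0)
    + 64 * ∑ q ∈ range 3, y q * foldEntry (prodCoeff u u) 0 a q

theorem norm_precond_cubic_le (β : ℕ → ℕ → ℕ → ℝ) (b : ℝ) {u y : ℕ → ℝ}
    (h0 : u 0 = (1 - y 0) / 2) (h1 : u 1 = -(9 / 10) * y 1) (h2 : u 2 = -(25 / 26) * y 2) :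
    ‖precond r β (cubic invLap resolv (mul3 r) (sineVec r 1) b (oddPoly r y))‖
      ≤ r ^ 15 * (∑ i ∈ range 4, |∑ a ∈ range 4, β 0 i a * residual b u y a|
        + (∑ a ∈ Finset.Ico 4 8, |residual b u y a|) / 81) := by
  have key : cubic invLap resolv (mul3 r) (sineVec r 1) b (oddPoly r y)
      = invLap (∑ a ∈ range 8, (residual b u y a : ℂ) • sineVec r (2 * a + 0 + 1 : ℕ)) := by
    have hy : oddPoly r y = invLap (∑ a ∈ range 8,
        ((if a < 3 then ((2 * a + 1 : ℕ) : ℝ) ^ 2 * y a else 0 : ℝ) : ℂ) •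
          sineVec r (2 * a + 0 + 1 : ℕ)) := by
      rw [oddPoly_eq_sum r y (by norm_num : 3 ≤ 8), map_sum]
      refine Finset.sum_congr rfl fun a _ => ?_
      rw [map_smul, invLap_sineVec, smul_smul]
      congr 1
      split_ifs
      · have : ((2 * a + 0 + 1 : ℕ) : ℂ) ≠ 0 := Nat.cast_ne_zero.2 (by omega)
        rw [Complex.ofReal_mul, Complex.ofReal_pow, Complex.ofReal_natCast]
        field_simp
      · simp
    have hT : mul3 r (oddPoly r u) (oddPoly r u) (oddPoly r y)
        = ∑ a ∈ range 8, ((∑ q ∈ range 3, y q * foldEntry (prodCoeff u u) 0 a q : ℝ) : ℂ) •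
          sineVec r (2 * a + 0 + 1 : ℕ) := by
      conv_lhs => rw [oddPoly_eq_sum r y (le_refl 3), map_sum]
      have : ∀ q ∈ range 3, mul3 r (oddPoly r u) (oddPoly r u)
          (((if q < 3 then y q else 0 : ℝ) : ℂ) • sineVec r (2 * q + 0 + 1 : ℕ))
          = ∑ a ∈ range 8, ((y q * foldEntry (prodCoeff u u) 0 a q : ℝ) : ℂ) •
            sineVec r (2 * a + 0 + 1 : ℕ) := by
        intro q hq
        rw [Finset.mem_range] at hq
        rw [if_pos hq, map_smul, mul3_oddPoly_eq_sum r u u (π := 0) (q := q) (K := 8)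
          (by norm_num) (by omega),
          Finset.smul_sum]
        refine Finset.sum_congr rfl fun a _ => ?_
        rw [smul_smul]
        push_cast
        rfl
      rw [Finset.sum_congr rfl this, Finset.sum_comm]
      refine Finset.sum_congr rfl fun a _ => ?_
      rw [← Finset.sum_smul]
      push_cast
      rfl
    rw [cubic, resolv_sub_oddPoly r h0 h1 h2, hT]
    conv_lhs => rw [hy]
    rw [oddPoly_eq_sum r u (by norm_num : 3 ≤ 8), ← map_sub, Finset.smul_sum, Finset.smul_sum,
      ← Finset.sum_sub_distrib, ← Finset.sum_sub_distrib]
    congr 1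
    refine Finset.sum_congr rfl fun a _ => ?_
    rw [smul_smul, smul_smul, ← sub_smul, ← sub_smul]
    congr 1
    simp only [residual]
    split_ifs <;> push_cast <;> ring
  rw [key]
  have := norm_low_sub_precond_invLap_le r β (π := 0) (K := 8) (N := 15) (by norm_num)
    (by norm_num) (by norm_num) (by norm_num) (fun _ => 0) (residual b u y)
  simpa only [Complex.ofReal_zero, zero_smul, Finset.sum_const_zero, zero_sub, norm_neg,
    abs_neg] using this

end Precond

/-! ### Integer arithmetic for the numerical bounds -/

section Checker

/-- `forceNat n k = k n`; the recursion makes the kernel evaluate `n` before it enters `k`. -/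
def forceNat (n : ℕ) (k : ℕ → Bool) : Bool :=
  match n with
  | 0 => k 0
  | m + 1 => k (Nat.succ m)

/-- `forceInt z k = k z`, with `z` evaluated first. -/
def forceInt (z : ℤ) (k : ℤ → Bool) : Bool :=
  match z with
  | .ofNat n => forceNat n fun m => k (.ofNat m)
  | .negSucc n => forceNat n fun m => k (.negSucc m)

/-- `forceList l k = k l`, with the entries of `l` evaluated first. -/
def forceList : List ℤ → (List ℤ → Bool) → Bool
  | [], k => k []
  | x :: l, k => forceInt x fun y => forceList l fun m => k (y :: m)

@[simp]
theorem forceNat_eq (n : ℕ) (k : ℕ → Bool) : forceNat n k = k n := by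
  cases n <;> rfl

@[simp]
theorem forceInt_eq (z : ℤ) (k : ℤ → Bool) : forceInt z k = k z := by
  cases z <;> simp [forceInt]

@[simp]
theorem forceList_eq (l : List ℤ) (k : List ℤ → Bool) : forceList l k = k l := by
  induction l generalizing k with
  | nil => rfl
  | cons x l ih => simp [forceList, ih]

/-- Inner product of two lists, cut at the shorter length. -/
def dot : List ℤ → List ℤ → ℤ
  | x :: l, y :: m => x * y + dot l m
  | _, _ => 0

/-- `allBelow p n` tests `p` on `0, …, n - 1`. -/
def allBelow (p : ℕ → Bool) : ℕ → Bool
  | 0 => true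
  | n + 1 => p n && allBelow p n

/-- `∑ |f i|` over `a ≤ i < a + n`. -/
def absSum (f : ℕ → ℤ) : ℕ → ℕ → ℕ
  | 0, _ => 0
  | n + 1, a => (f a).natAbs + absSum f n (a + 1)

/-- Integer version of `prodCoeff`, multiplied by `4`. -/
def prodList (u y : List ℤ) : List ℤ :=
  match u, y with
  | [u0, u1, u2], [y0, y1, y2] =>
    [2 * (u0 * y0 + u1 * y1 + u2 * y2), u0 * y1 + u1 * y0 + u1 * y2 + u2 * y1 - u0 * y0,
      u0 * y2 + u2 * y0 - u0 * y1 - u1 * y0, -(u0 * y2 + u2 * y0 + u1 * y1), -(u1 * y2 + u2 * y1),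
      -(u2 * y2)]
  | _, _ => []

/-- The combination of the two product lists that enters `linEntry` in the column with squared
frequency `j2`. All integer versions of `linEntry` and `colEntry` carry the factor
`s = (j2 + 1) 2⁴⁰`, which clears the denominators of `resolv` and of the coefficients. -/
def combine (j2 : ℤ) : List ℤ → List ℤ → List ℤ
  | p :: l, q :: m => (16 * (j2 + 1) * p - 32 * j2 * q) :: combine j2 l m
  | _, _ => []

/-- Integer version of `foldEntry`. -/
def foldInt (f : List ℤ) (π a q : ℕ) : ℤ := f.getD ((a - q) + (q - a)) 0 - f.getD (a + q + π + 1) 0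

/-- Integer version of `linEntry`; `dg` is the contribution of `b • resolv` to the diagonal. -/
def entryInt (f : List ℤ) (dg : ℤ) (π q a : ℕ) : ℤ :=
  foldInt f π a q + bif Nat.beq a q then dg else 0

/-- Integer version of `colEntry`, with the row `row` of the approximate inverse. -/
def colInt (row E : List ℤ) (j2 s : ℤ) (q i : ℕ) : ℤ :=
  (bif Nat.ble q 3 then (bif Nat.beq i q then 4096 else 0) - j2 * row.getD q 0 else 0) * s
    - dot row E

/-- The test that one column of `1 - A (1 + S L)` has norm at most `k / 1000`, in the form of
`norm_one_sub_precond_le`. Here `2³² = 2⁴⁰ / 256` comes from `b = bz / 256`. -/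
def colOK (bz : ℤ) (P Q : List ℤ) (B : List (List ℤ)) (k : ℕ) (π q : ℕ) : Bool :=
  forceInt (((2 * q + π + 1) * (2 * q + π + 1) : ℕ) : ℤ) fun j2 =>
  forceList (combine j2 P Q) fun f =>
  forceInt (bz * j2 * 4294967296) fun dg =>
  forceInt ((j2 + 1) * 1099511627776) fun s =>
  forceList [entryInt f dg π q 0, entryInt f dg π q 1, entryInt f dg π q 2,
    entryInt f dg π q 3] fun E =>
  Nat.ble (117000 * (81 * absSum (fun i => colInt (B.getD i []) E j2 s q i) 4 0
      + 4096 * absSum (entryInt f dg π q) (q + 2) 4))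
    (100 * k * 81 * 4096 * s.natAbs)

/-- Integer version of `residual`, multiplied by `2⁶⁰`. -/
def residualInt (bz : ℤ) (u y p : List ℤ) (a : ℕ) : ℤ :=
  (((2 * a + 1) * (2 * a + 1) : ℕ) : ℤ) * y.getD a 0 * 1099511627776
    - bz * u.getD a 0 * 4294967296
    + 16 * (y.getD 0 0 * foldInt p 0 a 0 + y.getD 1 0 * foldInt p 0 a 1
      + y.getD 2 0 * foldInt p 0 a 2)

/-- The test that the preconditioned residual has norm at most `yb / 10⁶`; the factor on the right
is `2⁶⁰`. -/
def residualOK (bz : ℤ) (u y p : List ℤ) (B : List (List ℤ)) (yb : ℕ) : Bool :=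
  forceList [residualInt bz u y p 0, residualInt bz u y p 1, residualInt bz u y p 2,
    residualInt bz u y p 3] fun E =>
  Nat.ble (1270000 * (81 * absSum (fun i => dot (B.getD i []) E) 4 0
      + 4096 * absSum (residualInt bz u y p) 4 4))
    (yb * 81 * 4096 * 1152921504606846976)

/-- A node of the numerical branch: the parameter `bz / 256`, and three integers that determine
an approximate solution with modes `1, 3, 5`. -/
structure Node where
  (bz t0 t1 t2 : ℤ)

/-- The coefficients of `u` at a node, in units of `2⁻²⁰`. -/
def Node.uList (n : Node) : List ℤ := [n.t0, 9 * n.t1, 25 * n.t2]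

/-- The coefficients of `y` at a node, in units of `2⁻²⁰`. -/
def Node.yList (n : Node) : List ℤ := [1048576 - 2 * n.t0, -10 * n.t1, -26 * n.t2]

/-- The data of the interval between two nodes: the approximate inverses (in units of `1 / 4096`)
on the odd and on the even frequencies, and bounds for the contraction constant, the inverse, `u`
and `y` (in units of `10⁻³`), for the step and the residual (in units of `10⁻⁶`). -/
structure Cell where
  (B0 B1 : List (List ℤ))
  (k al nu ny de yb : ℕ)

/-- The tests that involve one end of a cell: the norms of `u` and `y`, the columns of high
frequency, the residual, and the eighteen columns of low frequency. -/
def nodeOK (n : Node) (c : Cell) : Bool :=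
  forceList n.uList fun u => forceList n.yList fun y =>
  forceList (prodList u u) fun p => forceList (prodList u y) fun q =>
  Nat.ble (1081 * absSum (fun i => u.getD i 0) 3 0) (c.nu * 1048576) &&
  Nat.ble (1081 * absSum (fun i => y.getD i 0) 3 0) (c.ny * 1048576) &&
  Nat.ble (1000000 * n.bz.natAbs + 256 * (64 * c.nu ^ 2 + 128 * c.nu * c.ny)) (20736000 * c.k) &&
  residualOK n.bz u y p c.B0 c.yb &&
  allBelow (colOK n.bz p q c.B0 c.k 0) 9 && allBelow (colOK n.bz p q c.B1 c.k 1) 9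

/-- The test of the bound `al / 1000` for the approximate inverse on the low frequencies. -/
def invOK (B : List (List ℤ)) (al : ℕ) : Bool :=
  allBelow (fun q => Nat.ble (1170 * absSum (fun i => (B.getD i []).getD q 0) 4 0) (al * 4096)) 4

/-- All tests for a cell. The last one is `δ + κ ρ < ρ` for the ball of radius `ρ = 1 / 500`,
multiplied by `500 · 512 · 10¹⁸`, where `δ` and `κ` are the bounds of `norm_map_cubic_interp_le` and
`norm_newton_deriv_le`. -/
def cellOK (n : Node) (c : Cell) (m : Node) : Bool :=
  nodeOK n c && nodeOK m c && invOK c.B0 c.al && invOK c.B1 c.al && Nat.ble 13 c.al &&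
  forceInt (m.bz - n.bz) fun db =>
  Nat.blt 0 db.toNat &&
  Nat.ble (1081000 * absSum (fun i => n.yList.getD i 0 - m.yList.getD i 0) 3 0)
    (c.de * 1048576) &&
  Nat.blt (c.yb * 256000000000000000 + c.al * db.natAbs * c.de * 250000000000
      + c.al * 4096000 * (2 * c.nu + c.ny) * c.de ^ 2 + c.al * 8192 * c.de ^ 3
      + c.k * 512000000000000000 + c.al * 24576000 * c.de ^ 2
      + c.al * 1024000000000 * (256 * c.nu + 128 * c.ny + 384))
    512000000000000000000

/-- Tests all cells of a chain of nodes that starts at `n`. -/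
def chainOK (n : Node) : List (Cell × Node) → Bool
  | [] => true
  | (c, m) :: l => cellOK n c m && chainOK m l

end Checker

/-! ### The numerical branch -/

/-- The first node of the chain, at the parameter `-1 / 64`. -/
def chainStart : Node := ⟨-4, 524628, 16, 1⟩

set_option maxRecDepth 100000 in
/-- A chain of cells, each followed by the node at its right end. The chain reaches the parameter
`2824 / 256 > 11 + 1 / 64`. It follows the branch that passes through `u = sin x / 2`, `y = 0` at
`b = 0`; the steps are about as long as `cellOK` allows. -/
def chain : List (Cell × Node) := [
  (⟨[[341, 83, 10, 1], [83, 268, 33, 2], [10, 33, 129, 9], [1, 2, 9, 73]], [[363, 61, 5, 0], [61,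
  184, 17, 1], [6, 17, 95, 5], [0, 1, 5, 57]], 272, 125, 542, 5, 5363, 20⟩, ⟨20, 522582, -82,
  -4⟩),
  (⟨[[346, 83, 10, 1], [84, 270, 32, 2], [10, 32, 130, 9], [1, 2, 9, 73]], [[367, 61, 5, 0], [61,
  184, 16, 1], [5, 16, 95, 5], [0, 1, 5, 57]], 267, 126, 540, 14, 8963, 29⟩, ⟨60, 519151, -247,
  -11⟩),
  (⟨[[352, 84, 9, 0], [85, 273, 31, 2], [9, 32, 130, 9], [0, 2, 9, 73]], [[373, 60, 4, 0], [61,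
  185, 16, 1], [5, 16, 96, 5], [0, 1, 5, 57]], 258, 128, 538, 27, 12602, 57⟩, ⟨116, 514301, -476,
  -20⟩),
  (⟨[[361, 84, 8, 0], [86, 276, 30, 1], [9, 31, 131, 8], [0, 1, 8, 73]], [[381, 59, 4, 0], [60,
  186, 15, 0], [4, 15, 96, 5], [0, 0, 5, 58]], 273, 131, 536, 43, 16330, 68⟩, ⟨188, 507984, -768,
  -31⟩),
  (⟨[[373, 85, 7, 0], [88, 280, 29, 1], [8, 29, 131, 8], [0, 1, 8, 73]], [[392, 58, 2, 0], [59,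
  188, 14, 0], [3, 14, 96, 5], [0, 0, 5, 58]], 290, 134, 532, 63, 20130, 72⟩, ⟨276, 500134,
  -1122, -42⟩),
  (⟨[[386, 85, 5, 0], [90, 284, 27, 0], [7, 28, 132, 7], [0, 0, 7, 74]], [[403, 56, 1, 0], [58,
  189, 13, 0], [2, 14, 97, 4], [0, 0, 4, 58]], 307, 138, 528, 82, 19409, 72⟩, ⟨360, 492503,
  -1455, -51⟩),
  (⟨[[399, 86, 4, -1], [92, 288, 25, -1], [5, 26, 133, 7], [0, 0, 7, 74]], [[415, 54, 0, 0], [56,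
  191, 12, -1], [1, 13, 97, 4], [0, 0, 4, 58]], 322, 142, 523, 102, 19112, 47⟩, ⟨442, 484917,
  -1776, -57⟩),
  (⟨[[414, 85, 2, -1], [94, 292, 24, -1], [4, 25, 134, 6], [-1, -1, 6, 74]], [[427, 52, -1, -1],
  [55, 192, 11, -1], [-1, 12, 98, 4], [0, -1, 4, 58]], 336, 147, 518, 120, 18565, 40⟩, ⟨521,
  477475, -2078, -61⟩),
  (⟨[[428, 85, 0, -1], [96, 295, 22, -2], [3, 23, 134, 6], [-1, -1, 6, 75]], [[438, 49, -2, -1],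
  [52, 193, 11, -1], [-2, 11, 98, 3], [-1, -1, 3, 59]], 350, 151, 514, 138, 17792, 69⟩, ⟨596,
  470282, -2360, -63⟩),
  (⟨[[442, 84, -1, -1], [97, 299, 20, -2], [2, 21, 135, 5], [-1, -2, 5, 75]], [[449, 46, -3, -1],
  [50, 194, 10, -1], [-3, 10, 99, 3], [-1, -1, 3, 59]], 362, 155, 509, 155, 16980, 108⟩, ⟨667,
  463352, -2621, -63⟩),
  (⟨[[457, 83, -3, -1], [98, 302, 18, -2], [0, 19, 136, 5], [-1, -2, 5, 75]], [[460, 43, -4, -1],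
  [48, 195, 9, -1], [-3, 9, 99, 3], [-1, -1, 3, 59]], 373, 159, 504, 171, 16229, 141⟩, ⟨734,
  456699, -2862, -62⟩),
  (⟨[[472, 81, -4, -1], [99, 304, 16, -3], [-1, 18, 136, 4], [-1, -3, 4, 76]], [[470, 40, -5, 0],
  [45, 196, 8, -1], [-4, 8, 100, 2], [-1, -1, 3, 59]], 383, 164, 499, 187, 15704, 182⟩, ⟨798,
  450237, -3085, -59⟩),
  (⟨[[486, 79, -6, -1], [100, 307, 14, -3], [-2, 16, 137, 4], [-1, -3, 4, 76]], [[480, 37, -6,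
  0], [43, 197, 7, -2], [-5, 7, 100, 2], [0, -2, 2, 59]], 393, 169, 495, 201, 14891, 218⟩, ⟨858,
  444079, -3290, -56⟩),
  (⟨[[501, 77, -7, -1], [100, 309, 12, -3], [-4, 15, 138, 3], [-1, -3, 4, 76]], [[489, 34, -7,
  0], [40, 198, 6, -2], [-6, 7, 100, 2], [0, -2, 2, 59]], 401, 174, 490, 215, 14330, 235⟩, ⟨915,
  438134, -3478, -51⟩),
  (⟨[[516, 75, -9, -1], [100, 311, 11, -4], [-5, 13, 138, 3], [-1, -3, 3, 76]], [[498, 30, -7,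
  0], [37, 199, 5, -2], [-6, 6, 101, 2], [0, -2, 2, 60]], 410, 178, 486, 229, 13716, 271⟩, ⟨969,
  432412, -3651, -46⟩),
  (⟨[[531, 72, -10, -1], [100, 313, 9, -4], [-6, 11, 139, 3], [-1, -4, 3, 76]], [[507, 27, -8,
  0], [34, 200, 5, -2], [-7, 5, 101, 1], [0, -2, 2, 60]], 416, 183, 481, 242, 13104, 289⟩, ⟨1020,
  426925, -3809, -40⟩),
  (⟨[[546, 69, -11, -1], [100, 315, 7, -4], [-7, 10, 139, 2], [-1, -4, 2, 77]], [[515, 23, -8,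
  0], [31, 201, 4, -2], [-7, 4, 101, 1], [0, -2, 1, 60]], 423, 187, 477, 254, 12712, 319⟩, ⟨1069,
  421573, -3956, -34⟩),
  (⟨[[560, 65, -12, -1], [100, 316, 6, -4], [-8, 9, 140, 2], [-1, -4, 2, 77]], [[523, 20, -9, 0],
  [28, 202, 3, -2], [-8, 4, 102, 1], [0, -2, 1, 60]], 430, 192, 473, 266, 12048, 356⟩, ⟨1115,
  416473, -4089, -28⟩),
  (⟨[[575, 62, -13, 0], [99, 318, 4, -4], [-9, 7, 140, 1], [-1, -4, 2, 77]], [[531, 16, -9, 0],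
  [25, 203, 3, -2], [-8, 3, 102, 1], [0, -2, 1, 60]], 435, 196, 469, 277, 11662, 352⟩, ⟨1159,
  411523, -4212, -21⟩),
  (⟨[[590, 58, -14, 0], [99, 319, 3, -4], [-10, 6, 141, 1], [-1, -4, 1, 77]], [[538, 13, -9, 0],
  [22, 204, 2, -2], [-8, 3, 102, 1], [0, -2, 1, 60]], 440, 200, 464, 288, 11227, 369⟩, ⟨1201,
  406729, -4324, -14⟩),
  (⟨[[606, 54, -15, 0], [98, 320, 1, -4], [-11, 4, 141, 1], [-1, -4, 1, 77]], [[545, 9, -9, 0],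
  [19, 204, 1, -2], [-9, 2, 102, 0], [0, -2, 0, 60]], 445, 205, 460, 299, 11058, 388⟩, ⟨1242,
  401982, -4429, -7⟩),
  (⟨[[621, 50, -16, 0], [97, 321, 0, -4], [-12, 3, 142, 0], [-1, -4, 1, 77]], [[552, 6, -10, 1],
  [16, 205, 1, -2], [-9, 1, 103, 0], [0, -2, 0, 60]], 449, 209, 456, 309, 10623, 394⟩, ⟨1281,
  397401, -4525, 0⟩),
  (⟨[[637, 46, -17, 0], [96, 322, -1, -4], [-13, 2, 142, 0], [-1, -4, 0, 78]], [[559, 2, -10, 1],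
  [13, 206, 0, -2], [-9, 1, 103, 0], [0, -2, 0, 60]], 453, 214, 452, 319, 10466, 399⟩, ⟨1319,
  392874, -4614, 8⟩),
  (⟨[[653, 41, -17, 1], [94, 323, -3, -4], [-14, 1, 143, 0], [0, -4, 0, 78]], [[565, -2, -10, 1],
  [10, 207, 0, -2], [-9, 0, 103, 0], [1, -2, 0, 60]], 459, 218, 449, 329, 10256, 404⟩, ⟨1356,
  388401, -4696, 15⟩),
  (⟨[[670, 36, -18, 1], [93, 324, -4, -4], [-15, 0, 143, -1], [0, -4, 0, 78]], [[571, -5, -10,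
  1], [7, 208, -1, -2], [-9, 0, 103, 0], [1, -2, 0, 61]], 462, 223, 445, 339, 9790, 415⟩, ⟨1391,
  384109, -4769, 22⟩),
  (⟨[[686, 30, -18, 1], [91, 325, -5, -4], [-16, -2, 144, -1], [0, -4, -1, 78]], [[577, -9, -10,
  1], [4, 209, -2, -2], [-9, -1, 104, -1], [1, -2, 0, 61]], 466, 227, 441, 349, 9638, 415⟩,
  ⟨1425, 379879, -4837, 30⟩),
  (⟨[[703, 25, -19, 1], [89, 326, -7, -4], [-16, -3, 144, -1], [0, -4, -1, 78]], [[583, -12, -9,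
  1], [1, 209, -2, -2], [-9, -1, 104, -1], [1, -2, -1, 61]], 470, 231, 438, 358, 9403, 409⟩,
  ⟨1458, 375715, -4898, 37⟩),
  (⟨[[721, 19, -19, 1], [87, 327, -8, -4], [-17, -4, 144, -1], [0, -4, -1, 78]], [[588, -16, -9,
  1], [-2, 210, -3, -2], [-9, -2, 104, -1], [1, -2, -1, 61]], 474, 236, 434, 368, 9213, 401⟩,
  ⟨1490, 371618, -4954, 44⟩),
  (⟨[[739, 13, -19, 2], [85, 328, -9, -4], [-18, -5, 145, -2], [0, -4, -2, 78]], [[594, -19, -9,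
  1], [-5, 211, -3, -2], [-9, -3, 104, -1], [1, -2, -1, 61]], 477, 241, 431, 377, 9285, 393⟩,
  ⟨1522, 367461, -5005, 51⟩),
  (⟨[[758, 6, -19, 2], [83, 329, -10, -4], [-18, -6, 145, -2], [0, -4, -2, 78]], [[599, -23, -9,
  1], [-8, 212, -4, -2], [-9, -3, 104, -1], [1, -2, -1, 61]], 480, 246, 427, 386, 9093, 386⟩,
  ⟨1553, 363372, -5051, 58⟩),
  (⟨[[778, 0, -20, 2], [80, 330, -11, -3], [-19, -7, 146, -2], [1, -4, -2, 78]], [[604, -27, -9,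
  1], [-12, 213, -4, -2], [-9, -4, 105, -1], [1, -2, -1, 61]], 482, 251, 423, 395, 9200, 376⟩,
  ⟨1584, 359219, -5092, 66⟩),
  (⟨[[798, -8, -19, 2], [78, 331, -12, -3], [-20, -8, 146, -3], [1, -4, -2, 79]], [[609, -30, -8,
  1], [-15, 214, -5, -2], [-8, -4, 105, -2], [1, -2, -1, 61]], 486, 257, 420, 404, 8656, 383⟩,
  ⟨1613, 355274, -5127, 72⟩),
  (⟨[[819, -15, -19, 3], [75, 332, -14, -3], [-20, -9, 146, -3], [1, -3, -3, 79]], [[614, -34,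
  -8, 2], [-18, 215, -6, -2], [-8, -5, 105, -2], [1, -2, -2, 61]], 488, 262, 416, 413, 9056,
  349⟩, ⟨1643, 351128, -5158, 79⟩),
  (⟨[[841, -24, -19, 3], [72, 333, -15, -3], [-20, -10, 147, -3], [1, -3, -3, 79]], [[618, -37,
  -7, 2], [-21, 216, -6, -2], [-8, -5, 105, -2], [1, -2, -2, 61]], 490, 267, 412, 422, 8868,
  339⟩, ⟨1672, 347053, -5185, 86⟩),
  (⟨[[864, -32, -19, 3], [68, 334, -16, -3], [-21, -11, 147, -4], [1, -3, -3, 79]], [[623, -41,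
  -7, 2], [-24, 217, -7, -2], [-7, -6, 105, -2], [1, -2, -2, 61]], 493, 273, 409, 431, 8949,
  312⟩, ⟨1701, 342909, -5206, 93⟩),
  (⟨[[889, -42, -18, 3], [64, 335, -17, -3], [-21, -12, 147, -4], [2, -3, -4, 79]], [[627, -45,
  -6, 2], [-27, 218, -7, -2], [-7, -6, 105, -2], [1, -2, -2, 61]], 494, 279, 405, 439, 8732,
  305⟩, ⟨1729, 338837, -5223, 99⟩),
  (⟨[[915, -52, -17, 3], [60, 336, -18, -2], [-21, -13, 148, -4], [2, -3, -4, 79]], [[631, -48,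
  -6, 2], [-31, 219, -8, -1], [-7, -7, 106, -2], [1, -2, -2, 61]], 496, 286, 401, 448, 8846,
  265⟩, ⟨1757, 334693, -5234, 106⟩),
  (⟨[[942, -62, -17, 4], [56, 337, -19, -2], [-22, -14, 148, -4], [2, -3, -4, 79]], [[636, -52,
  -5, 2], [-34, 220, -8, -1], [-6, -7, 106, -2], [1, -1, -2, 61]], 498, 292, 397, 457, 8939,
  265⟩, ⟨1785, 330471, -5241, 112⟩),
  (⟨[[972, -74, -16, 4], [51, 339, -20, -2], [-22, -15, 148, -5], [2, -3, -4, 79]], [[640, -56,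
  -5, 2], [-37, 221, -9, -1], [-6, -8, 106, -3], [1, -1, -3, 61]], 499, 300, 393, 466, 9058,
  229⟩, ⟨1813, 326166, -5243, 118⟩),
  (⟨[[1003, -86, -14, 4], [45, 340, -21, -2], [-22, -16, 149, -5], [2, -2, -5, 79]], [[644, -59,
  -4, 2], [-40, 222, -9, -1], [-5, -9, 106, -3], [1, -1, -3, 61]], 499, 307, 388, 475, 8922,
  193⟩, ⟨1840, 321932, -5240, 124⟩),
  (⟨[[1035, -99, -13, 4], [40, 342, -22, -2], [-22, -17, 149, -5], [3, -2, -5, 79]], [[647, -63,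
  -3, 2], [-44, 223, -10, -1], [-5, -9, 106, -3], [1, -1, -3, 61]], 501, 315, 384, 484, 9165,
  168⟩, ⟨1867, 317610, -5231, 130⟩),
  (⟨[[1070, -112, -12, 4], [34, 343, -24, -1], [-22, -18, 149, -6], [3, -2, -5, 79]], [[651, -66,
  -3, 2], [-47, 224, -11, -1], [-4, -10, 106, -3], [1, -1, -3, 61]], 502, 323, 380, 493, 9044,
  150⟩, ⟨1893, 313359, -5217, 135⟩),
  (⟨[[1107, -127, -10, 4], [27, 345, -25, -1], [-21, -19, 150, -6], [3, -2, -6, 79]], [[654, -70,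
  -2, 2], [-50, 225, -11, -1], [-3, -10, 106, -3], [1, -1, -3, 61]], 502, 331, 375, 502, 9287,
  112⟩, ⟨1919, 309015, -5198, 140⟩),
  (⟨[[1146, -143, -8, 4], [20, 347, -26, -1], [-21, -20, 150, -6], [3, -2, -6, 79]], [[657, -73,
  -1, 2], [-53, 226, -12, -1], [-3, -11, 107, -3], [1, -1, -3, 61]], 502, 340, 371, 510, 9172,
  86⟩, ⟨1944, 304744, -5173, 144⟩),
  (⟨[[1186, -159, -6, 4], [13, 349, -27, -1], [-21, -21, 150, -6], [3, -1, -6, 79]], [[660, -77,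
  0, 2], [-56, 227, -12, -1], [-2, -11, 107, -4], [1, -1, -3, 62]], 501, 350, 366, 519, 9042,
  98⟩, ⟨1968, 300551, -5145, 148⟩),
  (⟨[[1227, -175, -3, 4], [5, 351, -28, -1], [-20, -22, 151, -7], [3, -1, -6, 80]], [[662, -80,
  0, 1], [-59, 228, -13, -1], [-2, -12, 107, -4], [1, -1, -4, 62]], 501, 359, 362, 527, 8528,
  118⟩, ⟨1990, 296622, -5114, 152⟩),
  (⟨[[1269, -192, -1, 4], [-3, 353, -29, 0], [-19, -23, 151, -7], [3, -1, -7, 80]], [[665, -82,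
  1, 1], [-61, 229, -13, 0], [-1, -12, 107, -4], [1, -1, -4, 62]], 501, 370, 358, 534, 8343,
  140⟩, ⟨2011, 292790, -5079, 155⟩),
  (⟨[[1310, -208, 2, 4], [-11, 356, -30, 0], [-19, -24, 151, -7], [3, -1, -7, 80]], [[666, -85,
  2, 1], [-64, 230, -14, 0], [0, -13, 107, -4], [1, 0, -4, 62]], 499, 384, 353, 541, 7712, 181⟩,
  ⟨2030, 289251, -5044, 157⟩),
  (⟨[[1351, -224, 4, 4], [-18, 358, -31, 0], [-18, -24, 151, -7], [3, -1, -7, 80]], [[668, -87,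
  2, 1], [-66, 230, -14, 0], [0, -13, 107, -4], [1, 0, -4, 62]], 499, 398, 350, 548, 7516, 183⟩,
  ⟨2048, 285830, -5007, 160⟩),
  (⟨[[1392, -241, 7, 4], [-26, 360, -32, 0], [-17, -25, 151, -7], [3, -1, -7, 80]], [[669, -90,
  3, 1], [-68, 231, -15, 0], [1, -14, 107, -4], [1, 0, -4, 62]], 498, 411, 346, 554, 7211, 222⟩,
  ⟨2065, 282536, -4969, 161⟩),
  (⟨[[1433, -257, 9, 4], [-34, 362, -33, 0], [-16, -26, 152, -8], [3, 0, -7, 80]], [[670, -92, 4,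
  1], [-70, 232, -15, 0], [1, -14, 107, -4], [1, 0, -4, 62]], 496, 425, 342, 561, 6980, 231⟩,
  ⟨2081, 279377, -4929, 163⟩),
  (⟨[[1474, -273, 12, 3], [-42, 365, -33, 1], [-15, -27, 152, -8], [3, 0, -7, 80]], [[671, -94,
  4, 1], [-72, 232, -15, 0], [2, -15, 107, -4], [1, 0, -4, 62]], 494, 439, 338, 566, 6660, 255⟩,
  ⟨2096, 276360, -4889, 164⟩),
  (⟨[[1515, -290, 15, 3], [-50, 367, -34, 1], [-14, -28, 152, -8], [3, 0, -8, 80]], [[672, -95,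
  5, 1], [-73, 233, -16, 0], [2, -15, 107, -4], [1, 0, -4, 62]], 494, 452, 335, 572, 6349, 269⟩,
  ⟨2110, 273494, -4849, 165⟩),
  (⟨[[1555, -305, 18, 3], [-58, 369, -35, 1], [-13, -28, 152, -8], [3, 0, -8, 80]], [[673, -97,
  5, 1], [-75, 233, -16, 0], [3, -15, 107, -4], [1, 0, -4, 62]], 493, 466, 332, 577, 6007, 274⟩,
  ⟨2123, 270789, -4810, 166⟩),
  (⟨[[1595, -321, 20, 3], [-66, 372, -36, 1], [-12, -29, 152, -8], [3, 0, -8, 80]], [[673, -98,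
  6, 1], [-76, 234, -16, 0], [3, -15, 108, -4], [1, 0, -4, 62]], 492, 479, 329, 582, 6132, 275⟩,
  ⟨2136, 268038, -4768, 167⟩),
  (⟨[[1636, -337, 23, 3], [-74, 374, -36, 1], [-11, -30, 152, -8], [3, 0, -8, 80]], [[674, -100,
  6, 1], [-77, 234, -17, 0], [3, -16, 108, -5], [1, 0, -4, 62]], 489, 493, 325, 587, 5743, 301⟩,
  ⟨2148, 265458, -4727, 167⟩),
  (⟨[[1675, -353, 26, 2], [-82, 377, -37, 1], [-10, -30, 152, -8], [3, 0, -8, 80]], [[674, -101,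
  7, 1], [-79, 235, -17, 0], [4, -16, 108, -5], [1, 0, -5, 62]], 488, 506, 322, 592, 5365, 314⟩,
  ⟨2159, 263056, -4687, 167⟩),
  (⟨[[1715, -368, 29, 2], [-89, 379, -38, 2], [-9, -31, 152, -8], [3, 1, -8, 80]], [[674, -102,
  7, 1], [-80, 235, -17, 1], [4, -16, 108, -5], [1, 0, -5, 62]], 486, 519, 319, 597, 5446, 326⟩,
  ⟨2170, 260620, -4646, 167⟩),
  (⟨[[1754, -383, 31, 2], [-97, 381, -38, 2], [-7, -32, 153, -9], [3, 1, -8, 80]], [[674, -103,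
  7, 1], [-81, 235, -17, 1], [4, -16, 108, -5], [1, 0, -5, 62]], 486, 532, 317, 601, 5046, 345⟩,
  ⟨2180, 258373, -4606, 167⟩),
  (⟨[[1792, -398, 34, 1], [-105, 383, -39, 2], [-6, -32, 153, -9], [3, 1, -8, 80]], [[674, -104,
  8, 0], [-82, 236, -18, 1], [5, -17, 108, -5], [1, 1, -5, 62]], 484, 545, 314, 605, 5120, 343⟩,
  ⟨2190, 256095, -4565, 167⟩),
  (⟨[[1832, -414, 37, 1], [-113, 386, -40, 2], [-5, -33, 153, -9], [3, 1, -8, 80]], [[674, -105,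
  8, 0], [-82, 236, -18, 1], [5, -17, 108, -5], [1, 1, -5, 62]], 482, 558, 311, 609, 5205, 346⟩,
  ⟨2200, 253786, -4522, 167⟩),
  (⟨[[1872, -429, 40, 1], [-121, 388, -40, 2], [-4, -33, 153, -9], [3, 1, -8, 80]], [[674, -106,
  8, 0], [-83, 236, -18, 1], [5, -17, 108, -5], [0, 1, -5, 62]], 480, 572, 308, 613, 4770, 363⟩,
  ⟨2209, 251681, -4483, 166⟩),
  (⟨[[1910, -444, 43, 1], [-129, 391, -41, 2], [-3, -34, 153, -9], [3, 1, -9, 80]], [[673, -106,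
  9, 0], [-84, 236, -18, 1], [6, -17, 108, -5], [0, 1, -5, 62]], 480, 585, 306, 617, 4827, 364⟩,
  ⟨2218, 249550, -4441, 166⟩),
  (⟨[[1947, -458, 45, 0], [-136, 393, -42, 2], [-1, -35, 153, -9], [3, 1, -9, 80]], [[673, -107,
  9, 0], [-85, 236, -18, 1], [6, -17, 108, -5], [0, 1, -5, 62]], 478, 597, 303, 621, 4372, 383⟩,
  ⟨2226, 247633, -4403, 165⟩),
  (⟨[[1983, -472, 48, 0], [-144, 395, -42, 3], [0, -35, 153, -9], [3, 1, -9, 80]], [[673, -108,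
  9, 0], [-85, 237, -19, 1], [6, -18, 108, -5], [0, 1, -5, 62]], 477, 609, 301, 624, 4400, 386⟩,
  ⟨2234, 245694, -4364, 165⟩),
  (⟨[[2020, -486, 51, 0], [-151, 397, -43, 3], [1, -36, 153, -9], [3, 2, -9, 80]], [[672, -108,
  10, 0], [-86, 237, -19, 1], [6, -18, 108, -5], [0, 1, -5, 62]], 476, 622, 299, 628, 4479, 383⟩,
  ⟨2242, 243735, -4324, 164⟩),
  (⟨[[2056, -500, 53, -1], [-158, 399, -43, 3], [2, -36, 153, -9], [2, 2, -9, 80]], [[672, -109,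
  10, 0], [-86, 237, -19, 1], [7, -18, 108, -5], [0, 1, -5, 62]], 473, 634, 296, 631, 3970, 398⟩,
  ⟨2249, 242003, -4288, 163⟩),
  (⟨[[2090, -512, 56, -1], [-165, 401, -44, 3], [3, -37, 153, -9], [2, 2, -9, 80]], [[671, -109,
  10, 0], [-87, 237, -19, 1], [7, -18, 108, -5], [0, 1, -5, 62]], 472, 646, 294, 634, 3988, 399⟩,
  ⟨2256, 240254, -4251, 163⟩),
  (⟨[[2124, -525, 58, -1], [-172, 404, -44, 3], [5, -37, 153, -9], [2, 2, -9, 80]], [[670, -110,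
  10, 0], [-87, 237, -19, 1], [7, -18, 108, -5], [0, 1, -5, 62]], 471, 658, 292, 638, 4056, 387⟩,
  ⟨2263, 238490, -4213, 162⟩),
  (⟨[[2156, -538, 60, -2], [-179, 406, -45, 3], [6, -38, 153, -9], [2, 2, -9, 80]], [[670, -110,
  10, 0], [-88, 237, -19, 1], [7, -18, 108, -5], [0, 1, -5, 62]], 470, 670, 290, 640, 3514, 400⟩,
  ⟨2269, 236964, -4180, 161⟩),
  (⟨[[2187, -549, 63, -2], [-185, 407, -45, 3], [7, -38, 153, -9], [2, 2, -9, 80]], [[669, -110,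
  11, 0], [-88, 237, -19, 1], [7, -18, 108, -5], [0, 1, -5, 62]], 468, 681, 288, 643, 3547, 409⟩,
  ⟨2275, 235427, -4146, 160⟩),
  (⟨[[2217, -560, 65, -2], [-192, 409, -46, 3], [8, -39, 153, -9], [2, 2, -9, 80]], [[668, -110,
  11, 0], [-88, 237, -19, 1], [7, -18, 108, -5], [0, 1, -5, 62]], 467, 691, 286, 646, 3582, 421⟩,
  ⟨2281, 233878, -4111, 159⟩),
  (⟨[[2248, -572, 67, -2], [-198, 411, -46, 3], [9, -39, 153, -9], [2, 2, -9, 80]], [[668, -111,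
  11, 0], [-88, 237, -20, 1], [8, -19, 108, -5], [0, 1, -5, 62]], 466, 702, 284, 649, 3578, 421⟩,
  ⟨2287, 232318, -4076, 159⟩),
  (⟨[[2279, -583, 69, -3], [-204, 413, -47, 3], [10, -40, 153, -9], [2, 2, -9, 80]], [[667, -111,
  11, 0], [-89, 237, -20, 1], [8, -19, 108, -5], [0, 1, -5, 62]], 464, 713, 282, 652, 3638, 398⟩,
  ⟨2293, 230747, -4040, 158⟩),
  (⟨[[2310, -595, 72, -3], [-211, 415, -47, 4], [11, -40, 153, -10], [1, 2, -9, 80]], [[666,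
  -111, 11, 0], [-89, 237, -20, 1], [8, -19, 108, -5], [0, 1, -5, 62]], 463, 724, 280, 654, 3662,
  406⟩, ⟨2299, 229164, -4004, 157⟩),
  (⟨[[2339, -605, 74, -3], [-217, 416, -47, 4], [12, -40, 153, -10], [1, 3, -9, 80]], [[665,
  -111, 11, 0], [-89, 237, -20, 1], [8, -19, 108, -5], [0, 1, -5, 62]], 461, 734, 278, 657, 3081,
  406⟩, ⟨2304, 227838, -3973, 156⟩),
  (⟨[[2365, -615, 76, -4], [-223, 418, -48, 4], [13, -41, 153, -10], [1, 3, -9, 80]], [[664,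
  -111, 11, 0], [-89, 237, -20, 1], [8, -19, 108, -5], [0, 1, -5, 62]], 459, 744, 276, 659, 3097,
  410⟩, ⟨2309, 226504, -3942, 155⟩),
  (⟨[[2391, -625, 78, -4], [-228, 420, -48, 4], [14, -41, 153, -10], [1, 3, -9, 80]], [[663,
  -111, 12, 0], [-89, 237, -20, 1], [8, -19, 108, -5], [0, 1, -5, 62]], 460, 753, 275, 662, 3122,
  414⟩, ⟨2314, 225163, -3910, 154⟩),
  (⟨[[2417, -634, 79, -4], [-234, 421, -49, 4], [15, -42, 153, -10], [1, 3, -9, 80]], [[662,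
  -111, 12, 0], [-90, 237, -20, 1], [8, -19, 108, -5], [0, 1, -5, 62]], 458, 762, 273, 664, 3135,
  414⟩, ⟨2319, 223816, -3878, 153⟩),
  (⟨[[2443, -643, 81, -4], [-239, 423, -49, 4], [17, -42, 153, -10], [1, 3, -9, 80]], [[662,
  -111, 12, 0], [-90, 237, -20, 1], [8, -19, 108, -5], [0, 1, -5, 62]], 456, 772, 271, 667, 3159,
  416⟩, ⟨2324, 222462, -3845, 152⟩),
  (⟨[[2468, -653, 83, -5], [-245, 424, -49, 4], [18, -42, 153, -10], [1, 3, -9, 80]], [[661,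
  -111, 12, 0], [-90, 237, -20, 1], [9, -19, 108, -5], [0, 1, -5, 62]], 454, 781, 269, 669, 3170,
  420⟩, ⟨2329, 221103, -3812, 151⟩),
  (⟨[[2491, -661, 85, -5], [-250, 425, -50, 4], [18, -43, 153, -10], [1, 3, -9, 80]], [[660,
  -111, 12, 0], [-90, 237, -20, 1], [9, -19, 108, -5], [0, 1, -5, 62]], 454, 789, 268, 671, 2547,
  417⟩, ⟨2333, 220011, -3786, 150⟩),
  (⟨[[2514, -669, 86, -5], [-254, 427, -50, 4], [19, -43, 153, -10], [0, 3, -9, 80]], [[659,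
  -111, 12, 0], [-90, 237, -20, 1], [9, -19, 108, -5], [0, 1, -5, 62]], 452, 797, 266, 673, 3200,
  413⟩, ⟨2338, 218642, -3752, 149⟩),
  (⟨[[2536, -677, 88, -5], [-259, 428, -50, 4], [20, -43, 153, -10], [0, 3, -9, 80]], [[658,
  -111, 12, -1], [-90, 237, -20, 2], [9, -19, 108, -5], [0, 1, -5, 62]], 452, 805, 265, 675,
  2572, 411⟩, ⟨2342, 217543, -3725, 148⟩),
  (⟨[[2555, -684, 89, -6], [-264, 429, -50, 4], [21, -43, 153, -10], [0, 3, -9, 80]], [[657,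
  -111, 12, -1], [-90, 236, -20, 2], [9, -19, 108, -5], [0, 1, -5, 62]], 450, 812, 263, 677,
  2578, 415⟩, ⟨2346, 216441, -3698, 147⟩),
  (⟨[[2574, -690, 91, -6], [-268, 430, -51, 4], [22, -44, 153, -10], [0, 3, -9, 80]], [[656,
  -111, 12, -1], [-90, 236, -20, 2], [9, -19, 108, -5], [0, 1, -5, 62]], 449, 819, 262, 679,
  2592, 414⟩, ⟨2350, 215337, -3670, 146⟩),
  (⟨[[2593, -697, 92, -6], [-272, 431, -51, 4], [23, -44, 153, -10], [0, 3, -9, 80]], [[655,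
  -111, 12, -1], [-90, 236, -20, 2], [9, -19, 108, -5], [0, 1, -5, 62]], 447, 825, 260, 681,
  2598, 417⟩, ⟨2354, 214230, -3642, 145⟩),
  (⟨[[2612, -703, 94, -6], [-276, 432, -51, 4], [24, -44, 153, -10], [0, 3, -9, 80]], [[654,
  -111, 12, -1], [-90, 236, -20, 2], [9, -19, 107, -5], [0, 1, -5, 62]], 447, 832, 259, 683,
  2603, 416⟩, ⟨2358, 213121, -3614, 144⟩),
  (⟨[[2630, -709, 95, -6], [-280, 433, -51, 4], [24, -44, 153, -10], [0, 3, -9, 80]], [[653,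
  -111, 12, -1], [-90, 236, -20, 2], [9, -19, 107, -5], [0, 1, -5, 61]], 445, 839, 257, 685,
  2607, 416⟩, ⟨2362, 212010, -3586, 143⟩),
  (⟨[[2647, -715, 96, -7], [-284, 434, -52, 5], [25, -45, 153, -10], [0, 3, -10, 80]], [[652,
  -111, 12, -1], [-90, 236, -20, 2], [9, -19, 107, -5], [0, 1, -5, 61]], 444, 845, 256, 687,
  2636, 445⟩, ⟨2366, 210898, -3558, 141⟩),
  (⟨[[2664, -721, 97, -7], [-288, 435, -52, 5], [26, -45, 153, -10], [0, 3, -10, 80]], [[651,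
  -111, 12, -1], [-90, 236, -20, 2], [9, -19, 107, -5], [0, 1, -5, 61]], 444, 851, 255, 689,
  2611, 445⟩, ⟨2370, 209785, -3530, 140⟩),
  (⟨[[2680, -727, 99, -7], [-292, 436, -52, 5], [27, -45, 153, -10], [-1, 4, -10, 79]], [[650,
  -110, 12, -1], [-90, 236, -20, 2], [9, -19, 107, -5], [0, 1, -5, 61]], 442, 857, 253, 691,
  2623, 430⟩, ⟨2374, 208671, -3501, 139⟩),
  (⟨[[2696, -732, 100, -7], [-296, 437, -52, 5], [28, -45, 153, -10], [-1, 4, -10, 79]], [[648,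
  -110, 13, -1], [-89, 235, -20, 2], [9, -19, 107, -5], [0, 2, -5, 61]], 441, 863, 252, 693,
  2625, 430⟩, ⟨2378, 207556, -3472, 138⟩),
  (⟨[[2711, -737, 101, -7], [-299, 437, -52, 5], [28, -46, 153, -10], [-1, 4, -10, 79]], [[647,
  -110, 13, -1], [-89, 235, -20, 2], [9, -19, 107, -5], [0, 2, -5, 61]], 439, 869, 250, 695,
  2625, 428⟩, ⟨2382, 206441, -3443, 137⟩),
  (⟨[[2726, -742, 102, -7], [-303, 438, -53, 5], [29, -46, 153, -10], [-1, 4, -10, 79]], [[646,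
  -110, 13, -1], [-89, 235, -20, 2], [9, -19, 107, -5], [0, 2, -5, 61]], 439, 874, 249, 697,
  2623, 424⟩, ⟨2386, 205327, -3414, 136⟩),
  (⟨[[2739, -746, 103, -8], [-306, 439, -53, 5], [30, -46, 153, -10], [-1, 4, -10, 79]], [[645,
  -110, 13, -1], [-89, 235, -20, 2], [9, -19, 107, -5], [0, 2, -5, 61]], 437, 879, 247, 699,
  2623, 420⟩, ⟨2390, 204213, -3385, 135⟩),
  (⟨[[2752, -750, 104, -8], [-309, 439, -53, 5], [30, -46, 153, -10], [-1, 4, -10, 79]], [[644,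
  -109, 13, -1], [-89, 235, -20, 2], [9, -19, 107, -5], [0, 2, -5, 61]], 436, 884, 246, 701,
  2650, 435⟩, ⟨2394, 203099, -3356, 133⟩),
  (⟨[[2765, -754, 105, -8], [-312, 440, -53, 5], [31, -46, 153, -10], [-1, 4, -10, 79]], [[642,
  -109, 13, -1], [-89, 234, -20, 2], [9, -19, 107, -5], [0, 2, -5, 61]], 434, 889, 244, 703,
  2617, 435⟩, ⟨2398, 201988, -3327, 132⟩),
  (⟨[[2776, -758, 105, -8], [-315, 440, -53, 5], [32, -46, 153, -10], [-1, 4, -10, 79]], [[641,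
  -109, 13, -1], [-89, 234, -20, 2], [9, -19, 107, -5], [-1, 2, -5, 61]], 434, 893, 243, 705,
  2617, 422⟩, ⟨2402, 200877, -3298, 131⟩),
  (⟨[[2786, -761, 106, -8], [-318, 441, -53, 5], [32, -47, 153, -10], [-1, 4, -10, 79]], [[640,
  -108, 13, -1], [-88, 234, -20, 2], [9, -19, 107, -5], [-1, 2, -5, 61]], 433, 897, 242, 707,
  2621, 412⟩, ⟨2406, 199769, -3268, 130⟩),
  (⟨[[2796, -763, 107, -8], [-320, 441, -53, 5], [33, -47, 153, -10], [-2, 4, -10, 79]], [[638,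
  -108, 13, -1], [-88, 234, -20, 2], [9, -19, 107, -5], [-1, 2, -5, 61]], 431, 901, 240, 709,
  2605, 410⟩, ⟨2410, 198664, -3239, 129⟩),
  (⟨[[2805, -766, 108, -9], [-323, 441, -53, 5], [34, -47, 153, -10], [-2, 4, -10, 79]], [[637,
  -108, 13, -1], [-88, 234, -20, 2], [10, -19, 107, -5], [-1, 2, -5, 61]], 431, 904, 239, 711,
  2627, 417⟩, ⟨2414, 197561, -3210, 127⟩),
  (⟨[[2812, -768, 108, -9], [-325, 442, -53, 5], [34, -47, 153, -10], [-2, 4, -10, 79]], [[635,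
  -108, 13, -1], [-88, 233, -20, 2], [10, -19, 107, -5], [-1, 2, -5, 61]], 429, 907, 237, 713,
  2603, 416⟩, ⟨2418, 196462, -3180, 126⟩),
  (⟨[[2819, -770, 109, -9], [-327, 442, -53, 5], [35, -47, 153, -10], [-2, 4, -10, 79]], [[634,
  -107, 13, -1], [-87, 233, -20, 2], [10, -19, 107, -5], [-1, 2, -5, 61]], 428, 910, 236, 715,
  2586, 413⟩, ⟨2422, 195366, -3151, 125⟩),
  (⟨[[2825, -771, 109, -9], [-329, 442, -53, 5], [35, -47, 153, -10], [-2, 4, -10, 79]], [[633,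
  -107, 13, -1], [-87, 233, -20, 2], [10, -19, 107, -5], [-1, 2, -5, 61]], 426, 912, 234, 716,
  2578, 398⟩, ⟨2426, 194274, -3122, 124⟩),
  (⟨[[2830, -772, 109, -9], [-331, 442, -53, 5], [36, -47, 152, -10], [-2, 4, -10, 79]], [[631,
  -106, 13, -1], [-87, 233, -20, 2], [10, -19, 107, -5], [-1, 2, -5, 61]], 425, 914, 233, 718,
  2607, 415⟩, ⟨2430, 193186, -3092, 122⟩),
  (⟨[[2834, -773, 110, -9], [-333, 442, -53, 5], [36, -47, 152, -10], [-2, 4, -10, 79]], [[630,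
  -106, 13, -1], [-87, 232, -20, 2], [10, -19, 107, -5], [-1, 2, -5, 61]], 423, 916, 231, 720,
  2557, 415⟩, ⟨2434, 192104, -3063, 121⟩),
  (⟨[[2837, -773, 110, -9], [-334, 441, -53, 5], [37, -47, 152, -10], [-2, 4, -10, 79]], [[628,
  -106, 13, -1], [-86, 232, -20, 2], [10, -19, 107, -5], [-1, 2, -5, 61]], 422, 917, 230, 722,
  2549, 399⟩, ⟨2438, 191026, -3034, 120⟩),
  (⟨[[2839, -773, 110, -9], [-335, 441, -53, 5], [37, -47, 152, -10], [-2, 4, -10, 79]], [[626,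
  -105, 13, -1], [-86, 232, -20, 2], [10, -19, 107, -5], [-1, 2, -5, 61]], 422, 918, 229, 724,
  3186, 394⟩, ⟨2443, 189687, -2998, 118⟩),
  (⟨[[2840, -772, 110, -9], [-337, 441, -53, 5], [37, -47, 152, -10], [-2, 4, -10, 79]], [[624,
  -105, 12, -1], [-86, 231, -20, 2], [9, -19, 107, -5], [-1, 2, -5, 61]], 420, 919, 227, 727,
  3139, 394⟩, ⟨2448, 188358, -2962, 117⟩),
  (⟨[[2839, -770, 110, -9], [-337, 440, -53, 5], [38, -47, 152, -10], [-2, 4, -10, 79]], [[622,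
  -104, 12, -1], [-85, 231, -20, 2], [9, -19, 106, -5], [-1, 2, -5, 61]], 418, 919, 225, 729,
  3147, 379⟩, ⟨2453, 187038, -2926, 115⟩),
  (⟨[[2837, -769, 110, -10], [-338, 440, -53, 5], [38, -47, 152, -10], [-2, 4, -9, 79]], [[620,
  -104, 12, -1], [-85, 231, -20, 2], [9, -19, 106, -5], [-1, 2, -5, 61]], 416, 919, 223, 731,
  3124, 396⟩, ⟨2458, 185729, -2890, 113⟩),
  (⟨[[2833, -766, 110, -10], [-338, 439, -53, 5], [38, -47, 152, -10], [-3, 4, -9, 79]], [[618,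
  -103, 12, -1], [-84, 230, -20, 2], [9, -19, 106, -5], [-1, 2, -5, 61]], 416, 918, 222, 734,
  3064, 396⟩, ⟨2463, 184431, -2855, 112⟩),
  (⟨[[2828, -763, 110, -10], [-339, 438, -53, 5], [39, -47, 151, -10], [-3, 4, -9, 79]], [[616,
  -102, 12, -1], [-84, 230, -20, 2], [9, -19, 106, -5], [-1, 2, -5, 61]], 414, 917, 220, 736,
  3069, 377⟩, ⟨2468, 183144, -2820, 110⟩),
  (⟨[[2822, -760, 109, -10], [-338, 437, -53, 5], [39, -47, 151, -10], [-3, 4, -9, 79]], [[614,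
  -102, 12, -1], [-84, 229, -20, 2], [9, -19, 106, -5], [-1, 2, -5, 61]], 412, 915, 218, 738,
  3015, 377⟩, ⟨2473, 181870, -2785, 109⟩),
  (⟨[[2813, -755, 109, -10], [-338, 436, -52, 5], [39, -47, 151, -10], [-3, 4, -9, 79]], [[612,
  -101, 12, -1], [-83, 229, -20, 2], [9, -19, 106, -5], [-1, 2, -5, 61]], 411, 913, 217, 741,
  3594, 357⟩, ⟨2479, 180358, -2744, 107⟩),
  (⟨[[2802, -750, 108, -10], [-337, 434, -52, 5], [39, -47, 151, -10], [-3, 4, -9, 79]], [[609,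
  -100, 12, -1], [-82, 228, -19, 2], [9, -19, 106, -5], [-1, 2, -5, 61]], 409, 909, 215, 743,
  3555, 353⟩, ⟨2485, 178865, -2703, 105⟩),
  (⟨[[2789, -744, 107, -10], [-336, 433, -52, 5], [39, -46, 151, -10], [-3, 4, -9, 79]], [[607,
  -100, 12, -1], [-82, 228, -19, 2], [9, -19, 106, -5], [-1, 2, -5, 61]], 408, 905, 213, 746,
  3504, 353⟩, ⟨2491, 177392, -2663, 103⟩),
  (⟨[[2774, -738, 106, -10], [-334, 431, -52, 5], [39, -46, 151, -10], [-3, 4, -9, 79]], [[604,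
  -99, 12, -1], [-81, 227, -19, 2], [9, -18, 106, -5], [-1, 2, -5, 61]], 406, 900, 211, 748,
  3462, 351⟩, ⟨2497, 175939, -2623, 101⟩),
  (⟨[[2756, -730, 105, -9], [-332, 429, -51, 5], [39, -46, 150, -10], [-3, 4, -9, 79]], [[602,
  -98, 12, -1], [-81, 227, -19, 2], [9, -18, 106, -5], [-1, 2, -5, 61]], 404, 895, 209, 751,
  3959, 347⟩, ⟨2504, 174270, -2578, 99⟩),
  (⟨[[2736, -721, 104, -9], [-330, 427, -51, 5], [39, -46, 150, -9], [-3, 4, -9, 78]], [[598,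
  -97, 12, -1], [-80, 226, -19, 2], [9, -18, 105, -5], [-1, 2, -5, 61]], 402, 888, 207, 754,
  3897, 324⟩, ⟨2511, 172631, -2533, 97⟩),
  (⟨[[2712, -711, 102, -9], [-327, 425, -50, 5], [39, -45, 150, -9], [-3, 4, -9, 78]], [[595,
  -96, 12, -1], [-79, 225, -19, 2], [9, -18, 105, -5], [-1, 2, -5, 61]], 399, 881, 204, 757,
  4361, 315⟩, ⟨2519, 170792, -2483, 95⟩),
  (⟨[[2684, -700, 100, -9], [-323, 422, -50, 5], [39, -45, 149, -9], [-3, 4, -9, 78]], [[592,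
  -95, 11, -1], [-78, 225, -19, 2], [9, -18, 105, -5], [-1, 2, -5, 61]], 398, 871, 202, 761,
  4295, 309⟩, ⟨2527, 168993, -2434, 92⟩),
  (⟨[[2655, -688, 98, -9], [-319, 419, -49, 5], [38, -44, 149, -9], [-3, 4, -9, 78]], [[588, -94,
  11, -1], [-77, 224, -19, 2], [9, -18, 105, -5], [-1, 2, -5, 61]], 396, 862, 200, 764, 4178,
  309⟩, ⟨2535, 167233, -2386, 90⟩),
  (⟨[[2623, -675, 96, -9], [-314, 416, -49, 5], [38, -44, 149, -9], [-3, 4, -9, 78]], [[585, -93,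
  11, -1], [-77, 223, -18, 2], [9, -18, 105, -5], [-1, 2, -5, 61]], 393, 851, 197, 767, 4588,
  295⟩, ⟨2544, 165299, -2333, 88⟩),
  (⟨[[2585, -660, 94, -9], [-309, 413, -48, 5], [37, -43, 148, -9], [-3, 4, -9, 78]], [[580, -91,
  11, -1], [-76, 222, -18, 2], [8, -18, 105, -5], [-1, 2, -5, 61]], 391, 839, 195, 771, 4970,
  279⟩, ⟨2554, 163208, -2277, 85⟩),
  (⟨[[2544, -644, 91, -8], [-303, 409, -47, 5], [36, -43, 148, -9], [-3, 4, -9, 78]], [[576, -90,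
  11, -1], [-74, 221, -18, 2], [8, -17, 105, -5], [-1, 2, -5, 61]], 388, 825, 192, 774, 4833,
  278⟩, ⟨2564, 161178, -2222, 82⟩),
  (⟨[[2500, -627, 89, -8], [-296, 405, -46, 5], [36, -42, 147, -9], [-3, 4, -9, 78]], [[572, -89,
  11, -1], [-73, 220, -18, 2], [8, -17, 104, -5], [-1, 2, -5, 60]], 385, 810, 189, 778, 5116,
  278⟩, ⟨2575, 159013, -2164, 80⟩),
  (⟨[[2451, -608, 86, -8], [-289, 400, -45, 5], [35, -41, 147, -9], [-3, 4, -9, 78]], [[567, -87,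
  10, -1], [-72, 219, -18, 2], [8, -17, 104, -5], [-1, 2, -5, 60]], 384, 794, 187, 782, 5415,
  243⟩, ⟨2587, 156731, -2103, 77⟩),
  (⟨[[2398, -588, 82, -8], [-281, 396, -44, 4], [34, -41, 146, -9], [-3, 4, -9, 78]], [[562, -85,
  10, -1], [-71, 218, -17, 2], [8, -17, 104, -5], [-1, 1, -5, 60]], 381, 776, 184, 786, 5648,
  235⟩, ⟨2600, 154351, -2039, 74⟩),
  (⟨[[2341, -567, 79, -7], [-272, 391, -43, 4], [33, -40, 146, -9], [-3, 4, -9, 77]], [[556, -84,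
  10, -1], [-69, 217, -17, 2], [8, -17, 104, -5], [-1, 1, -5, 60]], 377, 757, 180, 791, 5827,
  227⟩, ⟨2614, 151889, -1974, 71⟩),
  (⟨[[2280, -545, 75, -7], [-262, 385, -42, 4], [31, -39, 145, -9], [-3, 4, -8, 77]], [[550, -82,
  9, -1], [-68, 216, -17, 2], [7, -16, 103, -5], [-1, 1, -5, 60]], 374, 736, 177, 795, 5967,
  216⟩, ⟨2629, 149364, -1908, 68⟩),
  (⟨[[2217, -522, 72, -7], [-253, 379, -41, 4], [30, -38, 145, -8], [-3, 4, -8, 77]], [[544, -80,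
  9, -1], [-66, 214, -17, 1], [7, -16, 103, -5], [-1, 1, -5, 60]], 372, 715, 174, 800, 6077,
  196⟩, ⟨2645, 146791, -1841, 65⟩),
  (⟨[[2150, -497, 68, -6], [-242, 373, -40, 4], [29, -37, 144, -8], [-2, 3, -8, 77]], [[537, -78,
  9, -1], [-65, 213, -16, 1], [7, -16, 103, -5], [-1, 1, -5, 60]], 369, 693, 171, 804, 6516,
  195⟩, ⟨2663, 144038, -1770, 61⟩),
  (⟨[[2078, -472, 64, -6], [-231, 367, -39, 4], [27, -36, 143, -8], [-2, 3, -8, 77]], [[530, -76,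
  9, -1], [-63, 211, -16, 1], [7, -15, 102, -5], [-1, 1, -5, 60]], 366, 668, 167, 810, 6817,
  195⟩, ⟨2683, 141141, -1696, 58⟩),
  (⟨[[2002, -445, 59, -5], [-219, 360, -37, 4], [26, -34, 142, -8], [-2, 3, -8, 77]], [[523, -73,
  8, -1], [-61, 209, -16, 1], [6, -15, 102, -4], [-1, 1, -4, 60]], 362, 643, 163, 815, 7048,
  174⟩, ⟨2705, 138137, -1621, 55⟩),
  (⟨[[1923, -418, 55, -5], [-207, 353, -36, 3], [24, -33, 141, -8], [-2, 3, -8, 76]], [[514, -71,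
  8, -1], [-59, 207, -15, 1], [6, -15, 102, -4], [0, 1, -4, 60]], 358, 616, 159, 821, 7534, 148⟩,
  ⟨2730, 134935, -1541, 51⟩),
  (⟨[[1841, -390, 50, -4], [-194, 345, -34, 3], [22, -32, 140, -8], [-2, 3, -7, 76]], [[506, -68,
  7, -1], [-57, 205, -15, 1], [6, -14, 101, -4], [0, 1, -4, 59]], 355, 589, 155, 826, 7844, 147⟩,
  ⟨2758, 131588, -1460, 47⟩),
  (⟨[[1756, -361, 46, -4], [-180, 337, -33, 3], [20, -30, 139, -7], [-2, 3, -7, 76]], [[496, -65,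
  7, -1], [-54, 203, -14, 1], [6, -14, 101, -4], [0, 1, -4, 59]], 352, 560, 151, 833, 8021, 141⟩,
  ⟨2789, 128147, -1378, 44⟩),
  (⟨[[1671, -333, 42, -4], [-167, 329, -31, 3], [19, -29, 138, -7], [-2, 3, -7, 76]], [[486, -62,
  7, -1], [-52, 201, -14, 1], [5, -13, 100, -4], [0, 1, -4, 59]], 349, 532, 147, 839, 8378, 113⟩,
  ⟨2824, 124556, -1294, 40⟩)]

theorem chainOK_chain : chainOK chainStart chain = true := by decide +kernel

/-! ### Meaning of the integer tests -/

section Soundness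

theorem absSum_eq (f : ℕ → ℤ) (n a : ℕ) :
    (absSum f n a : ℝ) = ∑ i ∈ Finset.Ico a (a + n), |(f i : ℝ)| := by
  induction n generalizing a with
  | zero => simp [absSum]
  | succ n ih =>
    rw [Finset.sum_eq_sum_Ico_succ_bot (by omega), absSum, Nat.cast_add, ih, Nat.cast_natAbs,
      Int.cast_abs, show a + 1 + n = a + (n + 1) by ring]

theorem absSum_zero_eq (f : ℕ → ℤ) (n : ℕ) :
    (absSum f n 0 : ℝ) = ∑ i ∈ Finset.range n, |(f i : ℝ)| := by
  rw [absSum_eq, zero_add, Finset.range_eq_Ico]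

theorem allBelow_iff {p : ℕ → Bool} {n : ℕ} : allBelow p n = true ↔ ∀ i < n, p i = true := by
  induction n with
  | zero => simp [allBelow]
  | succ n ih =>
    rw [allBelow, Bool.and_eq_true, ih, Nat.forall_lt_succ_right, and_comm]

theorem dot_eq (row : List ℤ) (a b c d : ℤ) : dot row [a, b, c, d]
    = row.getD 0 0 * a + row.getD 1 0 * b + row.getD 2 0 * c + row.getD 3 0 * d := by
  match row with
  | [] => simp [dot]
  | [x] => simp [dot]
  | [x, y] => simp [dot]
  | [x, y, z] => simp [dot]; ring
  | x :: y :: z :: w :: l => simp [dot]; ring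

/-- The coefficients that a list represents, in units of `2⁻²⁰`. -/
noncomputable def scaled (l : List ℤ) (i : ℕ) : ℝ := (l.getD i 0 : ℝ) / 1048576

theorem prodCoeff_scaled {u y : List ℤ} (hu : u.length = 3) (hy : y.length = 3) (c : ℕ) :
    prodCoeff (scaled u) (scaled y) c = ((prodList u y).getD c 0 : ℝ) / (4 * 1048576 ^ 2) := by
  obtain ⟨u0, u1, u2, rfl⟩ := List.length_eq_three.1 hu
  obtain ⟨y0, y1, y2, rfl⟩ := List.length_eq_three.1 hy
  match c with
  | 0 | 1 | 2 | 3 | 4 | 5 =>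
    simp only [prodCoeff, prodList, scaled, List.getD_cons_zero, List.getD_cons_succ]
    push_cast
    ring
  | n + 6 => simp [prodCoeff, prodList]

theorem foldEntry_scaled {u y : List ℤ} (hu : u.length = 3) (hy : y.length = 3) (π a q : ℕ) :
    foldEntry (prodCoeff (scaled u) (scaled y)) π a q
      = (foldInt (prodList u y) π a q : ℝ) / (4 * 1048576 ^ 2) := by
  rw [foldEntry, prodCoeff_scaled hu hy, prodCoeff_scaled hu hy, foldInt]
  push_cast
  ring

theorem combine_getD (j2 : ℤ) {l m : List ℤ} (h : l.length = m.length) (c : ℕ) :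
    (combine j2 l m).getD c 0 = 16 * (j2 + 1) * l.getD c 0 - 32 * j2 * m.getD c 0 := by
  induction l generalizing m c with
  | nil =>
    obtain rfl : m = [] := List.length_eq_zero_iff.1 h.symm
    simp [combine]
  | cons x l ih =>
    match m with
    | y :: m =>
      match c with
      | 0 => simp [combine]
      | c + 1 =>
        have := ih (m := m) (by simpa using h) c
        simpa [combine] using this

theorem prodList_length {u y : List ℤ} (hu : u.length = 3) (hy : y.length = 3) :
    (prodList u y).length = 6 := by
  obtain ⟨u0, u1, u2, rfl⟩ := List.length_eq_three.1 hu
  obtain ⟨y0, y1, y2, rfl⟩ := List.length_eq_three.1 hy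
  rfl

theorem entryInt_eq {u y : List ℤ} (hu : u.length = 3) (hy : y.length = 3) (bz : ℤ) (π q a : ℕ) :
    (entryInt (combine (((2 * q + π + 1) * (2 * q + π + 1) : ℕ) : ℤ) (prodList u u) (prodList u y))
      (bz * (((2 * q + π + 1) * (2 * q + π + 1) : ℕ) : ℤ) * 4294967296) π q a : ℝ)
      = linEntry (bz / 256) (scaled u) (scaled y) π q a
        * (((2 * q + π + 1 : ℕ) ^ 2 + 1) * 1048576 ^ 2) := by
  have hl := (prodList_length hu hu).trans (prodList_length hu hy).symm
  rw [entryInt, foldInt, combine_getD _ hl, combine_getD _ hl, linEntry, foldEntry_scaled hu hu,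
    foldEntry_scaled hu hy, foldInt, foldInt]
  have hj : ((2 * q + π + 1 : ℕ) : ℝ) ^ 2 + 1 ≠ 0 := by positivity
  by_cases h : a = q
  · rw [if_pos h, h, Nat.beq_refl]
    push_cast [cond_true] at hj ⊢
    field_simp
    ring
  · rw [if_neg h, show Nat.beq a q = false from
      Bool.eq_false_iff.2 fun e => h (Nat.eq_of_beq_eq_true e)]
    push_cast [cond_false] at hj ⊢
    field_simp
    ring

/-- The matrix entries that a list of rows represents, in units of `1 / 4096`. -/
noncomputable def scaledMatrix (B : List (List ℤ)) (i a : ℕ) : ℝ :=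
  ((B.getD i []).getD a 0 : ℝ) / 4096

theorem colInt_eq (B : List (List ℤ)) (β : ℕ → ℕ → ℕ → ℝ) {π : ℕ} (hβ : β π = scaledMatrix B)
    (b : ℝ) (u y : ℕ → ℝ) (q i : ℕ) {j2 s e0 e1 e2 e3 : ℤ}
    (hj : j2 = (((2 * q + π + 1) * (2 * q + π + 1) : ℕ) : ℤ))
    (h0 : (e0 : ℝ) = linEntry b u y π q 0 * s)
    (h1 : (e1 : ℝ) = linEntry b u y π q 1 * s) (h2 : (e2 : ℝ) = linEntry b u y π q 2 * s)
    (h3 : (e3 : ℝ) = linEntry b u y π q 3 * s) :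
    (colInt (B.getD i []) [e0, e1, e2, e3] j2 s q i : ℝ)
      = colEntry β b u y π q i * (4096 * s) := by
  rw [colInt, dot_eq, colEntry, hj]
  simp only [hβ, scaledMatrix, Finset.sum_range_succ, Finset.sum_range_zero]
  push_cast
  rw [h0, h1, h2, h3]
  have hc : (Nat.ble q 3 = true) ↔ q < 4 := by rw [Nat.ble_eq]; omega
  have hd : (Nat.beq i q = true) ↔ i = q := by rw [Nat.beq_eq]
  simp only [Bool.cond_eq_ite, hc, hd]
  split_ifs <;> push_cast <;> ring

theorem colOK_sound {u y : List ℤ} (hu : u.length = 3) (hy : y.length = 3) {bz : ℤ}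
    {B : List (List ℤ)} {β : ℕ → ℕ → ℕ → ℝ} {π : ℕ} (hβ : β π = scaledMatrix B) {k q : ℕ}
    (h : colOK bz (prodList u u) (prodList u y) B k π q = true) :
    117 / 100 * (∑ i ∈ Finset.range 4, |colEntry β (bz / 256) (scaled u) (scaled y) π q i|
      + (∑ a ∈ Finset.Ico 4 (q + 6), |linEntry (bz / 256) (scaled u) (scaled y) π q a|) / 81)
      ≤ k / 1000 := by
  simp only [colOK, forceInt_eq, forceList_eq, Nat.ble_eq] at h
  have he := entryInt_eq hu hy bz π q
  set j2 : ℤ := (((2 * q + π + 1) * (2 * q + π + 1) : ℕ) : ℤ) with hj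
  set f := combine j2 (prodList u u) (prodList u y)
  set s : ℤ := (j2 + 1) * 1099511627776 with hs
  have hs' : ((2 * q + π + 1 : ℕ) ^ 2 + 1) * 1048576 ^ 2 = (s : ℝ) := by
    rw [hs, hj]; push_cast; ring
  have hs0 : (0 : ℝ) < s := by rw [← hs']; positivity
  rw [hs'] at he
  have h' := (Nat.cast_le (α := ℝ)).2 h
  push_cast at h'
  rw [absSum_zero_eq, absSum_eq, show 4 + (q + 2) = q + 6 by ring, Nat.cast_natAbs, Int.cast_abs,
    abs_of_pos hs0] at h'
  simp only [he, colInt_eq B β hβ _ _ _ q _ hj (he 0) (he 1) (he 2) (he 3), abs_mul,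
    ← Finset.sum_mul, abs_of_pos hs0, abs_of_pos (show (0 : ℝ) < 4096 by norm_num)] at h'
  set X := ∑ i ∈ Finset.range 4, |colEntry β (bz / 256) (scaled u) (scaled y) π q i|
  set Y := ∑ a ∈ Finset.Ico 4 (q + 6), |linEntry (bz / 256) (scaled u) (scaled y) π q a|
  have h2 : (117000 * (81 * X + Y) * 4096) * (s : ℝ) ≤ (100 * k * 81 * 4096) * s := by linarith
  have h3 := le_of_mul_le_mul_right h2 hs0
  linarith

theorem residualInt_eq {u y : List ℤ} (hu : u.length = 3) (hy : y.length = 3) (bz : ℤ) (a : ℕ) :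
    (residualInt bz u y (prodList u u) a : ℝ)
      = residual (bz / 256) (scaled u) (scaled y) a * 1048576 ^ 3 := by
  rw [residualInt, residual]
  simp only [Finset.sum_range_succ, Finset.sum_range_zero, foldEntry_scaled hu hu]
  by_cases ha : a < 3
  · rw [if_pos ha]
    simp only [scaled]
    push_cast
    ring
  · rw [if_neg ha, List.getD_eq_default y 0 (by omega), List.getD_eq_default u 0 (by omega)]
    simp only [scaled]
    push_cast
    ring

theorem residualOK_sound {u y : List ℤ} (hu : u.length = 3) (hy : y.length = 3) {bz : ℤ}
    {B : List (List ℤ)} {β : ℕ → ℕ → ℕ → ℝ} (hβ : β 0 = scaledMatrix B) {yb : ℕ}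
    (h : residualOK bz u y (prodList u u) B yb = true) :
    127 / 100 * (∑ i ∈ Finset.range 4, |∑ a ∈ Finset.range 4, β 0 i a
        * residual (bz / 256) (scaled u) (scaled y) a|
      + (∑ a ∈ Finset.Ico 4 8, |residual (bz / 256) (scaled u) (scaled y) a|) / 81)
      ≤ yb / 1000000 := by
  simp only [residualOK, forceList_eq, Nat.ble_eq] at h
  have h' := (Nat.cast_le (α := ℝ)).2 h
  push_cast at h'
  rw [absSum_zero_eq, absSum_eq] at h'
  have hd : ∀ i, ((dot (B.getD i []) [residualInt bz u y (prodList u u) 0,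
      residualInt bz u y (prodList u u) 1, residualInt bz u y (prodList u u) 2,
      residualInt bz u y (prodList u u) 3] : ℤ) : ℝ)
      = (∑ a ∈ Finset.range 4, β 0 i a * residual (bz / 256) (scaled u) (scaled y) a)
        * (4096 * 1048576 ^ 3) := by
    intro i
    rw [dot_eq]
    push_cast
    simp only [residualInt_eq hu hy, hβ, scaledMatrix, Finset.sum_range_succ,
      Finset.sum_range_zero]
    ring
  simp only [hd, residualInt_eq hu hy, abs_mul, ← Finset.sum_mul] at h'
  rw [abs_of_pos (show (0 : ℝ) < 4096 by norm_num),
    abs_of_pos (show (0 : ℝ) < 1048576 ^ 3 by norm_num)] at h'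
  linarith

/-- The parameter value of a node. -/
noncomputable def Node.b (n : Node) : ℝ := n.bz / 256

/-- The coefficients of `u` at a node. -/
noncomputable def Node.u (n : Node) : ℕ → ℝ := scaled n.uList

/-- The coefficients of `y` at a node. -/
noncomputable def Node.y (n : Node) : ℕ → ℝ := scaled n.yList

theorem Node.u_zero (n : Node) : n.u 0 = (1 - n.y 0) / 2 := by
  simp [Node.u, Node.y, scaled, uList, yList]; ring

theorem Node.u_one (n : Node) : n.u 1 = -(9 / 10) * n.y 1 := by
  simp [Node.u, Node.y, scaled, uList, yList]; ring

theorem Node.u_two (n : Node) : n.u 2 = -(25 / 26) * n.y 2 := by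
  simp [Node.u, Node.y, scaled, uList, yList]; ring

/-- The matrices of a cell, for the odd (`π = 0`) and the even frequencies. -/
noncomputable def Cell.β (c : Cell) (π : ℕ) : ℕ → ℕ → ℝ :=
  scaledMatrix (if π = 0 then c.B0 else c.B1)

theorem invOK_sound {B : List (List ℤ)} {al : ℕ} (h : invOK B al = true) {q : ℕ} (hq : q < 4) :
    117 / 100 * ∑ a ∈ Finset.range 4, |scaledMatrix B a q| ≤ al / 1000 := by
  have h1 := allBelow_iff.1 h q hq
  rw [Nat.ble_eq] at h1
  have h' := (Nat.cast_le (α := ℝ)).2 h1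
  push_cast at h'
  rw [absSum_zero_eq] at h'
  simp only [scaledMatrix, abs_div, ← Finset.sum_div]
  rw [abs_of_pos (show (0 : ℝ) < 4096 by norm_num)]
  linarith

-- Both weights in use, `r = 65 / 64` and `r = 1`, satisfy this bound.
variable {r : ℝ} [hr : Fact (1 ≤ r)] (h5 : r ^ 5 ≤ 1081 / 1000)

include h5

theorem norm_oddPoly_scaled_le {l : List ℤ} {N : ℕ}
    (h : 1081 * absSum (fun i => l.getD i 0) 3 0 ≤ N * 1048576) :
    ‖oddPoly r (scaled l)‖ ≤ N / 1000 := by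
  have h' := (Nat.cast_le (α := ℝ)).2 h
  push_cast at h'
  rw [absSum_zero_eq] at h'
  refine (norm_oddPoly_le r _).trans ?_
  simp only [Finset.sum_range_succ, Finset.sum_range_zero, zero_add] at h'
  simp only [scaled, abs_div]
  rw [abs_of_pos (show (0 : ℝ) < 1048576 by norm_num), ← add_div, ← add_div]
  refine (mul_le_mul_of_nonneg_right h5 (by positivity)).trans ?_
  linarith

theorem nodeOK_sound {n : Node} {c : Cell} (h : nodeOK n c = true) :
    ‖oddPoly r n.u‖ ≤ c.nu / 1000 ∧ ‖oddPoly r n.y‖ ≤ c.ny / 1000 ∧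
    ‖precond r c.β (cubic invLap resolv (mul3 r) (sineVec r 1) n.b (oddPoly r n.y))‖
      ≤ c.yb / 1000000 ∧
    ‖1 - precond r c.β * (1 + invLap.comp (linPart resolv (mul3 r) n.b
      (resolv (sineVec r 1 - oddPoly r n.y)) (oddPoly r n.y)))‖ ≤ c.k / 1000 := by
  have h1r : 1 ≤ r := hr.out
  have h10 : r ^ 10 ≤ 117 / 100 := by
    have := pow_le_pow_left₀ (by positivity) h5 2
    rw [← pow_mul] at this
    exact this.trans (by norm_num)
  have h15 : r ^ 15 ≤ 127 / 100 := by
    have := pow_le_pow_left₀ (by positivity) h5 3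
    rw [← pow_mul] at this
    exact this.trans (by norm_num)
  simp only [nodeOK, forceList_eq, Bool.and_eq_true, Nat.ble_eq] at h
  obtain ⟨⟨⟨⟨⟨hu, hy⟩, hk⟩, hres⟩, hB0⟩, hB1⟩ := h
  have hu := norm_oddPoly_scaled_le h5 hu
  have hy := norm_oddPoly_scaled_le h5 hy
  refine ⟨hu, hy, ?_, ?_⟩
  · refine (norm_precond_cubic_le r c.β n.b n.u_zero n.u_one n.u_two).trans ?_
    refine (mul_le_mul_of_nonneg_right h15 (by positivity)).trans ?_
    exact residualOK_sound (β := c.β) rfl rfl rfl hres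
  · rw [resolv_sub_oddPoly r n.u_zero n.u_one n.u_two]
    refine norm_one_sub_precond_le r c.β n.b n.u n.y h10 ?_ hu hy fun π hπ q hq => ?_
    · have h' := (Nat.cast_le (α := ℝ)).2 hk
      push_cast at h'
      rw [Nat.cast_natAbs, Int.cast_abs] at h'
      rw [Node.b, abs_div, abs_of_pos (show (0 : ℝ) < 256 by norm_num)]
      linarith
    · obtain rfl | rfl : π = 0 ∨ π = 1 := by omega
      · exact colOK_sound (β := c.β) rfl rfl rfl (allBelow_iff.1 hB0 q hq)
      · exact colOK_sound (β := c.β) rfl rfl rfl (allBelow_iff.1 hB1 q hq)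

end Soundness

/-! ### Real sine series with odd frequencies -/

section RealOdd

/-- The sine series with real coefficients in which only odd frequencies (stored at the even
indices) occur. -/
def realOdd : AddSubgroup SineSpace where
  carrier := {f | ∀ n, (f n).im = 0 ∧ (Odd n → f n = 0)}
  zero_mem' := by simp
  add_mem' hf hg := fun n => ⟨by simp [(hf n).1, (hg n).1],
    fun h => by simp [(hf n).2 h, (hg n).2 h]⟩
  neg_mem' hf := fun n => ⟨by simp [(hf n).1], fun h => by simp [(hf n).2 h]⟩

theorem mem_realOdd {f : SineSpace} : f ∈ realOdd ↔ ∀ n, (f n).im = 0 ∧ (Odd n → f n = 0) :=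
  Iff.rfl

theorem isClosed_realOdd : IsClosed (realOdd : Set SineSpace) := by
  have e : (realOdd : Set SineSpace) = ⋂ n, {f : SineSpace | (f n).im = 0 ∧ (Odd n → f n = 0)} := by
    ext f; simp [mem_realOdd]
  rw [e]
  refine isClosed_iInter fun n => ?_
  have hc : Continuous fun f : SineSpace => f n := (lp.evalCLM ℂ (fun _ : ℕ => ℂ) 1 n).continuous
  refine (isClosed_eq (Complex.continuous_im.comp hc) continuous_const).inter ?_
  by_cases h : Odd n
  · simp only [h, forall_true_left]
    exact isClosed_eq hc continuous_const
  · simp only [h, false_imp_iff]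
    exact isClosed_const

theorem smul_mem_realOdd {z : ℂ} (hz : z.im = 0) {f : SineSpace} (hf : f ∈ realOdd) :
    z • f ∈ realOdd := fun n =>
  ⟨by simp [hz, (hf n).1], fun h => by simp [(hf n).2 h]⟩

theorem unitVec_mem_realOdd {n : ℕ} (hn : ¬ Odd n) : unitVec n ∈ realOdd := fun m => by
  rw [unitVec_apply]
  split_ifs with h
  · subst h; simp [hn]
  · simp

theorem map_mem_realOdd {f : SineSpace →L[ℂ] SineSpace}
    (h : ∀ n, ¬ Odd n → f (unitVec n) ∈ realOdd) {x : SineSpace} (hx : x ∈ realOdd) :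
    f x ∈ realOdd :=
  map_mem_of_unitVec f (P := realOdd.toAddSubmonoid) isClosed_realOdd fun n => by
    by_cases hn : Odd n
    · rw [(hx n).2 hn, zero_smul]; exact realOdd.zero_mem
    · exact smul_mem_realOdd (hx n).1 (h n hn)

variable (r : ℝ)

theorem sineVec_mem_realOdd {m : ℤ} (hm : Odd m) : sineVec r m ∈ realOdd := by
  have h : ¬ Odd (m.natAbs - 1) := by
    obtain ⟨k, hk⟩ := Int.natAbs_odd.2 hm
    rw [hk]; simp
  refine smul_mem_realOdd ?_ (unitVec_mem_realOdd h)
  rw [← Complex.ofReal_pow, ← Complex.ofReal_intCast, ← Complex.ofReal_mul, Complex.ofReal_im]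

theorem oddPoly_mem_realOdd (u : ℕ → ℝ) : oddPoly r u ∈ realOdd :=
  realOdd.add_mem (realOdd.add_mem
    (smul_mem_realOdd (Complex.ofReal_im _) (sineVec_mem_realOdd r (by decide)))
    (smul_mem_realOdd (Complex.ofReal_im _) (sineVec_mem_realOdd r (by decide))))
    (smul_mem_realOdd (Complex.ofReal_im _) (sineVec_mem_realOdd r (by decide)))

theorem diag_mem_realOdd {d : ℕ → ℂ} {C : ℝ} (hd : ∀ n, ‖d n‖ ≤ C) (hr : ∀ n, (d n).im = 0)
    {x : SineSpace} (hx : x ∈ realOdd) : diag d C hd x ∈ realOdd :=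
  map_mem_realOdd (fun n hn => by
    rw [diag_unitVec]; exact smul_mem_realOdd (hr n) (unitVec_mem_realOdd hn)) hx

theorem invLap_mem_realOdd {x : SineSpace} (hx : x ∈ realOdd) : invLap x ∈ realOdd :=
  diag_mem_realOdd _ (fun n => by
    have : (1 / ((n : ℂ) + 1) ^ 2) = ((1 / ((n : ℝ) + 1) ^ 2 : ℝ) : ℂ) := by push_cast; rfl
    rw [this, Complex.ofReal_im]) hx

theorem resolv_mem_realOdd {x : SineSpace} (hx : x ∈ realOdd) : resolv x ∈ realOdd :=
  diag_mem_realOdd _ (fun n => by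
    have : ((n : ℂ) + 1) ^ 2 / (((n : ℂ) + 1) ^ 2 + 1)
        = ((((n : ℝ) + 1) ^ 2 / (((n : ℝ) + 1) ^ 2 + 1) : ℝ) : ℂ) := by push_cast; rfl
    rw [this, Complex.ofReal_im]) hx

theorem precond_mem_realOdd (β : ℕ → ℕ → ℕ → ℝ) {x : SineSpace} (hx : x ∈ realOdd) :
    precond r β x ∈ realOdd := by
  refine map_mem_realOdd (fun n hn => ?_) hx
  rw [precond, lift_unitVec, precondCol]
  split_ifs
  · refine smul_mem_realOdd ?_ (realOdd.sum_mem fun a _ =>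
      smul_mem_realOdd (Complex.ofReal_im _) (sineVec_mem_realOdd r ?_))
    · have : ((r : ℂ) ^ (n + 1))⁻¹ * ((n : ℂ) + 1) ^ 2
          = (((r ^ (n + 1))⁻¹ * ((n : ℝ) + 1) ^ 2 : ℝ) : ℂ) := by push_cast; rfl
      rw [this, Complex.ofReal_im]
    · exact ⟨a, by have : n % 2 = 0 := by grind
                   rw [this]; push_cast; ring⟩
  · exact unitVec_mem_realOdd hn

variable [hr : Fact (1 ≤ r)]

theorem mul3_mem_realOdd {f g h : SineSpace} (hf : f ∈ realOdd) (hg : g ∈ realOdd)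
    (hh : h ∈ realOdd) : mul3 r f g h ∈ realOdd := by
  rw [mul3_comm, mul3_comm']
  refine map_mem_realOdd (fun i hi => ?_) hf
  rw [mul3_comm', mul3_comm, mul3_comm']
  refine map_mem_realOdd (fun j hj => ?_) hg
  rw [mul3_comm']
  refine map_mem_realOdd (fun k hk => ?_) hh
  rw [mul3_unitVec, sineTriple]
  have hp : (((r : ℂ) ^ (i + j + k + 3))⁻¹).im = 0 := by
    rw [← Complex.ofReal_pow, ← Complex.ofReal_inv, Complex.ofReal_im]
  rw [Nat.not_odd_iff_even] at hi hj hk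
  refine smul_mem_realOdd hp (smul_mem_realOdd (by norm_num) ?_)
  refine realOdd.sub_mem (realOdd.sub_mem (realOdd.add_mem ?_ ?_) ?_) ?_ <;>
    exact sineVec_mem_realOdd r (by grind)

theorem cubic_mem_realOdd {b : ℂ} (hb : b.im = 0) {y : SineSpace} (hy : y ∈ realOdd) :
    cubic invLap resolv (mul3 r) (sineVec r 1) b y ∈ realOdd := by
  have hu : resolv (sineVec r 1 - y) ∈ realOdd :=
    resolv_mem_realOdd (realOdd.sub_mem (sineVec_mem_realOdd r (by decide)) hy)
  exact realOdd.sub_mem hy (invLap_mem_realOdd (realOdd.sub_mem (smul_mem_realOdd hb hu)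
    (smul_mem_realOdd (by norm_num) (mul3_mem_realOdd r hu hu hy))))

end RealOdd

/-! ### The branch of zeros -/

section Branch

variable {r : ℝ} [hr : Fact (1 ≤ r)] (h5 : r ^ 5 ≤ 1081 / 1000)

include h5

theorem norm_precond_mul_invLap_cell_le {n m : Node} {c : Cell} (h : cellOK n c m = true) :
    ‖precond r c.β * invLap‖ ≤ c.al / 1000 := by
  have h1r : 1 ≤ r := hr.out
  have h10 : r ^ 10 ≤ 117 / 100 := by
    have := pow_le_pow_left₀ (by positivity) h5 2
    rw [← pow_mul] at this
    exact this.trans (by norm_num)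
  simp only [cellOK, Bool.and_eq_true, Nat.ble_eq] at h
  obtain ⟨⟨⟨⟨-, hB0⟩, hB1⟩, hal⟩, -⟩ := h
  have hal' : (13 : ℝ) ≤ c.al := by exact_mod_cast hal
  refine norm_precond_mul_invLap_le r c.β (by linarith) h10 fun π hπ q hq => ?_
  obtain rfl | rfl : π = 0 ∨ π = 1 := by omega
  · exact invOK_sound hB0 hq
  · exact invOK_sound hB1 hq

/-- A cell that passes the tests carries, for each of its parameters, a unique zero in the ball of
radius `1 / 500` around the interpolated approximate solution. -/
theorem cellOK_sound {n m : Node} {c : Cell} (h : cellOK n c m = true) {θ : ℝ}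
    (hθ : θ ∈ Icc (0 : ℝ) 1) {b : ℂ} (hb : b = interp (n.b : ℂ) (m.b : ℂ) θ) {y : SineSpace}
    (hy : y = interp (oddPoly r n.y) (oddPoly r m.y) θ) :
    (∃ z ∈ Metric.ball y (1 / 500), z ∈ (realOdd : Set SineSpace) ∧
      cubic invLap resolv (mul3 r) (sineVec r 1) b z = 0) ∧
    (∀ z ∈ Metric.closedBall y (1 / 500), ∀ z' ∈ Metric.closedBall y (1 / 500),
      cubic invLap resolv (mul3 r) (sineVec r 1) b z = 0 →
      cubic invLap resolv (mul3 r) (sineVec r 1) b z' = 0 → z = z') ∧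
    ∀ z ∈ Metric.closedBall y (1 / 500),
      IsUnit (1 + invLap.comp (linPart resolv (mul3 r) b (resolv (sineVec r 1 - z)) z)) := by
  have h1r : 1 ≤ r := hr.out
  have hα := norm_precond_mul_invLap_cell_le h5 h
  simp only [cellOK, Bool.and_eq_true, Nat.ble_eq, Nat.blt_eq, forceInt_eq] at h
  obtain ⟨⟨⟨⟨⟨hn, hm⟩, -⟩, -⟩, -⟩, ⟨⟨hdb, hde⟩, hfin⟩⟩ := h
  obtain ⟨un, yn, Yn, kn⟩ := nodeOK_sound h5 hn
  obtain ⟨um, ym, Ym, km⟩ := nodeOK_sound h5 hm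
  have hde' : ‖oddPoly r m.y - oddPoly r n.y‖ ≤ c.de / 1000000 := by
    have h' := (Nat.cast_le (α := ℝ)).2 hde
    push_cast at h'
    rw [absSum_zero_eq] at h'
    simp only [Finset.sum_range_succ, Finset.sum_range_zero, zero_add, Int.cast_sub] at h'
    have e : oddPoly r m.y - oddPoly r n.y = oddPoly r (fun i => m.y i - n.y i) := by
      simp only [oddPoly]; push_cast; module
    have e2 : ∀ i, m.y i - n.y i
        = -(((n.yList.getD i 0 : ℝ) - (m.yList.getD i 0 : ℝ)) / 1048576) := fun i => by
      simp only [Node.y, scaled]; ring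
    rw [e]
    refine (norm_oddPoly_le r _).trans ((mul_le_mul_of_nonneg_right h5 (by positivity)).trans ?_)
    simp only [e2, abs_neg, abs_div]
    rw [abs_of_pos (show (0 : ℝ) < 1048576 by norm_num)]
    linarith
  have hdb' : ‖(m.b : ℂ) - n.b‖ ≤ ((m.bz - n.bz).natAbs : ℝ) / 256 := by
    rw [← Complex.ofReal_sub, Complex.norm_real, Real.norm_eq_abs, Node.b, Node.b, ← sub_div,
      abs_div, abs_of_pos (show (0 : ℝ) < 256 by norm_num), Nat.cast_natAbs, Int.cast_abs,
      Int.cast_sub]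
  have hT := norm_mul3_le_clm r
  have hun : ‖resolv (sineVec r 1 - oddPoly r n.y)‖ ≤ c.nu / 1000 := by
    rwa [resolv_sub_oddPoly r n.u_zero n.u_one n.u_two]
  have hum : ‖resolv (sineVec r 1 - oddPoly r m.y)‖ ≤ c.nu / 1000 := by
    rwa [resolv_sub_oddPoly r m.u_zero m.u_one m.u_two]
  have hδ := norm_map_cubic_interp_le (A := precond r c.β) hT norm_resolv_le (mul3_comm r) hθ hde'
    hα hun yn hdb' Yn Ym
  have hκ : ∀ z ∈ Metric.closedBall y (1 / 500), _ := fun z hz =>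
    norm_newton_deriv_le (A := precond r c.β) hT norm_resolv_le hθ hde' hα hun yn hum ym kn km
      (ρ := 1 / 500) (y := z) (by rw [← hy]; exact mem_closedBall_iff_norm.1 hz)
  rw [← hb, ← hy] at hδ
  rw [← hb] at hκ
  refine existsUnique_zero invLap resolv (sineVec r 1) (A := precond r c.β) (mul3_comm r) (mul3_comm' r)
    lowModes (precond_sub_mem r c.β) hδ ?_ hκ (by norm_num) ?_ isClosed_realOdd ?_ ?_
  · positivity
  · have h' := (Nat.cast_lt (α := ℝ)).2 hfin
    push_cast at h'
    linarith
  · rw [hy, interp]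
    refine realOdd.add_mem (smul_mem_realOdd ?_ (oddPoly_mem_realOdd r _))
      (smul_mem_realOdd (Complex.ofReal_im _) (oddPoly_mem_realOdd r _))
    simp
  · intro z hz
    refine realOdd.sub_mem hz (precond_mem_realOdd r _ (cubic_mem_realOdd r ?_ hz))
    rw [hb]
    simp [interp]

end Branch

section Path

/-- Piecewise linear interpolation along a chain of nodes that starts at `n`, with the value `v m`
at the node `m`. -/
noncomputable def chainPath (v : Node → SineSpace) (n : Node) : List (Cell × Node) → ℝ → SineSpace
  | [], _ => v n
  | (_, m) :: l, b => if b ≤ m.b then interp (v n) (v m) ((b - n.b) / (m.b - n.b))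
      else chainPath v m l b

/-- The last node of a chain. -/
def chainEnd (n : Node) : List (Cell × Node) → Node
  | [] => n
  | (_, m) :: l => chainEnd m l

theorem Node.b_lt_of_cellOK {n m : Node} {c : Cell} (h : cellOK n c m = true) : n.b < m.b := by
  simp only [cellOK, Bool.and_eq_true, Nat.blt_eq, forceInt_eq] at h
  have h1 : n.bz < m.bz := by omega
  rw [Node.b, Node.b]
  gcongr

theorem chainPath_start (v : Node → SineSpace) {n : Node} {l : List (Cell × Node)}
    (h : chainOK n l = true) : chainPath v n l n.b = v n := by
  match l with
  | [] => rfl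
  | (c, m) :: l =>
    rw [chainOK, Bool.and_eq_true] at h
    rw [chainPath, if_pos (Node.b_lt_of_cellOK h.1).le]
    simp [interp]

theorem continuous_chainPath (v : Node → SineSpace) {n : Node} {l : List (Cell × Node)}
    (h : chainOK n l = true) : Continuous (chainPath v n l) := by
  induction l generalizing n with
  | nil => exact continuous_const
  | cons p l ih =>
    obtain ⟨c, m⟩ := p
    rw [chainOK, Bool.and_eq_true] at h
    have hlt := Node.b_lt_of_cellOK h.1
    refine Continuous.if_le (f' := fun b => interp (v n) (v m) ((b - n.b) / (m.b - n.b))) ?_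
      (ih h.2) continuous_id continuous_const ?_
    · simp only [interp]
      fun_prop
    · rintro b rfl
      have : m.b - n.b ≠ 0 := by linarith
      change interp (v n) (v m) ((m.b - n.b) / (m.b - n.b)) = chainPath v m l m.b
      rw [chainPath_start v h.2, div_self this]
      simp [interp]

/-- Every parameter below the end of the chain lies in a cell. -/
theorem exists_cell (v : Node → SineSpace) {n : Node} {l : List (Cell × Node)}
    (h : chainOK n l = true) {b : ℝ} (hn : n.b ≤ b) (hl : b < (chainEnd n l).b) :
    ∃ n' c m, cellOK n' c m = true ∧ ∃ θ ∈ Icc (0 : ℝ) 1, (b : ℂ) = interp (n'.b : ℂ) (m.b : ℂ) θ ∧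
      chainPath v n l b = interp (v n') (v m) θ := by
  induction l generalizing n with
  | nil => exact absurd hl (not_lt.2 hn)
  | cons p l ih =>
    obtain ⟨c, m⟩ := p
    rw [chainOK, Bool.and_eq_true] at h
    have hlt := Node.b_lt_of_cellOK h.1
    by_cases hb : b ≤ m.b
    · refine ⟨n, c, m, h.1, (b - n.b) / (m.b - n.b), ⟨?_, ?_⟩, ?_, ?_⟩
      · exact div_nonneg (by linarith) (by linarith)
      · rw [div_le_one (by linarith)]; linarith
      · have h0 : ((m.b : ℂ) - n.b) ≠ 0 := by
          rw [← Complex.ofReal_sub]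
          exact Complex.ofReal_ne_zero.2 (by linarith)
        simp only [interp, smul_eq_mul]
        push_cast
        field_simp
        ring
      · rw [chainPath, if_pos hb]
    · rw [chainPath, if_neg hb]
      exact ih h.2 (not_le.1 hb).le hl

/-- The piecewise linear path of approximate solutions. -/
noncomputable def center (r : ℝ) : ℝ → SineSpace :=
  chainPath (fun n => oddPoly r n.y) chainStart chain

theorem continuous_center (r : ℝ) : Continuous (center r) :=
  continuous_chainPath _ chainOK_chain

/-- Validation of the numerical branch, for every weight `r ≥ 1` with `r ^ 5 ≤ 1081 / 1000`. -/
theorem center_zero (r : ℝ) [Fact (1 ≤ r)] (h5 : r ^ 5 ≤ 1081 / 1000) {b : ℝ}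
    (hb : b ∈ Ioo (-(1 / 64) : ℝ) (11 + 1 / 64)) :
    (∃ z ∈ Metric.ball (center r b) (1 / 500), z ∈ (realOdd : Set SineSpace) ∧
      cubic invLap resolv (mul3 r) (sineVec r 1) b z = 0) ∧
    (∀ z ∈ Metric.closedBall (center r b) (1 / 500),
      ∀ z' ∈ Metric.closedBall (center r b) (1 / 500),
      cubic invLap resolv (mul3 r) (sineVec r 1) b z = 0 →
      cubic invLap resolv (mul3 r) (sineVec r 1) b z' = 0 → z = z') ∧
    ∀ z ∈ Metric.closedBall (center r b) (1 / 500),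
      IsUnit (1 + invLap.comp (linPart resolv (mul3 r) b (resolv (sineVec r 1 - z)) z)) := by
  have he : (chainEnd chainStart chain).bz = 2824 := by decide +kernel
  obtain ⟨n, c, m, hc, θ, hθ, hbθ, hp⟩ := exists_cell (fun n => oddPoly r n.y) chainOK_chain
    (b := b) (by rw [Node.b, chainStart]; norm_num; linarith [hb.1])
    (by rw [Node.b, he]; norm_num; linarith [hb.2])
  exact cellOK_sound h5 hc hθ hbθ hp

end Path

/-! ### Evaluation of sine series -/

section Evaluation

theorem norm_sin_coeff_le (r : ℝ) [hr : Fact (1 ≤ r)] (x : ℝ) (n : ℕ) :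
    ‖((r : ℂ) ^ (n + 1))⁻¹ * (Real.sin ((n + 1 : ℕ) * x) : ℂ)‖ ≤ 1 := by
  have h1 : 1 ≤ r := hr.out
  rw [norm_mul, norm_inv, norm_pow, Complex.norm_real, Complex.norm_real, Real.norm_eq_abs,
    Real.norm_eq_abs, abs_of_nonneg (by linarith)]
  exact mul_le_one₀ (inv_le_one_of_one_le₀ (one_le_pow₀ h1)) (abs_nonneg _)
    (Real.abs_sin_le_one _)

variable (r : ℝ) [hr : Fact (1 ≤ r)]

/-- Evaluation at `x` of the sine series whose coefficients, multiplied by `r ^ k`, are stored. -/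
noncomputable def evalAt (x : ℝ) : SineSpace →L[ℂ] ℂ :=
  lift (fun n => ((r : ℂ) ^ (n + 1))⁻¹ * (Real.sin ((n + 1 : ℕ) * x) : ℂ)) 1
    (norm_sin_coeff_le r x)

theorem ofReal_pow_ne_zero (n : ℕ) : (r : ℂ) ^ n ≠ 0 := by
  have : (0 : ℝ) < r ^ n := pow_pos (by linarith [hr.out]) _
  exact_mod_cast this.ne'

theorem evalAt_unitVec (x : ℝ) (n : ℕ) :
    evalAt r x (unitVec n) = ((r : ℂ) ^ (n + 1))⁻¹ * (Real.sin ((n + 1 : ℕ) * x) : ℂ) := by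
  simp [evalAt]

theorem evalAt_sineVec (x : ℝ) (m : ℤ) : evalAt r x (sineVec r m) = (Real.sin (m * x) : ℂ) := by
  have h : ∀ n : ℕ, evalAt r x (sineVec r ((n : ℤ) + 1)) = (Real.sin ((n + 1 : ℕ) * x) : ℂ) := by
    intro n
    rw [sineVec_succ, map_smul, evalAt_unitVec, smul_eq_mul, ← mul_assoc,
      mul_inv_cancel₀ (ofReal_pow_ne_zero r _), one_mul]
  obtain h0 | h0 | h0 := lt_trichotomy m 0
  · obtain ⟨n, hn⟩ : ∃ n : ℕ, m = -((n : ℤ) + 1) := ⟨(-m - 1).toNat, by omega⟩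
    rw [hn, sineVec_neg, map_neg, h]
    push_cast
    rw [← Complex.sin_neg]
    congr 1
    ring
  · simp [h0]
  · obtain ⟨n, hn⟩ : ∃ n : ℕ, m = (n : ℤ) + 1 := ⟨(m - 1).toNat, by omega⟩
    rw [hn, h]
    push_cast
    rfl

theorem evalAt_sineTriple (x : ℝ) (a b c : ℤ) : evalAt r x (sineTriple r a b c)
    = (Real.sin (a * x) : ℂ) * (Real.sin (b * x) : ℂ) * (Real.sin (c * x) : ℂ) := by
  simp only [sineTriple, map_smul, map_sub, map_add, evalAt_sineVec, smul_eq_mul]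
  rw [← Complex.ofReal_mul, ← Complex.ofReal_mul]
  have key : Real.sin (a * x) * Real.sin (b * x) * Real.sin (c * x)
      = 1 / 4 * (Real.sin ((c + (a - b) : ℤ) * x) + Real.sin ((c - (a - b) : ℤ) * x)
        - Real.sin ((c + (a + b) : ℤ) * x) - Real.sin ((c - (a + b) : ℤ) * x)) := by
    push_cast
    simp only [add_mul, sub_mul, Real.sin_add, Real.sin_sub, Real.cos_add, Real.cos_sub]
    ring
  rw [key]
  push_cast
  ring

/-- `mul3` is the pointwise product: this holds on unit vectors, and both sides are continuous and
linear in each factor. -/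
theorem evalAt_mul3 (x : ℝ) (f g h : SineSpace) :
    evalAt r x (mul3 r f g h) = evalAt r x f * evalAt r x g * evalAt r x h := by
  have h0 : ∀ i j k, evalAt r x (mul3 r (unitVec i) (unitVec j) (unitVec k))
      = evalAt r x (unitVec i) * evalAt r x (unitVec j) * evalAt r x (unitVec k) := by
    intro i j k
    rw [mul3_unitVec, map_smul, evalAt_sineTriple, evalAt_unitVec, evalAt_unitVec, evalAt_unitVec,
      smul_eq_mul, show i + j + k + 3 = (i + 1) + (j + 1) + (k + 1) by ring, pow_add, pow_add,
      mul_inv, mul_inv]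
    push_cast
    ring
  have h1 : ∀ i j h, evalAt r x (mul3 r (unitVec i) (unitVec j) h)
      = evalAt r x (unitVec i) * evalAt r x (unitVec j) * evalAt r x h := fun i j h => by
    have e : (evalAt r x).comp (mul3 r (unitVec i) (unitVec j))
        = (evalAt r x (unitVec i) * evalAt r x (unitVec j)) • evalAt r x := clm_ext (h0 i j)
    exact DFunLike.congr_fun e h
  have h2 : ∀ i g h, evalAt r x (mul3 r (unitVec i) g h)
      = evalAt r x (unitVec i) * evalAt r x g * evalAt r x h := fun i g h => by
    have e : (evalAt r x).comp (mul3 r (unitVec i) h)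
        = (evalAt r x (unitVec i) * evalAt r x h) • evalAt r x := clm_ext fun j => by
      change evalAt r x (mul3 r (unitVec i) h (unitVec j)) = _
      rw [mul3_comm', h1, smul_apply, smul_eq_mul]; ring
    have := DFunLike.congr_fun e g
    rw [ContinuousLinearMap.comp_apply, mul3_comm', smul_apply, smul_eq_mul] at this
    rw [this]; ring
  have e : (evalAt r x).comp (mul3 r g h)
      = (evalAt r x g * evalAt r x h) • evalAt r x := clm_ext fun i => by
    change evalAt r x (mul3 r g h (unitVec i)) = _
    rw [mul3_comm', mul3_comm, h2, smul_apply, smul_eq_mul]; ring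
  have := DFunLike.congr_fun e f
  rw [ContinuousLinearMap.comp_apply, mul3_comm', mul3_comm, smul_apply, smul_eq_mul] at this
  rw [this]; ring

theorem hasSum_evalAt (x : ℝ) (f : SineSpace) :
    HasSum (fun n => f n * ((r : ℂ) ^ (n + 1))⁻¹ * (Real.sin ((n + 1 : ℕ) * x) : ℂ))
      (evalAt r x f) := by
  have := (hasSum_unitVec f).mapL (evalAt r x)
  simpa only [map_smul, evalAt_unitVec, smul_eq_mul, ← mul_assoc] using this

theorem summable_coeff (f : SineSpace) : Summable fun n => ‖f n * ((r : ℂ) ^ (n + 1))⁻¹‖ := by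
  refine Summable.of_nonneg_of_le (fun _ => norm_nonneg _) (fun n => ?_)
    (hasSum_norm_coord f).summable
  have h1 : 1 ≤ r := hr.out
  rw [norm_mul, norm_inv, norm_pow, Complex.norm_real, Real.norm_of_nonneg (by linarith)]
  exact mul_le_of_le_one_right (norm_nonneg _) (inv_le_one_of_one_le₀ (one_le_pow₀ h1))

theorem evalAt_zero (f : SineSpace) : evalAt r 0 f = 0 := by
  have h := hasSum_evalAt r 0 f
  simp only [mul_zero, Real.sin_zero, Complex.ofReal_zero] at h
  exact h.unique hasSum_zero

theorem evalAt_pi (f : SineSpace) : evalAt r Real.pi f = 0 := by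
  have h := hasSum_evalAt r Real.pi f
  simp only [Real.sin_nat_mul_pi, Complex.ofReal_zero, mul_zero] at h
  exact h.unique hasSum_zero

theorem evalAt_im_of_mem_realOdd {f : SineSpace} (hf : f ∈ realOdd) (x : ℝ) :
    (evalAt r x f).im = 0 := by
  have h := Complex.hasSum_im (hasSum_evalAt r x f)
  have e : ∀ n, (f n * ((r : ℂ) ^ (n + 1))⁻¹ * (Real.sin ((n + 1 : ℕ) * x) : ℂ)).im = 0 := by
    intro n
    rw [← Complex.ofReal_pow, ← Complex.ofReal_inv, Complex.im_mul_ofReal, Complex.im_mul_ofReal,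
      (hf n).1, zero_mul, zero_mul]
  simp only [e] at h
  exact h.unique hasSum_zero

theorem evalAt_pi_sub_of_mem_realOdd {f : SineSpace} (hf : f ∈ realOdd) (x : ℝ) :
    evalAt r (Real.pi - x) f = evalAt r x f := by
  refine (hasSum_evalAt r _ f).unique ?_
  convert hasSum_evalAt r x f using 2 with n
  by_cases hn : Odd n
  · rw [(hf n).2 hn]; simp
  · congr 2
    obtain ⟨k, hk⟩ := Nat.not_odd_iff_even.1 hn
    have : ((n + 1 : ℕ) : ℝ) * (Real.pi - x)
        = Real.pi - (n + 1 : ℕ) * x + k * (2 * Real.pi) := by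
      rw [hk]; push_cast; ring
    rw [this, Real.sin_add_nat_mul_two_pi, Real.sin_pi_sub]

/-- Two termwise derivatives of a sine series that has been smoothed by `invLap`. -/
theorem hasDerivAt_evalAt_invLap (f : SineSpace) :
    ∃ g : ℝ → ℂ, (∀ x, HasDerivAt (fun x => evalAt r x (invLap f)) (g x) x) ∧
      ∀ x, HasDerivAt g (-evalAt r x f) x := by
  set c : ℕ → ℂ := fun n => f n * ((r : ℂ) ^ (n + 1))⁻¹ with hc
  have hs : Summable fun n => ‖c n‖ := summable_coeff r f
  have hcoe : ∀ n : ℕ, ((n : ℂ) + 1) ≠ 0 := fun n => Nat.cast_add_one_ne_zero n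
  have hlin : ∀ (n : ℕ) (x : ℝ),
      HasDerivAt (fun x : ℝ => ((n + 1 : ℕ) : ℝ) * x) ((n + 1 : ℕ) : ℝ) x := fun n x => by
    simpa using (hasDerivAt_id x).const_mul ((n + 1 : ℕ) : ℝ)
  have hnorm : ∀ n : ℕ, 1 ≤ ‖((n : ℂ) + 1)‖ := fun n => by
    rw [← Nat.cast_succ, Complex.norm_natCast]; exact_mod_cast Nat.succ_pos n
  have e1 : (fun x => evalAt r x (invLap f))
      = fun x => ∑' n, c n / ((n : ℂ) + 1) ^ 2 * (Real.sin ((n + 1 : ℕ) * x) : ℂ) := by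
    funext x
    rw [← (hasSum_evalAt r x (invLap f)).tsum_eq]
    refine tsum_congr fun n => ?_
    rw [invLap, coord_diag]
    simp only [hc]
    ring
  have e2 : ∀ x, -evalAt r x f = ∑' n, c n * (-(Real.sin ((n + 1 : ℕ) * x) : ℂ)) := fun x => by
    rw [← (hasSum_evalAt r x f).tsum_eq, ← tsum_neg]
    exact tsum_congr fun n => by simp only [hc]; ring
  refine ⟨fun x => ∑' n, c n / ((n : ℂ) + 1) * (Real.cos ((n + 1 : ℕ) * x) : ℂ), fun x => ?_,
    fun x => ?_⟩
  · rw [e1]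
    refine hasDerivAt_tsum hs (g := fun n x =>
      c n / ((n : ℂ) + 1) ^ 2 * (Real.sin ((n + 1 : ℕ) * x) : ℂ)) (g' := fun n x =>
      c n / ((n : ℂ) + 1) * (Real.cos ((n + 1 : ℕ) * x) : ℂ)) (fun n y => ?_) (fun n y => ?_)
      (y₀ := 0) (by simp [summable_zero]) x
    · have h := ((hlin n y).sin.ofReal_comp).const_mul (c n / ((n : ℂ) + 1) ^ 2)
      refine h.congr_deriv ?_
      have := hcoe n
      push_cast
      field_simp
    · rw [norm_mul, norm_div, Complex.norm_real]
      calc _ ≤ ‖c n‖ / 1 * 1 := by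
            gcongr
            · exact hnorm n
            · exact Real.abs_cos_le_one _
        _ = _ := by ring
  · rw [e2]
    refine hasDerivAt_tsum hs (g := fun n x =>
      c n / ((n : ℂ) + 1) * (Real.cos ((n + 1 : ℕ) * x) : ℂ)) (g' := fun n x =>
      c n * (-(Real.sin ((n + 1 : ℕ) * x) : ℂ))) (fun n y => ?_) (fun n y => ?_) (y₀ := 0) ?_ x
    · have h := ((hlin n y).cos.ofReal_comp).const_mul (c n / ((n : ℂ) + 1))
      refine h.congr_deriv ?_
      have := hcoe n
      push_cast
      field_simp
    · rw [norm_mul, norm_neg, Complex.norm_real]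
      exact mul_le_of_le_one_right (norm_nonneg _) (Real.abs_sin_le_one _)
    · refine Summable.of_norm_bounded hs fun n => ?_
      rw [norm_mul, norm_div, Complex.norm_real]
      calc _ ≤ ‖c n‖ / 1 * 1 := by
            gcongr
            · exact hnorm n
            · exact Real.abs_cos_le_one _
        _ = _ := by ring

end Evaluation

/-! ### Stationary solutions from zeros of the cubic map -/

section Stationary

theorem isStationarySolution_of_hasDerivAt {b : ℝ} {u v u₁ v₁ : ℝ → ℂ}
    (hu : ∀ x, HasDerivAt u (u₁ x) x) (hv : ∀ x, HasDerivAt v (v₁ x) x)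
    (hu₁ : ∀ x, HasDerivAt u₁ (-((Real.sin x : ℂ) - (b + 1) * u x + u x ^ 2 * v x)) x)
    (hv₁ : ∀ x, HasDerivAt v₁ (-(64 * (b * u x - u x ^ 2 * v x))) x)
    (hu0 : u 0 = 0) (huπ : u Real.pi = 0) (hv0 : v 0 = 0) (hvπ : v Real.pi = 0) :
    IsStationarySolution b u v := by
  have du : deriv u = u₁ := funext fun x => (hu x).deriv
  have dv : deriv v = v₁ := funext fun x => (hv x).deriv
  have cu : Continuous u := continuous_iff_continuousAt.2 fun x => (hu x).continuousAt
  have cv : Continuous v := continuous_iff_continuousAt.2 fun x => (hv x).continuousAt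
  have c2 : ∀ {w w₁ w₂ : ℝ → ℂ}, (∀ x, HasDerivAt w (w₁ x) x) → (∀ x, HasDerivAt w₁ (w₂ x) x) →
      Continuous w₂ → ContDiff ℝ 2 w := by
    intro w w₁ w₂ h1 h2 h3
    have e1 : deriv w = w₁ := funext fun x => (h1 x).deriv
    have e2 : deriv w₁ = w₂ := funext fun x => (h2 x).deriv
    rw [show (2 : WithTop ℕ∞) = 1 + 1 by norm_num, contDiff_succ_iff_deriv]
    refine ⟨fun x => (h1 x).differentiableAt, by simp, ?_⟩
    rw [e1, contDiff_one_iff_deriv, e2]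
    exact ⟨fun x => (h2 x).differentiableAt, h3⟩
  have reg : ∀ {w w₁ w₂ : ℝ → ℂ}, (∀ x, HasDerivAt w (w₁ x) x) → (∀ x, HasDerivAt w₁ (w₂ x) x) →
      Continuous w₂ → w 0 = 0 → w Real.pi = 0 → IsDirichletRegular fun x _ => w x := by
    intro w w₁ w₂ h1 h2 h3 h4 h5
    have cw : Continuous w := continuous_iff_continuousAt.2 fun x => (h1 x).continuousAt
    exact ⟨(cw.comp continuous_fst).continuousOn, fun _ _ => differentiable_const _,
      fun _ => (c2 h1 h2 h3).contDiffOn, fun _ => h4, fun _ => h5⟩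
  refine ⟨reg hu hu₁ ?_ hu0 huπ, reg hv hv₁ ?_ hv0 hvπ, fun x _ t => ?_, fun x _ t => ?_⟩
  · fun_prop
  · fun_prop
  · simp only [deriv_const]
    rw [du, (hu₁ x).deriv]
    ring
  · simp only [deriv_const]
    rw [dv, (hv₁ x).deriv]
    ring

variable (r : ℝ) [hr : Fact (1 ≤ r)]

/-- A zero `y` of the cubic map gives the stationary solution `u = resolv (sin x - y)`,
`v = 64 y`. -/
theorem isStationarySolution_of_cubic_eq_zero {b : ℝ} {y : SineSpace}
    (hy : cubic invLap resolv (mul3 r) (sineVec r 1) b y = 0) :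
    IsStationarySolution b (fun x => evalAt r x (resolv (sineVec r 1 - y)))
      (fun x => evalAt r x ((64 : ℂ) • y)) := by
  set u := resolv (sineVec r 1 - y) with hu
  set h := (b : ℂ) • u - (64 : ℂ) • mul3 r u u y with hh
  have hyh : y = invLap h := sub_eq_zero.1 hy
  have hs1 : invLap (sineVec r 1) = sineVec r 1 := by
    have := invLap_sineVec r 0
    simpa using this
  have huh : u = invLap (sineVec r 1 - h - u) := by
    have := resolv_add_invLap_resolv (sineVec r 1 - y)
    rw [← hu] at this
    rw [map_sub, map_sub, hs1, ← hyh, ← this]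
    abel
  have e : ∀ x, evalAt r x h = b * evalAt r x u - 64 * (evalAt r x u ^ 2 * evalAt r x y) := by
    intro x
    rw [hh, map_sub, map_smul, map_smul, evalAt_mul3]
    simp only [smul_eq_mul]
    ring
  obtain ⟨u₁, du, du₁⟩ := hasDerivAt_evalAt_invLap r (sineVec r 1 - h - u)
  obtain ⟨v₁, dv, dv₁⟩ := hasDerivAt_evalAt_invLap r ((64 : ℂ) • h)
  rw [← huh] at du
  rw [map_smul, ← hyh] at dv
  refine isStationarySolution_of_hasDerivAt du dv (fun x => ?_) (fun x => ?_) (evalAt_zero r _)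
    (evalAt_pi r _) (evalAt_zero r _) (evalAt_pi r _)
  · refine (du₁ x).congr_deriv ?_
    have hs := evalAt_sineVec r x 1
    rw [Int.cast_one, one_mul] at hs
    rw [map_sub, map_sub, hs, e, map_smul, smul_eq_mul]
    ring
  · refine (dv₁ x).congr_deriv ?_
    rw [map_smul, map_smul, e, smul_eq_mul, smul_eq_mul]
    ring

end Stationary

/-! ### Analyticity in `x` -/

section Analytic

instance : Fact (1 ≤ rho) := ⟨by norm_num [rho]⟩

instance : Fact ((1 : ℝ) ≤ 1) := ⟨le_rfl⟩

theorem toFun_eq_evalAt (f : SineSpace) (x : ℝ) : f.toFun x = evalAt rho x f := by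
  rw [← (hasSum_evalAt rho x f).tsum_eq]
  refine tsum_congr fun n => ?_
  rw [SineSpace.coeff, div_eq_mul_inv, Complex.ofReal_pow]

theorem norm_complex_sin_le (z : ℂ) : ‖Complex.sin z‖ ≤ Real.exp |z.im| := by
  have h1 : ‖Complex.exp (-z * Complex.I)‖ ≤ Real.exp |z.im| := by
    rw [Complex.norm_exp]
    gcongr
    simpa using le_abs_self z.im
  have h2 : ‖Complex.exp (z * Complex.I)‖ ≤ Real.exp |z.im| := by
    rw [Complex.norm_exp]
    gcongr
    simpa using neg_le_abs z.im
  rw [Complex.sin, norm_div, norm_mul, Complex.norm_I, mul_one, Complex.norm_ofNat]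
  have := norm_sub_le (Complex.exp (-z * Complex.I)) (Complex.exp (z * Complex.I))
  linarith

/-- Sine series with coefficients in the weighted space converge in a complex strip. -/
theorem analyticOnNhd_toFun (f : SineSpace) : AnalyticOnNhd ℝ f.toFun univ := by
  have hlog : 0 < Real.log rho := Real.log_pos (by norm_num [rho])
  set U : Set ℂ := {z | |z.im| < Real.log rho} with hU
  have hUo : IsOpen U := isOpen_lt (by fun_prop) continuous_const
  have hd : DifferentiableOn ℂ (fun z : ℂ => ∑' n : ℕ, f.coeff n * Complex.sin ((n + 1 : ℕ) * z))
      U := by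
    refine Complex.differentiableOn_tsum_of_summable_norm (hasSum_norm_coord f).summable
      (fun n => ?_) hUo fun n z hz => ?_
    · fun_prop
    · rw [norm_mul, ← f.norm_coeff_mul]
      gcongr
      refine (norm_complex_sin_le _).trans ?_
      have e : (((n + 1 : ℕ) : ℂ) * z).im = (n + 1 : ℕ) * z.im := by
        rw [← Complex.ofReal_natCast, Complex.im_ofReal_mul]
      rw [e, abs_mul, Nat.abs_cast]
      calc Real.exp ((n + 1 : ℕ) * |z.im|) ≤ Real.exp ((n + 1 : ℕ) * Real.log rho) := by
            gcongr
            exact hz.le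
        _ = _ := by rw [Real.exp_nat_mul, Real.exp_log rho_pos]
  intro x _
  have hx : (x : ℂ) ∈ U := by simpa [hU] using hlog
  have ha := ((hd.analyticAt (hUo.mem_nhds hx)).restrictScalars (𝕜 := ℝ)).comp_of_eq
    (Complex.ofRealCLM.analyticAt x) rfl
  refine ha.congr (Filter.Eventually.of_forall fun t => ?_)
  simp [SineSpace.toFun]

end Analytic

/-! ### Change of weight -/

section ChangeWeight

variable (r : ℝ) [hr : Fact (1 ≤ r)]

theorem norm_inv_pow_le (n : ℕ) : ‖((r : ℂ) ^ (n + 1))⁻¹‖ ≤ 1 := by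
  have h1 : 1 ≤ r := hr.out
  rw [norm_inv, norm_pow, Complex.norm_real, Real.norm_of_nonneg (by linarith)]
  exact inv_le_one_of_one_le₀ (one_le_pow₀ h1)

/-- The inclusion of the sine series with weight `r` into those with weight `1`. -/
noncomputable def toUnweighted : SineSpace →L[ℂ] SineSpace :=
  diag (fun n => ((r : ℂ) ^ (n + 1))⁻¹) 1 (norm_inv_pow_le r)

theorem toUnweighted_sineVec (m : ℤ) : toUnweighted r (sineVec r m) = sineVec 1 m := by
  by_cases hm : m = 0
  · simp [hm]
  · rw [sineVec, sineVec, map_smul, toUnweighted, diag_unitVec, smul_smul,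
      Nat.sub_add_cancel (by omega), mul_assoc, mul_inv_cancel₀ (ofReal_pow_ne_zero r _)]
    simp

theorem toUnweighted_diag (d : ℕ → ℂ) (C : ℝ) (hd : ∀ n, ‖d n‖ ≤ C) (f : SineSpace) :
    toUnweighted r (diag d C hd f) = diag d C hd (toUnweighted r f) := by
  ext n
  simp only [toUnweighted, coord_diag]
  ring

theorem evalAt_toUnweighted (x : ℝ) (f : SineSpace) :
    evalAt 1 x (toUnweighted r f) = evalAt r x f := by
  have : (evalAt 1 x).comp (toUnweighted r) = evalAt r x := clm_ext_sineVec r fun n => by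
    rw [ContinuousLinearMap.comp_apply, toUnweighted_sineVec, evalAt_sineVec, evalAt_sineVec]
  exact DFunLike.congr_fun this f

theorem norm_toUnweighted_le (f : SineSpace) : ‖toUnweighted r f‖ ≤ ‖f‖ := by
  have := (toUnweighted r).le_of_opNorm_le (norm_diag_le _ _ _) f
  rwa [one_mul] at this

end ChangeWeight

/-! ### Sine coefficients of functions on `[0, π]` -/

section SineCoeff

open MeasureTheory

/-- The coefficient of `sin ((n + 1) x)` in the sine series of `w` on `[0, π]`. -/
noncomputable def sineCoeff (w : ℝ → ℂ) (n : ℕ) : ℂ :=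
  (2 / Real.pi : ℝ) * ∫ x in (0 : ℝ)..Real.pi, w x * (Real.sin ((n + 1 : ℕ) * x) : ℂ)

theorem sineCoeff_congr {w z : ℝ → ℂ} (h : EqOn w z (Icc 0 Real.pi)) (n : ℕ) :
    sineCoeff w n = sineCoeff z n := by
  rw [sineCoeff, sineCoeff]
  congr 1
  refine intervalIntegral.integral_congr fun x hx => ?_
  rw [uIcc_of_le Real.pi_pos.le] at hx
  simp only [h hx]

theorem intervalIntegrable_mul_sin {w : ℝ → ℂ} (hw : ContinuousOn w (Icc 0 Real.pi)) (n : ℕ) :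
    IntervalIntegrable (fun x => w x * (Real.sin ((n + 1 : ℕ) * x) : ℂ)) volume 0 Real.pi := by
  refine ContinuousOn.intervalIntegrable ?_
  rw [uIcc_of_le Real.pi_pos.le]
  exact hw.mul (by fun_prop)

theorem sineCoeff_sub {w z : ℝ → ℂ} (hw : ContinuousOn w (Icc 0 Real.pi))
    (hz : ContinuousOn z (Icc 0 Real.pi)) (n : ℕ) :
    sineCoeff (fun x => w x - z x) n = sineCoeff w n - sineCoeff z n := by
  simp only [sineCoeff, sub_mul]
  rw [intervalIntegral.integral_sub (intervalIntegrable_mul_sin hw n)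
    (intervalIntegrable_mul_sin hz n), mul_sub]

theorem sineCoeff_const_mul (c : ℂ) (w : ℝ → ℂ) (n : ℕ) :
    sineCoeff (fun x => c * w x) n = c * sineCoeff w n := by
  simp only [sineCoeff, mul_assoc]
  rw [intervalIntegral.integral_const_mul]
  ring

theorem norm_sineCoeff_le {w : ℝ → ℂ} {C : ℝ} (hw : ∀ x ∈ Icc 0 Real.pi, ‖w x‖ ≤ C) (n : ℕ) :
    ‖sineCoeff w n‖ ≤ 2 * C := by
  have hC : 0 ≤ C := (norm_nonneg _).trans (hw 0 ⟨le_rfl, Real.pi_pos.le⟩)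
  have h := intervalIntegral.norm_integral_le_of_norm_le_const (a := 0) (b := Real.pi) (C := C)
    (f := fun x => w x * (Real.sin ((n + 1 : ℕ) * x) : ℂ)) fun x hx => by
      rw [uIoc_of_le Real.pi_pos.le] at hx
      rw [norm_mul, Complex.norm_real]
      exact (mul_le_of_le_one_right (norm_nonneg _) (Real.abs_sin_le_one _)).trans
        (hw x ⟨hx.1.le, hx.2⟩)
  rw [sub_zero, abs_of_pos Real.pi_pos] at h
  rw [sineCoeff, norm_mul, Complex.norm_real, Real.norm_of_nonneg (by positivity)]
  calc 2 / Real.pi * _ ≤ 2 / Real.pi * (C * Real.pi) := by gcongr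
    _ = 2 * C := by field_simp

theorem integral_sin_mul_sin (m n : ℕ) :
    ∫ x in (0 : ℝ)..Real.pi, Real.sin ((m + 1 : ℕ) * x) * Real.sin ((n + 1 : ℕ) * x)
      = if m = n then Real.pi / 2 else 0 := by
  have hc : ∀ k : ℤ, ∫ x in (0 : ℝ)..Real.pi, Real.cos (k * x) = if k = 0 then Real.pi else 0 := by
    intro k
    split_ifs with h
    · simp [h]
    · rw [intervalIntegral.integral_comp_mul_left (fun x => Real.cos x) (by exact_mod_cast h)]
      simp [Real.sin_int_mul_pi]
  have e : ∀ x : ℝ, Real.sin ((m + 1 : ℕ) * x) * Real.sin ((n + 1 : ℕ) * x)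
      = 1 / 2 * Real.cos (((m : ℤ) - n : ℤ) * x)
        - 1 / 2 * Real.cos (((m : ℤ) + n + 2 : ℤ) * x) := by
    intro x
    have h1 : ((((m : ℤ) - n : ℤ) : ℝ)) * x = (m + 1 : ℕ) * x - (n + 1 : ℕ) * x := by
      push_cast; ring
    have h2 : ((((m : ℤ) + n + 2 : ℤ) : ℝ)) * x = (m + 1 : ℕ) * x + (n + 1 : ℕ) * x := by
      push_cast; ring
    rw [h1, h2, Real.cos_sub, Real.cos_add]
    ring
  simp only [e]
  rw [intervalIntegral.integral_sub (Continuous.intervalIntegrable (by fun_prop) _ _)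
    (Continuous.intervalIntegrable (by fun_prop) _ _), intervalIntegral.integral_const_mul,
    intervalIntegral.integral_const_mul, hc, hc, if_neg (show ¬ (m : ℤ) + n + 2 = 0 by omega)]
  by_cases h : m = n
  · rw [if_pos h, if_pos (by omega)]; ring
  · rw [if_neg h, if_neg (by omega)]; ring

theorem continuous_evalAt (r : ℝ) [Fact (1 ≤ r)] (f : SineSpace) :
    Continuous fun x => evalAt r x f := by
  have e : (fun x => evalAt r x f) = fun x => ∑' n, f n * ((r : ℂ) ^ (n + 1))⁻¹ *
      (Real.sin ((n + 1 : ℕ) * x) : ℂ) := funext fun x => (hasSum_evalAt r x f).tsum_eq.symm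
  rw [e]
  refine continuous_tsum (fun n => by fun_prop) (summable_coeff r f) fun n x => ?_
  rw [norm_mul _ (Complex.ofReal _), Complex.norm_real]
  exact mul_le_of_le_one_right (norm_nonneg _) (Real.abs_sin_le_one _)

/-- With weight `1`, the stored sequence consists of the sine coefficients. -/
theorem sineCoeff_evalAt (f : SineSpace) (n : ℕ) : sineCoeff (fun x => evalAt 1 x f) n = f n := by
  have h : HasSum (fun m => ∫ x in (0 : ℝ)..Real.pi,
      f m * (Real.sin ((m + 1 : ℕ) * x) : ℂ) * (Real.sin ((n + 1 : ℕ) * x) : ℂ))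
      (∫ x in (0 : ℝ)..Real.pi, evalAt 1 x f * (Real.sin ((n + 1 : ℕ) * x) : ℂ)) := by
    refine intervalIntegral.hasSum_integral_of_dominated_convergence (fun m _ => ‖f m‖)
      (fun m => Continuous.aestronglyMeasurable (by fun_prop)) (fun m => ?_) ?_ ?_ ?_
    · refine Filter.Eventually.of_forall fun x _ => ?_
      rw [norm_mul, norm_mul, Complex.norm_real, Complex.norm_real]
      exact (mul_le_of_le_one_right (by positivity) (Real.abs_sin_le_one _)).trans
        (mul_le_of_le_one_right (norm_nonneg _) (Real.abs_sin_le_one _))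
    · exact Filter.Eventually.of_forall fun x _ => (hasSum_norm_coord f).summable
    · exact intervalIntegrable_const
    · refine Filter.Eventually.of_forall fun x _ => ?_
      have := (hasSum_evalAt 1 x f).mul_right (Real.sin ((n + 1 : ℕ) * x) : ℂ)
      simpa using this
  have e : ∀ m, ∫ x in (0 : ℝ)..Real.pi,
      f m * (Real.sin ((m + 1 : ℕ) * x) : ℂ) * (Real.sin ((n + 1 : ℕ) * x) : ℂ)
      = if m = n then f n * (Real.pi / 2 : ℝ) else 0 := by
    intro m
    have h1 := integral_sin_mul_sin m n
    simp only [mul_assoc]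
    rw [intervalIntegral.integral_const_mul]
    simp only [← Complex.ofReal_mul]
    rw [intervalIntegral.integral_ofReal, h1]
    split_ifs with hmn
    · rw [hmn]
    · simp
  simp only [e] at h
  have h2 := h.unique (hasSum_ite_eq n (f n * (Real.pi / 2 : ℝ)))
  have : (Real.pi : ℂ) ≠ 0 := Complex.ofReal_ne_zero.2 Real.pi_ne_zero
  rw [sineCoeff, h2]
  push_cast
  field_simp

theorem eq_of_evalAt_eq {f g : SineSpace}
    (h : ∀ x ∈ Icc 0 Real.pi, evalAt 1 x f = evalAt 1 x g) : f = g := by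
  ext n
  rw [← sineCoeff_evalAt f, ← sineCoeff_evalAt g]
  exact sineCoeff_congr h n

/-- Completeness of the sines: the odd extension of `w` is a continuous function on the circle,
all of whose Fourier coefficients vanish. -/
theorem eq_zero_of_sineCoeff_eq_zero {w : ℝ → ℂ} (hw : ContinuousOn w (Icc 0 Real.pi))
    (h0 : w 0 = 0) (hπ : w Real.pi = 0) (h : ∀ n, sineCoeff w n = 0) :
    ∀ x ∈ Icc 0 Real.pi, w x = 0 := by
  have hpi := Real.pi_pos
  set e : ℝ → ℂ := IccExtend hpi.le ((Icc 0 Real.pi).domRestrict w) with he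
  have ec : Continuous e := (continuousOn_iff_continuous_domRestrict.1 hw).Icc_extend'
  have e1 : ∀ x ∈ Icc 0 Real.pi, e x = w x := fun x hx => IccExtend_of_mem _ _ hx
  have e2 : ∀ x ≤ 0, e x = 0 := fun x hx => (IccExtend_of_le_left _ _ hx).trans h0
  -- `e` vanishes on the left half line, so `e x - e (-x)` is the odd extension on `[-π, π]`.
  have hsin : ∀ n : ℤ, ∫ x in (0 : ℝ)..Real.pi, e x * (Real.sin (n * x) : ℂ) = 0 := by
    have hn : ∀ n : ℕ, ∫ x in (0 : ℝ)..Real.pi, e x * (Real.sin ((n + 1 : ℕ) * x) : ℂ) = 0 := by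
      intro n
      have h1 := (sineCoeff_congr e1 n).trans (h n)
      rw [sineCoeff] at h1
      refine (mul_eq_zero.1 h1).resolve_left ?_
      exact Complex.ofReal_ne_zero.2 (by positivity)
    intro n
    obtain hlt | rfl | hlt := lt_trichotomy n 0
    · obtain ⟨m, rfl⟩ : ∃ m : ℕ, n = -((m : ℤ) + 1) := ⟨(-n - 1).toNat, by omega⟩
      have := hn m
      push_cast at this ⊢
      simpa [neg_mul, ← neg_add_rev, add_comm] using this
    · simp
    · obtain ⟨m, rfl⟩ : ∃ m : ℕ, n = (m : ℤ) + 1 := ⟨(n - 1).toNat, by omega⟩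
      simpa using hn m
  have : Fact (0 < 2 * Real.pi) := ⟨by positivity⟩
  set F : ℝ → ℂ := fun x => e x - e (-x) with hF
  have hFc : Continuous F := ec.sub (ec.comp continuous_neg)
  have hFper : F (-Real.pi) = F (-Real.pi + 2 * Real.pi) := by
    have : -Real.pi + 2 * Real.pi = Real.pi := by ring
    simp only [hF, this, neg_neg, e1 Real.pi ⟨hpi.le, le_rfl⟩, hπ, e2 (-Real.pi) (by linarith)]
  set G : C(AddCircle (2 * Real.pi), ℂ) :=
    ⟨AddCircle.liftIco (2 * Real.pi) (-Real.pi) F,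
      AddCircle.liftIco_continuous hFper hFc.continuousOn⟩ with hG
  have hcoef : ∀ n : ℤ, fourierCoeff G n = 0 := by
    intro n
    have h1 : fourierCoeff G n = _ := fourierCoeff_liftIco_eq (T := 2 * Real.pi) (a := -Real.pi) F n
    rw [h1, fourierCoeffOn_eq_integral]
    have hend : -Real.pi + 2 * Real.pi = Real.pi := by ring
    have hexp : ∀ x : ℝ, fourier (-n) (x : AddCircle (-Real.pi + 2 * Real.pi - -Real.pi))
        = Complex.exp (-(n * x : ℝ) * Complex.I) := by
      intro x
      rw [fourier_coe_apply]
      congr 1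
      have : (Real.pi : ℂ) ≠ 0 := Complex.ofReal_ne_zero.2 Real.pi_ne_zero
      push_cast
      field_simp
      ring
    simp only [hexp, hend, smul_eq_mul]
    have hsplit : ∫ x in -Real.pi..Real.pi, Complex.exp (-(n * x : ℝ) * Complex.I) * F x = 0 := by
      have c1 : Continuous fun x : ℝ => Complex.exp (-(n * x : ℝ) * Complex.I) * e x := by fun_prop
      have c2 : Continuous fun x : ℝ => Complex.exp (-(n * x : ℝ) * Complex.I) * e (-x) := by
        fun_prop
      have c3 : Continuous fun x : ℝ => Complex.exp (-(n * -x : ℝ) * Complex.I) * e x := by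
        fun_prop
      simp only [hF, mul_sub]
      rw [intervalIntegral.integral_sub (c1.intervalIntegrable _ _) (c2.intervalIntegrable _ _)]
      have h2 := intervalIntegral.integral_comp_neg (a := -Real.pi) (b := Real.pi)
        (fun x : ℝ => Complex.exp (-(n * -x : ℝ) * Complex.I) * e x)
      simp only [neg_neg] at h2
      rw [h2, ← intervalIntegral.integral_sub (c1.intervalIntegrable _ _)
        (c3.intervalIntegrable _ _)]
      have h3 : ∀ x : ℝ, Complex.exp (-(n * x : ℝ) * Complex.I) * e x
          - Complex.exp (-(n * -x : ℝ) * Complex.I) * e x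
          = (-2 * Complex.I) * (e x * (Real.sin (n * x) : ℂ)) := by
        intro x
        rw [Complex.ofReal_sin, Complex.sin]
        push_cast
        have hI := Complex.I_mul_I
        ring_nf
        rw [Complex.I_sq]
        ring
      simp only [h3]
      have c4 : Continuous fun x : ℝ => (-2 * Complex.I) * (e x * (Real.sin (n * x) : ℂ)) := by
        fun_prop
      rw [← intervalIntegral.integral_add_adjacent_intervals (b := 0)
        (c4.intervalIntegrable _ _) (c4.intervalIntegrable _ _),
        intervalIntegral.integral_const_mul, intervalIntegral.integral_const_mul, hsin n, mul_zero,
        add_zero]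
      have h4 : ∫ x in -Real.pi..0, e x * (Real.sin (n * x) : ℂ)
          = ∫ x in -Real.pi..0, (0 : ℂ) := intervalIntegral.integral_congr fun x hx => by
        rw [uIcc_of_le (by linarith)] at hx
        simp only [e2 x hx.2, zero_mul]
      rw [h4]
      simp
    rw [hsplit, smul_zero]
  have hsum : Summable (fourierCoeff G) := by
    have : fourierCoeff G = fun _ => 0 := funext hcoef
    rw [this]
    exact summable_zero
  have hev : ∀ x ∈ Ico 0 Real.pi, w x = 0 := by
    intro x hx
    have h1 := has_pointwise_sum_fourier_series_of_summable hsum (x : AddCircle (2 * Real.pi))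
    simp only [hcoef, zero_smul] at h1
    have hx' : x ∈ Ico (-Real.pi) (-Real.pi + 2 * Real.pi) :=
      ⟨by linarith [hx.1], by linarith [hx.2]⟩
    have h2 : G (x : AddCircle (2 * Real.pi)) = F x := AddCircle.liftIco_coe_apply (f := F) hx'
    have h3 := h1.unique hasSum_zero
    rw [h2] at h3
    simpa only [hF, e1 x ⟨hx.1, hx.2.le⟩, e2 (-x) (by linarith [hx.1]), sub_zero] using h3
  intro x hx
  obtain rfl | hlt := hx.2.eq_or_lt
  · exact hπ
  · exact hev x ⟨hx.1, hlt⟩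

end SineCoeff

/-! ### Zeros of the cubic map from stationary solutions -/

section Converse

open MeasureTheory

/-- Integrating by parts twice. The derivative of `w` need not extend to the boundary; it is bounded
because the second derivative is, and this suffices since `sin ((n + 1) x)` vanishes there. -/
theorem sq_mul_sineCoeff {w g : ℝ → ℂ} (hw : ContinuousOn w (Icc 0 Real.pi))
    (hw2 : ContDiffOn ℝ 2 w (Ioo 0 Real.pi)) (h0 : w 0 = 0) (hπ : w Real.pi = 0)
    (hg : ContinuousOn g (Icc 0 Real.pi)) (h : ∀ x ∈ Ioo 0 Real.pi, deriv (deriv w) x = -g x)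
    (n : ℕ) : ((n : ℂ) + 1) ^ 2 * sineCoeff w n = sineCoeff g n := by
  have hpi := Real.pi_pos
  set m : ℝ := ((n + 1 : ℕ) : ℝ) with hm
  rw [show (2 : WithTop ℕ∞) = 1 + 1 by norm_num, contDiffOn_succ_iff_deriv_of_isOpen isOpen_Ioo]
    at hw2
  have d1 : ∀ x ∈ Ioo 0 Real.pi, HasDerivAt w (deriv w x) x := fun x hx =>
    ((hw2.1 x hx).differentiableAt (isOpen_Ioo.mem_nhds hx)).hasDerivAt
  have d2 : ∀ x ∈ Ioo 0 Real.pi, HasDerivAt (deriv w) (-g x) x := fun x hx => by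
    rw [← h x hx]
    exact ((hw2.2.2.differentiableOn (by norm_num) x hx).differentiableAt
      (isOpen_Ioo.mem_nhds hx)).hasDerivAt
  obtain ⟨C, hC⟩ := isCompact_Icc.exists_bound_of_continuousOn hg
  have hbd : ∀ x ∈ Ioo 0 Real.pi, ‖deriv w x‖ ≤ ‖deriv w (Real.pi / 2)‖ + C * Real.pi := by
    intro x hx
    have hmid : Real.pi / 2 ∈ Ioo 0 Real.pi := ⟨by linarith, by linarith⟩
    have h1 := (convex_Ioo 0 Real.pi).norm_image_sub_le_of_norm_hasDerivWithin_le
      (fun y hy => (d2 y hy).hasDerivWithinAt)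
      (fun y hy => by rw [norm_neg]; exact hC y (Ioo_subset_Icc_self hy)) hmid hx
    have hC0 : 0 ≤ C := (norm_nonneg _).trans (hC 0 ⟨le_rfl, hpi.le⟩)
    have h2 : ‖x - Real.pi / 2‖ ≤ Real.pi := by
      rw [Real.norm_eq_abs, abs_le]
      constructor <;> linarith [hx.1, hx.2]
    have h3 := norm_le_insert' (deriv w x) (deriv w (Real.pi / 2))
    have h4 : C * ‖x - Real.pi / 2‖ ≤ C * Real.pi := by gcongr
    linarith
  set Φ : ℝ → ℂ := fun x =>
    deriv w x * (Real.sin (m * x) : ℂ) - m * (w x * (Real.cos (m * x) : ℂ)) with hΦ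
  have hlin : ∀ x : ℝ, HasDerivAt (fun x : ℝ => m * x) m x :=
    fun x => by simpa using (hasDerivAt_id x).const_mul m
  have hder : ∀ x ∈ Ioo 0 Real.pi, HasDerivAt Φ
      (((m : ℂ) ^ 2 * w x - g x) * (Real.sin (m * x) : ℂ)) x := by
    intro x hx
    have s1 := (hlin x).sin.ofReal_comp
    have c1 := (hlin x).cos.ofReal_comp
    refine (((d2 x hx).mul s1).sub (((d1 x hx).mul c1).const_mul (m : ℂ))).congr_deriv ?_
    push_cast
    ring
  have hlim : ∀ (a : ℝ) (s : Set ℝ), a ∈ Icc 0 Real.pi → w a = 0 → Real.sin (m * a) = 0 →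
      Ioo 0 Real.pi ∈ nhdsWithin a s → Filter.Tendsto Φ (nhdsWithin a s) (nhds 0) := by
    intro a s ha hwa hsa hs
    have t1 : Filter.Tendsto (fun x => (Real.sin (m * x) : ℂ)) (nhdsWithin a s) (nhds 0) := by
      have : Continuous fun x : ℝ => (Real.sin (m * x) : ℂ) := by fun_prop
      have h1 := (this.tendsto a).mono_left (nhdsWithin_le_nhds (s := s))
      simpa only [hsa, Complex.ofReal_zero] using h1
    have t2 : Filter.Tendsto (fun x => deriv w x * (Real.sin (m * x) : ℂ)) (nhdsWithin a s)
        (nhds 0) := by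
      refine Filter.Tendsto.zero_mul_isBoundedUnder_le t1 ?_ |>.congr fun x => mul_comm _ _
      exact Filter.isBoundedUnder_of_eventually_le (Filter.mem_of_superset hs hbd)
    have t3 : Filter.Tendsto w (nhdsWithin a s) (nhds 0) := by
      have h1 := hw a ha
      rw [ContinuousWithinAt, hwa] at h1
      exact h1.mono_left (nhdsWithin_le_iff.2 (Filter.mem_of_superset hs Ioo_subset_Icc_self))
    have t4 : Filter.Tendsto (fun x => (Real.cos (m * x) : ℂ)) (nhdsWithin a s)
        (nhds (Real.cos (m * a))) := by
      have : Continuous fun x : ℝ => (Real.cos (m * x) : ℂ) := by fun_prop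
      exact (this.tendsto a).mono_left nhdsWithin_le_nhds
    simpa [hΦ] using t2.sub ((t3.mul t4).const_mul (m : ℂ))
  have hcont : ContinuousOn (fun x => ((m : ℂ) ^ 2 * w x - g x) * (Real.sin (m * x) : ℂ))
      (Icc 0 Real.pi) := by
    refine ((continuousOn_const.mul hw).sub hg).mul ?_
    fun_prop
  have key := intervalIntegral.integral_eq_sub_of_hasDerivAt_of_tendsto hpi hder
    (hcont.intervalIntegrable_of_Icc hpi.le)
    (hlim 0 (Ioi 0) ⟨le_rfl, hpi.le⟩ h0 (by simp) (Ioo_mem_nhdsGT hpi))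
    (hlim Real.pi (Iio Real.pi) ⟨hpi.le, le_rfl⟩ hπ (Real.sin_nat_mul_pi _) (Ioo_mem_nhdsLT hpi))
  rw [sub_zero] at key
  have e : sineCoeff (fun x => (m : ℂ) ^ 2 * w x - g x) n = 0 := by rw [sineCoeff, key, mul_zero]
  rw [sineCoeff_sub (w := fun x => (m : ℂ) ^ 2 * w x) (continuousOn_const.mul hw) hg,
    sineCoeff_const_mul] at e
  have : (m : ℂ) = (n : ℂ) + 1 := by rw [hm]; push_cast; rfl
  rw [← this]
  exact sub_eq_zero.1 e

theorem natCast_add_one_sq_ne_zero (n : ℕ) : ((n : ℂ) + 1) ^ 2 ≠ 0 :=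
  pow_ne_zero 2 (Nat.cast_add_one_ne_zero n)

theorem summable_inv_freq_sq : Summable fun n : ℕ => 1 / ((n : ℝ) + 1) ^ 2 := by
  have := (summable_nat_add_iff 1).2 (Real.summable_one_div_nat_pow.2 (by norm_num : 1 < 2))
  simpa using this

theorem norm_le_of_freq_sq {f : SineSpace} {C : ℝ}
    (h : ∀ n : ℕ, ‖((n : ℂ) + 1) ^ 2 * f n‖ ≤ C) :
    ‖f‖ ≤ C * ∑' n : ℕ, 1 / ((n : ℝ) + 1) ^ 2 := by
  rw [← (hasSum_norm_coord f).tsum_eq, ← tsum_mul_left]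
  refine (hasSum_norm_coord f).summable.tsum_le_tsum (fun n => ?_)
    (summable_inv_freq_sq.mul_left C)
  have := h n
  rw [norm_mul, norm_pow, ← Nat.cast_succ, Complex.norm_natCast] at this
  push_cast at this
  rw [mul_one_div, le_div_iff₀ (by positivity)]
  linarith

/-- A solution of the Dirichlet problem is the sum of its sine series, with absolutely summable
coefficients. -/
theorem exists_sineSpace_of_dirichlet {w g : ℝ → ℂ} (hw : ContinuousOn w (Icc 0 Real.pi))
    (hw2 : ContDiffOn ℝ 2 w (Ioo 0 Real.pi)) (h0 : w 0 = 0) (hπ : w Real.pi = 0)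
    (hg : ContinuousOn g (Icc 0 Real.pi)) (h : ∀ x ∈ Ioo 0 Real.pi, deriv (deriv w) x = -g x) :
    ∃ f : SineSpace, (∀ n : ℕ, ((n : ℂ) + 1) ^ 2 * f n = sineCoeff g n) ∧
      ∀ x ∈ Icc 0 Real.pi, w x = evalAt 1 x f := by
  have hc := sq_mul_sineCoeff hw hw2 h0 hπ hg h
  obtain ⟨C, hC⟩ := isCompact_Icc.exists_bound_of_continuousOn hg
  have hs : Summable fun n => ‖sineCoeff w n‖ := by
    refine Summable.of_nonneg_of_le (fun _ => norm_nonneg _) (fun n => ?_)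
      (summable_inv_freq_sq.mul_left (2 * C))
    have h1 := norm_sineCoeff_le hC n
    rw [← hc, norm_mul, norm_pow, ← Nat.cast_succ, Complex.norm_natCast] at h1
    push_cast at h1
    rw [mul_one_div, le_div_iff₀ (by positivity)]
    linarith
  set f : SineSpace := ⟨sineCoeff w, memℓp_gen (by simpa using hs)⟩ with hf
  have hfn : ∀ n, f n = sineCoeff w n := fun _ => rfl
  refine ⟨f, fun n => by rw [hfn, hc], fun x hx => ?_⟩
  have hev := (continuous_evalAt 1 f).continuousOn (s := Icc 0 Real.pi)
  have := eq_zero_of_sineCoeff_eq_zero (hw.sub hev)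
    (by simp [h0, evalAt_zero]) (by simp [hπ, evalAt_pi]) (fun n => by
      have := sineCoeff_sub hw hev n
      rw [sineCoeff_evalAt, hfn, sub_self] at this
      exact this) x hx
  exact sub_eq_zero.1 this

/-- The reaction term of the second equation. -/
def reaction (b : ℝ) (u v : ℝ → ℂ) (x : ℝ) : ℂ := b * u x - u x ^ 2 * v x

theorem IsDirichletRegular.continuousOn_const {w : ℝ → ℂ} (h : IsDirichletRegular fun x _ => w x) :
    ContinuousOn w (Icc 0 Real.pi) :=
  h.continuousOn.comp (f := fun x : ℝ => (x, (0 : ℝ))) (by fun_prop) fun _ hx => ⟨hx, mem_univ _⟩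

/-- Every stationary solution, of whatever size, comes from a
zero of the cubic map with weight `1`. -/
theorem exists_zero_of_isStationarySolution {b : ℝ} {u v : ℝ → ℂ}
    (h : IsStationarySolution b u v) :
    ∃ y : SineSpace, cubic invLap resolv (mul3 1) (sineVec 1 1) b y = 0 ∧
      (∀ n : ℕ, ((n : ℂ) + 1) ^ 2 * y n = sineCoeff (reaction b u v) n) ∧
      ∀ x ∈ Icc 0 Real.pi, u x = evalAt 1 x (resolv (sineVec 1 1 - y)) ∧
        v x = evalAt 1 x ((64 : ℂ) • y) := by
  have cu := h.regular_fst.continuousOn_const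
  have cv := h.regular_snd.continuousOn_const
  have cr : ContinuousOn (reaction b u v) (Icc 0 Real.pi) :=
    (continuousOn_const.mul cu).sub ((cu.pow 2).mul cv)
  obtain ⟨a, ha, ha'⟩ := exists_sineSpace_of_dirichlet (g := fun x =>
      (Real.sin x : ℂ) - reaction b u v x - u x) cu (h.regular_fst.contDiffOn_space 0)
    (h.regular_fst.boundary_left 0) (h.regular_fst.boundary_right 0)
    ((ContinuousOn.sub (by fun_prop) cr).sub cu) (fun x hx => by
      have := h.eq_fst x hx 0
      simp only [deriv_const] at this
      rw [reaction]
      linear_combination -this)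
  obtain ⟨z, hz, hz'⟩ := exists_sineSpace_of_dirichlet (g := fun x => 64 * reaction b u v x) cv
    (h.regular_snd.contDiffOn_space 0) (h.regular_snd.boundary_left 0)
    (h.regular_snd.boundary_right 0) (continuousOn_const.mul cr) (fun x hx => by
      have := h.eq_snd x hx 0
      simp only [deriv_const] at this
      rw [reaction]
      linear_combination (-64) * this)
  set y : SineSpace := (1 / 64 : ℂ) • z with hy
  have hzy : z = (64 : ℂ) • y := by rw [hy, smul_smul]; norm_num
  set H : SineSpace := (b : ℂ) • a - (64 : ℂ) • mul3 1 a a y with hH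
  have hHe : ∀ x ∈ Icc 0 Real.pi, reaction b u v x = evalAt 1 x H := by
    intro x hx
    rw [hH, map_sub, map_smul, map_smul, evalAt_mul3, reaction, ha' x hx, hz' x hx, hzy, map_smul]
    simp only [smul_eq_mul]
    ring
  have hHn : ∀ n, sineCoeff (reaction b u v) n = H n := fun n => by
    rw [sineCoeff_congr hHe, sineCoeff_evalAt]
  have hyn : ∀ n : ℕ, ((n : ℂ) + 1) ^ 2 * y n = sineCoeff (reaction b u v) n := by
    intro n
    have h1 := hz n
    rw [sineCoeff_const_mul, hzy] at h1
    simp only [lp.coeFn_smul, Pi.smul_apply, smul_eq_mul] at h1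
    linear_combination (1 / 64) * h1
  have hyS : y = invLap H := by
    ext n
    rw [invLap, coord_diag, ← hHn, ← hyn]
    have := natCast_add_one_sq_ne_zero n
    field_simp
  have han : ∀ n : ℕ, ((n : ℂ) + 1) ^ 2 * a n = (sineVec 1 1 - H - a : SineSpace) n := by
    intro n
    rw [ha n, ← sineCoeff_evalAt]
    refine sineCoeff_congr (fun x hx => ?_) n
    have hs := evalAt_sineVec 1 x 1
    rw [Int.cast_one, one_mul] at hs
    rw [map_sub, map_sub, hs, hHe x hx, ha' x hx]
  have haR : a = resolv (sineVec 1 1 - y) := by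
    ext n
    rw [resolv, coord_diag]
    have h1 := han n
    have h2 := natCast_add_one_sq_ne_zero n
    have h3 := sq_add_one_ne_zero n
    have h4 := hyn n
    rw [hHn] at h4
    have h5 : (sineVec 1 1 : SineSpace) n = ((n : ℂ) + 1) ^ 2 * (sineVec 1 1 : SineSpace) n := by
      have : (sineVec 1 1 : SineSpace) = (1 : ℂ) • unitVec 0 := by simpa using sineVec_succ 1 0
      rw [this, one_smul, unitVec_apply]
      split_ifs with hn
      · simp [hn]
      · simp
    simp only [lp.coeFn_sub, Pi.sub_apply] at h1 ⊢
    rw [div_mul_eq_mul_div, eq_div_iff h3]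
    linear_combination h1 + h5 + h4
  refine ⟨y, ?_, hyn, fun x hx => ⟨by rw [ha' x hx, ← haR], by rw [hz' x hx, hzy]⟩⟩
  rw [cubic, ← haR, ← hH, ← hyS, sub_self]

end Converse

/-! ### Local uniqueness among stationary solutions -/

section LocalUniqueness

theorem norm_reaction_sub_le {b b₀ : ℝ} {u v u₀ v₀ : ℝ → ℂ} {x ε M : ℝ} (hε : ε ≤ 1)
    (hb : |b - b₀| ≤ ε) (hu : ‖u x - u₀ x‖ ≤ ε) (hv : ‖v x - v₀ x‖ ≤ ε) (hu₀ : ‖u₀ x‖ ≤ M)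
    (hv₀ : ‖v₀ x‖ ≤ M) :
    ‖reaction b u v x - reaction b₀ u₀ v₀ x‖
      ≤ ε * ((M + 1) + |b₀| + (2 * M + 1) * (M + 1) + M ^ 2) := by
  have hε0 : 0 ≤ ε := (abs_nonneg _).trans hb
  have hM : 0 ≤ M := (norm_nonneg _).trans hu₀
  have e : reaction b u v x - reaction b₀ u₀ v₀ x = ((b - b₀ : ℝ) : ℂ) * u x + b₀ * (u x - u₀ x)
      + -((u x - u₀ x) * (u x + u₀ x) * v x) + -(u₀ x ^ 2 * (v x - v₀ x)) := by
    simp only [reaction]; push_cast; ring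
  have nu : ‖u x‖ ≤ M + 1 := by have := norm_le_insert' (u x) (u₀ x); linarith
  have nv : ‖v x‖ ≤ M + 1 := by have := norm_le_insert' (v x) (v₀ x); linarith
  have nuu : ‖u x + u₀ x‖ ≤ 2 * M + 1 := by have := norm_add_le (u x) (u₀ x); linarith
  rw [e]
  have t1 : ‖((b - b₀ : ℝ) : ℂ) * u x‖ ≤ ε * (M + 1) := by
    rw [norm_mul, Complex.norm_real, Real.norm_eq_abs]; gcongr
  have t2 : ‖(b₀ : ℂ) * (u x - u₀ x)‖ ≤ |b₀| * ε := by
    rw [norm_mul, Complex.norm_real, Real.norm_eq_abs]; gcongr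
  have t3 : ‖-((u x - u₀ x) * (u x + u₀ x) * v x)‖ ≤ ε * (2 * M + 1) * (M + 1) := by
    rw [norm_neg, norm_mul, norm_mul]; gcongr
  have t4 : ‖-(u₀ x ^ 2 * (v x - v₀ x))‖ ≤ M ^ 2 * ε := by
    rw [norm_neg, norm_mul, norm_pow]; gcongr
  refine (norm_add_le_of_le (norm_add_le_of_le (norm_add_le_of_le t1 t2) t3) t4).trans
    (le_of_eq (by ring))

/-- Near a nondegenerate zero of the cubic map, in the uniform norm, there is at most one stationary
solution for each parameter. -/
theorem exists_eqOn_of_uniformlyClose {b₀ : ℝ} {y₀ : SineSpace} {U V : ℝ → ℂ}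
    (h0 : cubic invLap resolv (mul3 1) (sineVec 1 1) b₀ y₀ = 0)
    (hD : IsUnit (1 + invLap.comp (linPart resolv (mul3 1) b₀ (resolv (sineVec 1 1 - y₀)) y₀)))
    (hU : ∀ x, U x = evalAt 1 x (resolv (sineVec 1 1 - y₀)))
    (hV : ∀ x, V x = evalAt 1 x ((64 : ℂ) • y₀)) :
    ∃ ε > 0, ∀ b : ℝ, |b - b₀| < ε → ∀ u v u' v' : ℝ → ℂ, IsStationarySolution b u v →
      IsStationarySolution b u' v' → UniformlyClose ε U V u v → UniformlyClose ε U V u' v' →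
      EqOn u u' (Icc 0 Real.pi) ∧ EqOn v v' (Icc 0 Real.pi) := by
  obtain rfl : U = fun x => evalAt 1 x (resolv (sineVec 1 1 - y₀)) := funext hU
  obtain rfl : V = fun x => evalAt 1 x ((64 : ℂ) • y₀) := funext hV
  set U := fun x => evalAt 1 x (resolv (sineVec 1 1 - y₀))
  set V := fun x => evalAt 1 x ((64 : ℂ) • y₀)
  obtain ⟨φ, -, -, -, hφ⟩ := exists_local_branch invLap resolv (sineVec 1 1) (mul3_comm 1)
    (mul3_comm' 1) h0 hD
  obtain ⟨η, hη, hφ⟩ := Metric.eventually_nhds_iff.1 hφ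
  obtain ⟨MU, hMU⟩ := isCompact_Icc.exists_bound_of_continuousOn
    ((continuous_evalAt 1 (resolv (sineVec 1 1 - y₀))).continuousOn (s := Icc 0 Real.pi))
  obtain ⟨MV, hMV⟩ := isCompact_Icc.exists_bound_of_continuousOn
    ((continuous_evalAt 1 ((64 : ℂ) • y₀)).continuousOn (s := Icc 0 Real.pi))
  set M := max MU MV
  have hM0 : 0 ≤ M := (norm_nonneg _).trans
    ((hMU 0 ⟨le_rfl, Real.pi_pos.le⟩).trans (le_max_left _ _))
  set L := (M + 1) + |b₀| + (2 * M + 1) * (M + 1) + M ^ 2 with hL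
  have hL0 : 0 ≤ L := by positivity
  set K := ∑' n : ℕ, 1 / ((n : ℝ) + 1) ^ 2
  have hK0 : 0 ≤ K := tsum_nonneg fun n => by positivity
  obtain ⟨z, -, hzn, hz⟩ := exists_zero_of_isStationarySolution
    (isStationarySolution_of_cubic_eq_zero 1 h0)
  obtain rfl : z = y₀ := by
    have : (64 : ℂ) • y₀ = (64 : ℂ) • z := eq_of_evalAt_eq fun x hx => (hz x hx).2
    exact (smul_right_injective _ (by norm_num : (64 : ℂ) ≠ 0) this).symm
  set ε := min (min 1 η) (η / (2 * L * K + 1)) with hε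
  have hε1 : ε ≤ 1 := (min_le_left _ _).trans (min_le_left _ _)
  have hεη : ε ≤ η := (min_le_left _ _).trans (min_le_right _ _)
  have hεL : ε * (2 * L * K + 1) ≤ η := by
    rw [← le_div_iff₀ (by positivity)]; exact min_le_right _ _
  have hε0 : 0 < ε := by positivity
  refine ⟨ε, hε0, fun b hb => ?_⟩
  have key : ∀ u v : ℝ → ℂ, IsStationarySolution b u v → UniformlyClose ε U V u v →
      ∀ x ∈ Icc 0 Real.pi, u x = evalAt 1 x (resolv (sineVec 1 1 - φ b)) ∧
        v x = evalAt 1 x ((64 : ℂ) • φ b) := by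
    intro u v huv hcl
    obtain ⟨y, hy, hyn, hyx⟩ := exists_zero_of_isStationarySolution huv
    have hdist : ‖y - z‖ ≤ 2 * (ε * L) * K := by
      refine norm_le_of_freq_sq fun n => ?_
      have cr : ∀ {b : ℝ} {u v : ℝ → ℂ}, IsStationarySolution b u v →
          ContinuousOn (reaction b u v) (Icc 0 Real.pi) := fun h =>
        (continuousOn_const.mul h.regular_fst.continuousOn_const).sub
          ((h.regular_fst.continuousOn_const.pow 2).mul h.regular_snd.continuousOn_const)
      have e : ((n : ℂ) + 1) ^ 2 * (y - z : SineSpace) n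
          = sineCoeff (fun x => reaction b u v x - reaction b₀ U V x) n := by
        rw [sineCoeff_sub (cr huv) (cr (isStationarySolution_of_cubic_eq_zero 1 h0)), ← hyn, ← hzn,
          lp.coeFn_sub, Pi.sub_apply, mul_sub]
      rw [e]
      refine norm_sineCoeff_le (fun x hx => ?_) n
      exact norm_reaction_sub_le hε1 hb.le (hcl x hx).1.le (hcl x hx).2.le
        ((hMU x hx).trans (le_max_left _ _)) ((hMV x hx).trans (le_max_right _ _))
    have hφy : φ b = y := by
      refine (hφ (y := ((b : ℂ), y)) ?_).1 hy
      rw [Prod.dist_eq, max_lt_iff]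
      constructor
      · rw [dist_eq_norm, ← Complex.ofReal_sub, Complex.norm_real]
        exact lt_of_lt_of_le hb hεη
      · rw [dist_eq_norm]
        refine hdist.trans_lt ?_
        linarith
    rw [hφy]
    exact hyx
  intro u v u' v' h h' hc hc'
  exact ⟨fun x hx => (key u v h hc x hx).1.trans (key u' v' h' hc' x hx).1.symm,
    fun x hx => (key u v h hc x hx).2.trans (key u' v' h' hc' x hx).2.symm⟩

theorem IsDirichletRegular.reflect {w : ℝ → ℂ} (h : IsDirichletRegular fun x _ => w x) :
    IsDirichletRegular fun x _ => w (Real.pi - x) := by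
  refine ⟨?_, fun _ _ => differentiable_const _, fun _ => ?_, fun _ => ?_, fun _ => ?_⟩
  · refine h.continuousOn_const.comp (f := fun p : ℝ × ℝ => Real.pi - p.1) (by fun_prop) ?_
    rintro p ⟨⟨h1, h2⟩, -⟩
    exact ⟨by linarith, by linarith⟩
  · refine (h.contDiffOn_space 0).comp (f := fun y : ℝ => Real.pi - y) (by fun_prop) ?_
    rintro y ⟨h1, h2⟩
    exact ⟨by linarith, by linarith⟩
  · simpa using h.boundary_right 0
  · simpa using h.boundary_left 0

theorem IsStationarySolution.reflect {b : ℝ} {u v : ℝ → ℂ} (h : IsStationarySolution b u v) :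
    IsStationarySolution b (fun x => u (Real.pi - x)) (fun x => v (Real.pi - x)) := by
  have dd : ∀ (w : ℝ → ℂ) (x : ℝ), deriv (deriv fun y => w (Real.pi - y)) x
      = deriv (deriv w) (Real.pi - x) := by
    intro w x
    have e : (deriv fun y => w (Real.pi - y)) = fun y => -deriv w (Real.pi - y) :=
      funext fun y => deriv_comp_const_sub w Real.pi y
    rw [e, deriv.fun_neg, deriv_comp_const_sub (deriv w) Real.pi x, neg_neg]
  have hx' : ∀ x ∈ Ioo 0 Real.pi, Real.pi - x ∈ Ioo 0 Real.pi := fun x hx =>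
    ⟨by linarith [hx.2], by linarith [hx.1]⟩
  refine ⟨h.regular_fst.reflect, h.regular_snd.reflect, fun x hx t => ?_, fun x hx t => ?_⟩
  · have := h.eq_fst _ (hx' x hx) t
    rw [dd, ← Real.sin_pi_sub x]
    simpa only [deriv_const] using this
  · have := h.eq_snd _ (hx' x hx) t
    rw [dd]
    simpa only [deriv_const] using this

end LocalUniqueness

/-! ### The analytic branch -/

section AnalyticBranch

/-- Both sides are the same function, and a sine series is determined by its sum. -/
theorem toUnweighted_mul3 (r : ℝ) [Fact (1 ≤ r)] (f g h : SineSpace) : toUnweighted r (mul3 r f g h)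
    = mul3 1 (toUnweighted r f) (toUnweighted r g) (toUnweighted r h) :=
  eq_of_evalAt_eq fun x _ => by simp only [evalAt_toUnweighted, evalAt_mul3]

theorem toUnweighted_cubic (r : ℝ) [Fact (1 ≤ r)] (b : ℂ) (y : SineSpace) :
    toUnweighted r (cubic invLap resolv (mul3 r) (sineVec r 1) b y)
      = cubic invLap resolv (mul3 1) (sineVec 1 1) b (toUnweighted r y) := by
  have hS : ∀ f, toUnweighted r (invLap f) = invLap (toUnweighted r f) := toUnweighted_diag r _ _ _
  have hR : ∀ f, toUnweighted r (resolv f) = resolv (toUnweighted r f) := toUnweighted_diag r _ _ _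
  have hu : toUnweighted r (resolv (sineVec r 1 - y))
      = resolv (sineVec 1 1 - toUnweighted r y) := by rw [hR, map_sub, toUnweighted_sineVec]
  rw [cubic, cubic, map_sub, hS, map_sub, map_smul, map_smul, toUnweighted_mul3, hu]

theorem toUnweighted_center (r : ℝ) [Fact (1 ≤ r)] (b : ℝ) :
    toUnweighted r (center r b) = center 1 b := by
  have h0 : ∀ n : Node, toUnweighted r (oddPoly r n.y) = oddPoly 1 n.y := fun n => by
    simp only [oddPoly, map_add, map_smul, toUnweighted_sineVec]
  rw [center, center]
  generalize chainStart = n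
  induction chain generalizing n with
  | nil => exact h0 n
  | cons p l ih =>
    obtain ⟨c, m⟩ := p
    simp only [chainPath]
    split_ifs
    · simp only [interp, map_add, map_smul, h0]
    · exact ih m

theorem rho_pow_five_le : rho ^ 5 ≤ 1081 / 1000 := by norm_num [rho]

/-- The zeros found by `center_zero` form an analytic branch: near each of them the zero set is the
graph of an analytic function, whose values stay in the balls in which the zero is unique. The branch
is also nondegenerate in the larger space with weight `1`. -/
theorem exists_analytic_branch : ∃ Y : ℝ → SineSpace, AnalyticOnNhd ℝ Y (Icc 0 11) ∧
    ∀ b ∈ Icc (0 : ℝ) 11, Y b ∈ realOdd ∧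
      cubic invLap resolv (mul3 rho) (sineVec rho 1) b (Y b) = 0 ∧
      IsUnit (1 + invLap.comp (linPart resolv (mul3 1) b
        (resolv (sineVec 1 1 - toUnweighted rho (Y b))) (toUnweighted rho (Y b)))) := by
  have hI : ∀ b ∈ Icc (0 : ℝ) 11, b ∈ Ioo (-(1 / 64) : ℝ) (11 + 1 / 64) := fun b hb =>
    ⟨by linarith [hb.1], by linarith [hb.2]⟩
  have hex : ∀ b ∈ Ioo (-(1 / 64) : ℝ) (11 + 1 / 64),
      ∃ z, z ∈ Metric.ball (center rho b) (1 / 500) ∧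
      z ∈ (realOdd : Set SineSpace) ∧
      cubic invLap resolv (mul3 rho) (sineVec rho 1) b z = 0 := fun b hb =>
    (center_zero rho rho_pow_five_le hb).1
  choose! Y hYb hYr hY0 using hex
  refine ⟨Y, fun b₀ hb₀ => ?_, fun b hb => ⟨hYr b (hI b hb), hY0 b (hI b hb), ?_⟩⟩
  · have hb := hI b₀ hb₀
    obtain ⟨φ, hφa, hφb, hφ0, -⟩ := exists_local_branch invLap resolv (sineVec rho 1)
      (mul3_comm rho) (mul3_comm' rho) (hY0 b₀ hb)
      ((center_zero rho rho_pow_five_le hb).2.2 _ (Metric.ball_subset_closedBall (hYb b₀ hb)))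
    have hφr : AnalyticAt ℝ (fun b : ℝ => φ b) b₀ :=
      (hφa.restrictScalars (𝕜 := ℝ)).comp_of_eq (Complex.ofRealCLM.analyticAt b₀) rfl
    refine hφr.congr ?_
    have e1 : ∀ᶠ b : ℝ in nhds b₀, b ∈ Ioo (-(1 / 64) : ℝ) (11 + 1 / 64) := isOpen_Ioo.mem_nhds hb
    have e2 : ∀ᶠ b : ℝ in nhds b₀,
        cubic invLap resolv (mul3 rho) (sineVec rho 1) b (φ b) = 0 :=
      Complex.continuous_ofReal.continuousAt.eventually hφ0
    have e3 : ∀ᶠ b : ℝ in nhds b₀, dist (φ b) (center rho b) < 1 / 500 := by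
      refine (hφr.continuousAt.dist (continuous_center rho).continuousAt).eventually_lt
        continuousAt_const ?_
      change dist (φ b₀) (center rho b₀) < 1 / 500
      rw [hφb]
      exact hYb b₀ hb
    filter_upwards [e1, e2, e3] with b h1 h2 h3
    exact (center_zero rho rho_pow_five_le h1).2.1 _ h3.le _
      (Metric.ball_subset_closedBall (hYb b h1)) h2 (hY0 b h1)
  · refine (center_zero 1 (by norm_num) (hI b hb)).2.2 _ ?_
    rw [mem_closedBall_iff_norm, ← toUnweighted_center rho, ← map_sub]
    exact (norm_toUnweighted_le rho _).trans
      (mem_closedBall_iff_norm.1 (Metric.ball_subset_closedBall (hYb b (hI b hb))))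

end AnalyticBranch

end Brusselator

open Brusselator

theorem theorem1 :
    ∃ U V : ℝ → Brusselator.SineSpace,
      AnalyticOnNhd ℝ (fun b : ℝ => (U b, V b)) (Set.Icc 0 11) ∧
      ∀ b ∈ Set.Icc (0 : ℝ) 11,
        (∀ x : ℝ, ((U b).toFun x).im = 0 ∧ ((V b).toFun x).im = 0) ∧
        AnalyticOnNhd ℝ (U b).toFun Set.univ ∧
        AnalyticOnNhd ℝ (V b).toFun Set.univ ∧
        Brusselator.IsStationarySolution b (U b).toFun (V b).toFun ∧
        Brusselator.IsReflectionSymmetric (U b).toFun (V b).toFun ∧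
        Brusselator.IsIsolatedStationary b (U b).toFun (V b).toFun ∧
        ¬ Brusselator.IsSymmetryBreakingBifurcation b (U b).toFun (V b).toFun := by
  obtain ⟨Y, hYa, hY⟩ := exists_analytic_branch
  refine ⟨fun b => resolv (sineVec rho 1 - Y b), fun b => (64 : ℂ) • Y b, fun b hb => ?_,
    fun b hb => ?_⟩
  · have h1 : AnalyticAt ℝ (fun b => sineVec rho 1 - Y b) b := analyticAt_const.sub (hYa b hb)
    have h2 : AnalyticAt ℝ (fun b => resolv (sineVec rho 1 - Y b)) b :=
      ((resolv.restrictScalars ℝ).analyticAt _).comp h1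
    exact h2.prod ((((64 : ℂ) • ContinuousLinearMap.id ℂ SineSpace).restrictScalars ℝ).analyticAt _
      |>.comp (hYa b hb))
  obtain ⟨hr, h0, hD⟩ := hY b hb
  set y := Y b
  have hru : resolv (sineVec rho 1 - y) ∈ realOdd :=
    resolv_mem_realOdd (realOdd.sub_mem (sineVec_mem_realOdd rho (by decide)) hr)
  have hrv : (64 : ℂ) • y ∈ realOdd := smul_mem_realOdd (by norm_num) hr
  have hst : IsStationarySolution b (resolv (sineVec rho 1 - y)).toFun ((64 : ℂ) • y).toFun := by
    have := isStationarySolution_of_cubic_eq_zero rho h0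
    simpa only [← toFun_eq_evalAt] using this
  have hsym : IsReflectionSymmetric (resolv (sineVec rho 1 - y)).toFun ((64 : ℂ) • y).toFun := by
    intro x _
    simp only [toFun_eq_evalAt]
    exact ⟨evalAt_pi_sub_of_mem_realOdd rho hru x, evalAt_pi_sub_of_mem_realOdd rho hrv x⟩
  have h0' : cubic invLap resolv (mul3 1) (sineVec 1 1) b (toUnweighted rho y) = 0 := by
    rw [← toUnweighted_cubic, h0, map_zero]
  obtain ⟨ε, hε, huniq⟩ := exists_eqOn_of_uniformlyClose h0' hD
    (U := (resolv (sineVec rho 1 - y)).toFun) (V := ((64 : ℂ) • y).toFun) (fun x => by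
      have hR : ∀ f, toUnweighted rho (resolv f) = resolv (toUnweighted rho f) :=
        toUnweighted_diag rho _ _ _
      rw [toFun_eq_evalAt, ← evalAt_toUnweighted, hR, map_sub, toUnweighted_sineVec])
    (fun x => by rw [toFun_eq_evalAt, ← evalAt_toUnweighted, map_smul])
  have hclose : UniformlyClose ε (resolv (sineVec rho 1 - y)).toFun ((64 : ℂ) • y).toFun
      (resolv (sineVec rho 1 - y)).toFun ((64 : ℂ) • y).toFun := fun x _ => by simpa using hε
  refine ⟨fun x => ?_, analyticOnNhd_toFun _, analyticOnNhd_toFun _, hst, hsym, ?_, ?_⟩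
  · simp only [toFun_eq_evalAt]
    exact ⟨evalAt_im_of_mem_realOdd rho hru x, evalAt_im_of_mem_realOdd rho hrv x⟩
  -- Compare with the branch itself.
  · exact ⟨ε, hε, fun u' v' h' hc => huniq b (by simpa using hε) _ _ _ _ h' hst hc hclose⟩
  -- Compare a solution with its reflection, which is equally close to the symmetric branch.
  · intro hbif
    obtain ⟨b', hb', u, v, huv, hc, hns⟩ := hbif ε hε
    refine hns fun x hx => ?_
    have hrefl : ∀ x ∈ Icc 0 Real.pi, Real.pi - x ∈ Icc 0 Real.pi := fun x hx =>
      ⟨by linarith [hx.2], by linarith [hx.1]⟩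
    have hc' : UniformlyClose ε (resolv (sineVec rho 1 - y)).toFun ((64 : ℂ) • y).toFun
        (fun x => u (Real.pi - x)) (fun x => v (Real.pi - x)) := fun x hx => by
      have h1 := hc _ (hrefl x hx)
      rwa [(hsym x hx).1, (hsym x hx).2] at h1
    obtain ⟨e1, e2⟩ := huniq b' hb' _ _ _ _ huv.reflect huv hc' hc
    exact ⟨e1 hx, e2 hx⟩
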